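/- **Setting.** Work over $\mathbb{C}(q)$, let $\iota=\sqrt{-1}\in\mathbb C$, and put $[n]=\frac{q^n-q^{-n}}{q-q^{-1}}$ and $[\mu;n]=\frac{q^n\mu-q^{-n}\mu^{-1}}{q-q^{-1}}$ for $n\in\mathbb{Z}$, $\mu\in\mathbb{C}(q)^*$. Consider the oriented chain of vertices $\bar 1\xrightarrow{\;1\;}\bar\diamondsuit\xrightarrow{\;0\;}\diamondsuit\xrightarrow{\,-1\,}1$ with edges labelled $1,0,-1$. Let $U_q(\mathfrak{gl}_4)$ be the $\mathbb{C}(q)$-algebra generated by $E_i,F_i$ ($i$ an edge) and pairwise commuting invertible $D_j$ ($j$ a vertex) such that $D_jE_iD_j^{-1}=q^{\delta_{s(i),j}-\delta_{t(i),j}}E_i$ and $D_jF_iD_j^{-1}=q^{\delta_{t(i),j}-\delta_{s(i),j}}F_i$, where $s(i),t(i)$ are the source and target of $i$; $[E_i,F_{i'}]=\delta_{ii'}\frac{K_i-K_i^{-1}}{q-q^{-1}}$ with $K_i=D_{s(i)}D_{t(i)}^{-1}$; and, both for the $E$'s and for the $F$'s, $E_iE_{i'}=E_{i'}E_i$ if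 $i,i'$ are not adjacent and $E_i^2E_{i'}-[2]E_iE_{i'}E_i+E_{i'}E_i^2=0$ if they are adjacent. Let $U_q'\subset U_q(\mathfrak{gl}_4)$ be the quantum symmetric pair coideal subalgebra generated by $$B_{\pm1}=F_{\pm1}+E_{\mp1}K_{\pm1}^{-1},\quad B_0=F_0+q^{-1}E_0K_0^{-1},\quad \hat D_\diamondsuit^{\pm1}=(D_\diamondsuit D_{\bar\diamondsuit})^{\pm1},\quad \hat D_1^{\pm1}=(D_1D_{\bar1})^{\pm1}.$$ Write $[a,b]_p=ab-p\,ba$ and $X=[B_0,B_1]_{q^{-1}}$, $Y=[B_0,B_{-1}]_{q^{-1}}$, $Z=[B_1,Y]_{q^{-1}}$. For $\kappa_\diamondsuit,\kappa_1\in\mathbb{Z}$ and $\beta,\zeta\in\mathbb{C}(q)$ the Verma module $\mathbb{M}(\kappa_\diamondsuit,\kappa_1,\beta,\zeta)$ is the $U_q'$-module induced from the one-dimensional module of the subalgebra generated by $B_1,X,\hat D_\diamondsuit^{\pm1},\hat D_1^{\pm1},B_0,Z$ on which $B_1,X$ act by $0$ and $\hat D_\diamondsuit,\hat D_1,B_0,Z$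 act by $q^{\kappa_\diamondsuit},q^{\kappa_1},\beta,\zeta$. For $\mu\in\mathbb{C}(q)^*$ the Verma module $\mathbb{M}(\kappa_\diamondsuit,\kappa_1,[\mu;0],\zeta)$ is called good if $\mu\neq\pm q^l\iota$ for all $l\in\mathbb{Z}$. **Corollary (BGG resolutions).** Let $\kappa_\diamondsuit,\kappa_1\in\mathbb{Z}$, $\kappa=\kappa_\diamondsuit-\kappa_1$, $\mu\in\mathbb{C}(q)^*$, $\zeta\in\mathbb{C}(q)$. Assume that $M=\mathbb{M}(\kappa_\diamondsuit,\kappa_1,[\mu;0],\zeta)$ is good and that its highest weight is dominant, i.e. $$\zeta=[\mu;\kappa-2i]-q^{-\kappa}[\mu;0]\quad\text{for some }i\in\mathbb{Z}\text{ with }0\le i\le\kappa .$$ Then $M$ has a unique irreducible quotient $L$, it is finite-dimensional, and there is an exact sequence of $U_q'$-modules $$0\to M_3\to M_1\oplus M_2\to M\to L\to 0,$$ whose last map is the quotient map, where $$\begin{aligned} M_1&=\mathbb{M}(\kappa_\diamondsuit-i-1,\;\kappa_1+i+1,\;[\mu;-(i+1)],\;\zeta_1'),&\zeta_1'&=\mu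 q[\kappa-i]+\mu^{-1}q^{2i+1-\kappa}[i+2],\\ M_2&=\mathbb{M}(\kappa_1+i-1,\;\kappa_\diamondsuit-i+1,\;[\mu;\kappa-i+1],\;\zeta_2'),&\zeta_2'&=-\mu q^{\kappa-2i+1}[\kappa-i+2]-\mu^{-1}q[i],\\ M_3&=\mathbb{M}(\kappa_1-2,\;\kappa_\diamondsuit+2,\;[\mu;\kappa-2i],\;\zeta_3'),&\zeta_3'&=q^{\kappa+2}\bigl(\mu^{-1}q^{i-\kappa}[i+2]-\mu q^{-i}[\kappa-i+2]\bigr). \end{aligned}$$ -/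

import Mathlib

noncomputable section

namespace QSP

/-! ### Ground field and quantum integers -/

/-- The ground field `ℂ(q)`. -/
abbrev Kq : Type := RatFunc ℂ

/-- The indeterminate `q`. -/
def q : Kq := RatFunc.X

/-- The square root `ι` of `-1` in `ℂ ⊆ ℂ(q)`. -/
def iota : Kq := RatFunc.C Complex.I

/-- `[μ;n] = (μ qⁿ - μ⁻¹ q⁻ⁿ) / (q - q⁻¹)`, used for `μ ≠ 0`. -/
def qbr (μ : Kq) (n : ℤ) : Kq := (q ^ n * μ - q ^ (-n) * μ⁻¹) / (q - q⁻¹)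

/-- The quantum integer `[n] = (qⁿ - q⁻ⁿ) / (q - q⁻¹)`. -/
def qint (n : ℤ) : Kq := (q ^ n - q ^ (-n)) / (q - q⁻¹)

/-! ### The quantum group `U_q(𝔤𝔩₄)`

It is attached to the linearly oriented graph with vertices `-1, -◇, ◇, 1` (in this order) and
with edges `1 : -1 → -◇`, `0 : -◇ → ◇`, `-1 : ◇ → 1`. -/

/-- The vertices `-1, -◇, ◇, 1`. -/
inductive Vertex : Type
  | negOne | negDia | dia | one
  deriving DecidableEq

/-- The edges, labelled by `-1, 0, 1`. -/
inductive Edge : Type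
  | neg | zero | pos
  deriving DecidableEq

/-- The source of an edge. -/
def Edge.source : Edge → Vertex
  | .pos => .negOne
  | .zero => .negDia
  | .neg => .dia

/-- The target of an edge. -/
def Edge.target : Edge → Vertex
  | .pos => .negDia
  | .zero => .dia
  | .neg => .one

/-- Two distinct edges are adjacent if they share a vertex. -/
def Edge.Adjacent (i j : Edge) : Prop := i.target = j.source ∨ j.target = i.source

/-- The symbols `E_i`, `F_i`, `D_j`, `D_j⁻¹`. -/
inductive Gen : Type
  | E (i : Edge) | F (i : Edge) | D (j : Vertex) | Dinv (j : Vertex)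

/-- `E_i` in the free algebra. -/
abbrev preE (i : Edge) : FreeAlgebra Kq Gen := FreeAlgebra.ι Kq (Gen.E i)
/-- `F_i` in the free algebra. -/
abbrev preF (i : Edge) : FreeAlgebra Kq Gen := FreeAlgebra.ι Kq (Gen.F i)
/-- `D_j` in the free algebra. -/
abbrev preD (j : Vertex) : FreeAlgebra Kq Gen := FreeAlgebra.ι Kq (Gen.D j)
/-- `D_j⁻¹` in the free algebra. -/
abbrev preDinv (j : Vertex) : FreeAlgebra Kq Gen := FreeAlgebra.ι Kq (Gen.Dinv j)

/-- The exponent `δ_{source i, j} - δ_{target i, j}`. -/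
def wt (i : Edge) (j : Vertex) : ℤ :=
  (if i.source = j then 1 else 0) - (if i.target = j then 1 else 0)

/-- The defining relations of `U_q(𝔤𝔩₄)`; here `K_i = D_{source i} D_{target i}⁻¹`. -/
inductive Rel : FreeAlgebra Kq Gen → FreeAlgebra Kq Gen → Prop
  | D_Dinv (j : Vertex) : Rel (preD j * preDinv j) 1
  | Dinv_D (j : Vertex) : Rel (preDinv j * preD j) 1
  | D_comm (j k : Vertex) : Rel (preD j * preD k) (preD k * preD j)
  | D_E (j : Vertex) (i : Edge) : Rel (preD j * preE i * preDinv j) (q ^ wt i j • preE i)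
  | D_F (j : Vertex) (i : Edge) : Rel (preD j * preF i * preDinv j) (q ^ (-wt i j) • preF i)
  | E_F_same (i : Edge) :
      Rel (preE i * preF i - preF i * preE i)
        ((q - q⁻¹)⁻¹ • (preD i.source * preDinv i.target - preD i.target * preDinv i.source))
  | E_F_ne (i j : Edge) (h : i ≠ j) : Rel (preE i * preF j - preF j * preE i) 0
  | E_comm (i j : Edge) (h : ¬ i.Adjacent j) : Rel (preE i * preE j) (preE j * preE i)
  | F_comm (i j : Edge) (h : ¬ i.Adjacent j) : Rel (preF i * preF j) (preF j * preF i)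
  | E_serre (i j : Edge) (h : i.Adjacent j) :
      Rel (preE i * preE i * preE j - qint 2 • (preE i * preE j * preE i)
        + preE j * preE i * preE i) 0
  | F_serre (i j : Edge) (h : i.Adjacent j) :
      Rel (preF i * preF i * preF j - qint 2 • (preF i * preF j * preF i)
        + preF j * preF i * preF i) 0

/-- The quantum group `U_q(𝔤𝔩₄)` over `ℂ(q)`. -/
def Uq : Type := RingQuot Rel

instance : Ring Uq := inferInstanceAs (Ring (RingQuot Rel))
instance : Algebra Kq Uq := inferInstanceAs (Algebra Kq (RingQuot Rel))

namespace Uq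

/-- The image of a generator in `U_q(𝔤𝔩₄)`. -/
def gen (g : Gen) : Uq := RingQuot.mkAlgHom Kq Rel (FreeAlgebra.ι Kq g)

/-- The generator `E_i`. -/
def E (i : Edge) : Uq := gen (.E i)
/-- The generator `F_i`. -/
def F (i : Edge) : Uq := gen (.F i)
/-- The generator `D_j`. -/
def D (j : Vertex) : Uq := gen (.D j)
/-- The generator `D_j⁻¹`. -/
def Dinv (j : Vertex) : Uq := gen (.Dinv j)

/-- `K_i⁻¹`, where `K_i = D_{source i} D_{target i}⁻¹`. -/
def Kinv (i : Edge) : Uq := D i.target * Dinv i.source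

/-- `B_1 = F_1 + E_{-1} K_1⁻¹`. -/
def BPos : Uq := F .pos + E .neg * Kinv .pos
/-- `B_{-1} = F_{-1} + E_1 K_{-1}⁻¹`. -/
def BNeg : Uq := F .neg + E .pos * Kinv .neg
/-- `B_0 = F_0 + q⁻¹ E_0 K_0⁻¹`. -/
def BZero : Uq := F .zero + q⁻¹ • (E .zero * Kinv .zero)
/-- `D̂_◇ = D_◇ D_{-◇}`. -/
def DhatDia : Uq := D .dia * D .negDia
/-- The inverse of `D̂_◇`. -/
def DhatDiaInv : Uq := Dinv .negDia * Dinv .dia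
/-- `D̂_1 = D_1 D_{-1}`. -/
def DhatOne : Uq := D .one * D .negOne
/-- The inverse of `D̂_1`. -/
def DhatOneInv : Uq := Dinv .negOne * Dinv .one

end Uq

/-! ### The quantum symmetric pair coideal subalgebra `U_q' = U_q'(𝔤𝔩₂ × 𝔤𝔩₂)` -/

/-- The subalgebra `U_q'` of `U_q(𝔤𝔩₄)`. -/
def Uq' : Subalgebra Kq Uq :=
  Algebra.adjoin Kq
    {Uq.BPos, Uq.BNeg, Uq.BZero, Uq.DhatDia, Uq.DhatDiaInv, Uq.DhatOne, Uq.DhatOneInv}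

namespace Uq'

/-- `B_1` as an element of `U_q'`. -/
def B1 : Uq' := ⟨Uq.BPos, Algebra.subset_adjoin (by simp)⟩
/-- `B_{-1}` as an element of `U_q'`. -/
def Bm1 : Uq' := ⟨Uq.BNeg, Algebra.subset_adjoin (by simp)⟩
/-- `B_0` as an element of `U_q'`. -/
def B0 : Uq' := ⟨Uq.BZero, Algebra.subset_adjoin (by simp)⟩
/-- `D̂_◇` as an element of `U_q'`. -/
def Ddia : Uq' := ⟨Uq.DhatDia, Algebra.subset_adjoin (by simp)⟩
/-- `D̂_1` as an element of `U_q'`. -/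
def D1 : Uq' := ⟨Uq.DhatOne, Algebra.subset_adjoin (by simp)⟩

/-- The commutator `[a,b]_p = ab - p ba`. -/
def comm (p : Kq) (a b : Uq') : Uq' := a * b - p • (b * a)

/-- `X = [B_0, B_1]_{q⁻¹}`. -/
def X : Uq' := comm q⁻¹ B0 B1
/-- `Y = [B_0, B_{-1}]_{q⁻¹}`. -/
def Y : Uq' := comm q⁻¹ B0 Bm1
/-- `Z = [B_1, Y]_{q⁻¹}`. -/
def Z : Uq' := comm q⁻¹ B1 Y

end Uq'

/-! ### Verma modules -/

open Uq' in
/-- The left ideal of `U_q'` generated by `B_1`, `X`, `D̂_◇ - q^{κ_◇}`, `D̂_1 - q^{κ_1}`, `B_0 - β`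
and `Z - ζ`. These six elements generate, as a left ideal, the kernel of the character
of the subalgebra `U_+' U_0' = ⟨B_1, X, D̂_◇^{±1}, D̂_1^{±1}, B_0, Z⟩` that sends `B_1, X` to `0` and
`D̂_◇, D̂_1, B_0, Z` to `q^{κ_◇}, q^{κ_1}, β, ζ`. -/
def vermaIdeal (kd k1 : ℤ) (β ζ : Kq) : Submodule Uq' Uq' :=
  Submodule.span Uq'
    {B1, X, Ddia - algebraMap Kq Uq' (q ^ kd), D1 - algebraMap Kq Uq' (q ^ k1),
      B0 - algebraMap Kq Uq' β, Z - algebraMap Kq Uq' ζ}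

/-- The Verma module `𝕄(κ_◇, κ_1, β, ζ)` of `U_q'`: the module induced from the
one-dimensional module `ℂ(q)_{(κ_◇, κ_1, β, ζ)}` of the subalgebra `U_+' U_0'`. For a ring `U`, a
subring `S` and a left ideal `J` of `S` one has `U ⊗_S (S / J) = U / U J`, which for the kernel `J`
of the character is the quotient of `U_q'` by the left ideal `vermaIdeal`. -/
abbrev Verma (kd k1 : ℤ) (β ζ : Kq) : Type := Uq' ⧸ vermaIdeal kd k1 β ζ

/-- The Verma module `𝕄(κ_◇, κ_1, [μ;0], ζ)` is good if `μ ≠ ± q^l ι` for every integer `l`. -/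
def IsGood (μ : Kq) : Prop := ∀ l : ℤ, μ ≠ q ^ l * iota ∧ μ ≠ -(q ^ l * iota)

/-- `ζ'_{1,j} = μ q [κ-j] + μ⁻¹ q^{2j+1-κ} [j+2]`. -/
def zeta1 (κ : ℤ) (μ : Kq) (j : ℤ) : Kq :=
  μ * q * qint (κ - j) + μ⁻¹ * q ^ (2 * j + 1 - κ) * qint (j + 2)

/-- `ζ'_{2,j} = - μ q^{2j+1-κ} [j+2] - μ⁻¹ q [κ-j]`. -/
def zeta2 (κ : ℤ) (μ : Kq) (j : ℤ) : Kq :=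
  -(μ * q ^ (2 * j + 1 - κ) * qint (j + 2)) - μ⁻¹ * q * qint (κ - j)

/-- `ζ'_{3,j} = q^{κ+2} (μ⁻¹ q^{j-κ} [j+2] - μ q^{-j} [κ-j+2])`. -/
def zeta3 (κ : ℤ) (μ : Kq) (j : ℤ) : Kq :=
  q ^ (κ + 2) * (μ⁻¹ * q ^ (j - κ) * qint (j + 2) - μ * q ^ (-j) * qint (κ - j + 2))

end QSP

end

/-!
In a good Verma module `B_0` is diagonalizable: corrected by multiples of `[B_0, B_{-1}]_{q⁻¹}`, the
operator `B_{-1}` splits into two ladder operators, which shift the parameter `μ` of the eigenvalue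
`[μ; 0]` by `q⁻¹` and by `q`. The ladder vectors of a highest weight vector are indexed by
`(m, n) ∈ ℕ × ℕ`; `B_1` lowers `m` or `n` by one, with explicit coefficients which, for
`ζ = [μ; κ - 2i] - q^{-κ} [μ; 0]`, vanish exactly at `m = 0`, `m = i + 1`, `n = 0`, `n = κ - i + 1`.

That these formulas define a module with basis `ℕ × ℕ`, the Fock space, is not checked against a
presentation of `U_q'`. Tensor products of characters with copies of the natural representation
contain highest weight vectors for all `s = i ≥ 0` and `t = κ - i ≥ 0`, and their ladder vectors
with `m ≤ s`, `n ≤ t` are linearly independent. Hence every relation of `U_q'` holds on a given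
basis vector of the Fock space for all large `s` and `t`, and, its matrix coefficients being
Laurent polynomials in `q^s` and `q^t`, for all `s` and `t`. By the universal property, good Verma
modules are Fock spaces.

The vectors at `(i + 1, 0)`, `(0, κ - i + 1)` and `(i + 1, κ - i + 1)` are singular, and the
quadrants above them are copies of `M_1`, `M_2` and `M_3`. The maximal submodule of `M` is the sum
of the first two quadrants, whose intersection is the third, and the resolution is
inclusion–exclusion.
-/

noncomputable section

namespace QSP

open scoped TensorProduct Matrix

/-! ### The indeterminate and quantum integers -/

theorem q_ne_zero : q ≠ 0 := RatFunc.X_ne_zero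

theorem q_pow_ne_one {n : ℕ} (hn : n ≠ 0) : q ^ n ≠ 1 := fun h =>
  (RatFunc.transcendental_X (K := ℂ)).pow (Nat.pos_of_ne_zero hn) (h ▸ isAlgebraic_one)

theorem q_zpow_eq_one_iff {n : ℤ} : q ^ n = 1 ↔ n = 0 := by
  refine ⟨fun h => ?_, fun h => by rw [h, zpow_zero]⟩
  by_contra hn
  refine q_pow_ne_one (Int.natAbs_ne_zero.mpr hn) ?_
  rcases Int.natAbs_eq n with habs | habs <;> rw [habs] at h
  · rwa [zpow_natCast] at h
  · rwa [zpow_neg, zpow_natCast, inv_eq_one] at h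

theorem q_zpow_injective : Function.Injective fun n : ℤ => q ^ n := fun m n h => by
  have hdiv : q ^ (m - n) = 1 := by
    rw [zpow_sub₀ q_ne_zero]
    exact (div_eq_one_iff_eq (zpow_ne_zero _ q_ne_zero)).mpr h
  exact sub_eq_zero.mp (q_zpow_eq_one_iff.mp hdiv)

theorem q_sq_sub_one_ne_zero : q ^ 2 - 1 ≠ 0 := sub_ne_zero.mpr (q_pow_ne_one two_ne_zero)

theorem q_sub_inv_ne_zero : q - q⁻¹ ≠ 0 := fun h => q_sq_sub_one_ne_zero <| by
  have := q_ne_zero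
  field_simp at h
  rwa [mul_zero] at h

theorem qint_two : qint 2 = q + q⁻¹ := by
  have := q_ne_zero
  rw [qint, div_eq_iff q_sub_inv_ne_zero, zpow_neg, zpow_ofNat]
  field_simp
  ring

/-! ### Chevalley generators -/

section Serre

variable {K A : Type*} [Field K] [Ring A] [Algebra K A]

/-- The quantum Serre expression `x² y - (q + q⁻¹) x y x + y x²`. -/
def serreExpr (q : K) (x y : A) : A :=
  x * (x * y) - (q + q⁻¹) • (x * (y * x)) + y * (x * x)

end Serre

section Weight

variable {K A : Type*} [Field K] [Ring A] [Algebra K A] {q : K} {c d d' x y : A} {m n : ℤ}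

theorem qCommute_mul_left (hq : q ≠ 0) (h : d * x = q ^ m • (x * d))
    (h' : d' * x = q ^ n • (x * d')) : d * d' * x = q ^ (m + n) • (x * (d * d')) := by
  rw [mul_assoc, h', mul_smul_comm, ← mul_assoc, h, smul_mul_assoc, smul_smul, mul_assoc,
    zpow_add₀ hq, mul_comm]

theorem qCommute_mul_right_of_commute (h : d * x = q ^ n • (x * d)) (hc : Commute d c) :
    d * (x * c) = q ^ n • (x * c * d) := by
  rw [← mul_assoc, h, smul_mul_assoc, mul_assoc, hc.eq, mul_assoc]

theorem qCommute_inv_left (hq : q ≠ 0) (h₁ : d * d' = 1) (h₂ : d' * d = 1)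
    (h : d * x = q ^ n • (x * d)) : d' * x = q ^ (-n) • (x * d') := by
  have hconj : q ^ n • (d' * x) = x * d' := by
    calc q ^ n • (d' * x) = d' * (q ^ n • (x * d)) * d' := by
          rw [mul_smul_comm, smul_mul_assoc, mul_assoc, mul_assoc, h₁, mul_one]
      _ = x * d' := by rw [← h, ← mul_assoc, h₂, one_mul]
  rw [← hconj, smul_smul, ← zpow_add₀ hq, neg_add_cancel, zpow_zero, one_smul]

theorem qCommute_add_right (h : d * x = q ^ n • (x * d)) (h' : d * y = q ^ n • (y * d)) :
    d * (x + y) = q ^ n • ((x + y) * d) := by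
  rw [mul_add, add_mul, h, h', smul_add]

end Weight

theorem Edge.Adjacent.symm {i j : Edge} (h : i.Adjacent j) : j.Adjacent i := Or.symm h

instance (i j : Edge) : Decidable (i.Adjacent j) :=
  inferInstanceAs (Decidable (i.target = j.source ∨ j.target = i.source))

/-- Elements `e i`, `f i`, `d j`, `d' j` of an algebra which satisfy the defining relations of
the generators `E_i`, `F_i`, `D_j`, `D_j⁻¹` of `U_q(𝔤𝔩₄)`, the weight relations being written
without inverses. -/
structure IsChevalley {A : Type*} [Ring A] [Algebra Kq A] (e f : Edge → A) (d d' : Vertex → A) :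
    Prop where
  d_mul_inv (j : Vertex) : d j * d' j = 1
  inv_mul_d (j : Vertex) : d' j * d j = 1
  d_commute (j k : Vertex) : Commute (d j) (d k)
  d_mul_e (j : Vertex) (i : Edge) : d j * e i = q ^ wt i j • (e i * d j)
  d_mul_f (j : Vertex) (i : Edge) : d j * f i = q ^ (-wt i j) • (f i * d j)
  e_mul_f_self (i : Edge) : e i * f i - f i * e i =
    (q - q⁻¹)⁻¹ • (d i.source * d' i.target - d i.target * d' i.source)
  e_commute_f {i j : Edge} (h : i ≠ j) : Commute (e i) (f j)
  e_commute {i j : Edge} (hne : i ≠ j) (h : ¬i.Adjacent j) : Commute (e i) (e j)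
  f_commute {i j : Edge} (hne : i ≠ j) (h : ¬i.Adjacent j) : Commute (f i) (f j)
  e_serre {i j : Edge} (h : i.Adjacent j) : serreExpr q (e i) (e j) = 0
  f_serre {i j : Edge} (h : i.Adjacent j) : serreExpr q (f i) (f j) = 0

namespace IsChevalley

variable {A : Type*} [Ring A] [Algebra Kq A] {e f : Edge → A} {d d' : Vertex → A}

theorem conj_e (h : IsChevalley e f d d') (j : Vertex) (i : Edge) :
    d j * e i * d' j = q ^ wt i j • e i := by
  rw [h.d_mul_e, smul_mul_assoc, mul_assoc, h.d_mul_inv, mul_one]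

theorem conj_f (h : IsChevalley e f d d') (j : Vertex) (i : Edge) :
    d j * f i * d' j = q ^ (-wt i j) • f i := by
  rw [h.d_mul_f, smul_mul_assoc, mul_assoc, h.d_mul_inv, mul_one]

/-- The values on the generators of the homomorphism `U_q(𝔤𝔩₄) → A` defined by elements
`e`, `f`, `d`, `d'` of `A`. -/
def onGen (e f : Edge → A) (d d' : Vertex → A) : Gen → A
  | .E i => e i
  | .F i => f i
  | .D j => d j
  | .Dinv j => d' j

theorem lift_onGen_eq (h : IsChevalley e f d d') ⦃x y : FreeAlgebra Kq Gen⦄ (hxy : Rel x y) :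
    FreeAlgebra.lift Kq (onGen e f d d') x = FreeAlgebra.lift Kq (onGen e f d d') y := by
  have commute_of_not_adjacent : ∀ {g : Edge → A} {i j : Edge},
      (i ≠ j → Commute (g i) (g j)) → g i * g j = g j * g i := fun {g i j} hc => by
    rcases eq_or_ne i j with rfl | hne
    exacts [rfl, hc hne]
  cases hxy <;> simp only [map_mul, map_sub, map_add, map_smul, map_one, map_zero,
    FreeAlgebra.lift_ι_apply, onGen]
  case D_Dinv j => exact h.d_mul_inv j
  case Dinv_D j => exact h.inv_mul_d j
  case D_comm j k => exact h.d_commute j k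
  case D_E j i => exact h.conj_e j i
  case D_F j i => exact h.conj_f j i
  case E_F_same i => exact h.e_mul_f_self i
  case E_F_ne i j hij => exact sub_eq_zero.mpr (h.e_commute_f hij)
  case E_comm i j hij => exact commute_of_not_adjacent fun hne => h.e_commute hne hij
  case F_comm i j hij => exact commute_of_not_adjacent fun hne => h.f_commute hne hij
  case E_serre i j hij => simpa only [serreExpr, mul_assoc, qint_two] using h.e_serre hij
  case F_serre i j hij => simpa only [serreExpr, mul_assoc, qint_two] using h.f_serre hij

/-- The universal property of `U_q(𝔤𝔩₄)`. -/
def lift (h : IsChevalley e f d d') : Uq →ₐ[Kq] A :=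
  RingQuot.liftAlgHom Kq ⟨FreeAlgebra.lift Kq (onGen e f d d'), h.lift_onGen_eq⟩

theorem lift_gen (h : IsChevalley e f d d') (g : Gen) : h.lift (Uq.gen g) = onGen e f d d' g :=
  (RingQuot.liftAlgHom_mkAlgHom_apply Kq _ h.lift_onGen_eq _).trans (FreeAlgebra.lift_ι_apply _ _)

theorem lift_E (h : IsChevalley e f d d') (i : Edge) : h.lift (Uq.E i) = e i := h.lift_gen _
theorem lift_F (h : IsChevalley e f d d') (i : Edge) : h.lift (Uq.F i) = f i := h.lift_gen _
theorem lift_D (h : IsChevalley e f d d') (j : Vertex) : h.lift (Uq.D j) = d j := h.lift_gen _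
theorem lift_Dinv (h : IsChevalley e f d d') (j : Vertex) : h.lift (Uq.Dinv j) = d' j :=
  h.lift_gen _

end IsChevalley

namespace Uq

/-- The projection from the free algebra on the generators. -/
def proj : FreeAlgebra Kq Gen →ₐ[Kq] Uq := RingQuot.mkAlgHom Kq Rel

theorem proj_eq_of_rel {x y : FreeAlgebra Kq Gen} (h : Rel x y) : proj x = proj y :=
  RingQuot.mkAlgHom_rel Kq h

theorem proj_E (i : Edge) : proj (preE i) = E i := rfl
theorem proj_F (i : Edge) : proj (preF i) = F i := rfl
theorem proj_D (j : Vertex) : proj (preD j) = D j := rfl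
theorem proj_Dinv (j : Vertex) : proj (preDinv j) = Dinv j := rfl

theorem D_mul_Dinv (j : Vertex) : D j * Dinv j = 1 := by
  simpa only [map_mul, map_one, proj_D, proj_Dinv] using proj_eq_of_rel (Rel.D_Dinv j)

theorem Dinv_mul_D (j : Vertex) : Dinv j * D j = 1 := by
  simpa only [map_mul, map_one, proj_D, proj_Dinv] using proj_eq_of_rel (Rel.Dinv_D j)

theorem D_mul_eq_of_conj {x y : Uq} {j : Vertex} (h : D j * x * Dinv j = y) :
    D j * x = y * D j := by
  rw [← h, mul_assoc _ (Dinv j), Dinv_mul_D, mul_one]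

theorem isChevalley : IsChevalley E F D Dinv where
  d_mul_inv := D_mul_Dinv
  inv_mul_d := Dinv_mul_D
  d_commute j k := by
    simpa only [map_mul, proj_D, commute_iff_eq] using proj_eq_of_rel (Rel.D_comm j k)
  d_mul_e j i := by
    rw [← smul_mul_assoc]
    exact D_mul_eq_of_conj (by
      simpa only [map_mul, map_smul, proj_D, proj_E, proj_Dinv] using
        proj_eq_of_rel (Rel.D_E j i))
  d_mul_f j i := by
    rw [← smul_mul_assoc]
    exact D_mul_eq_of_conj (by
      simpa only [map_mul, map_smul, proj_D, proj_F, proj_Dinv] using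
        proj_eq_of_rel (Rel.D_F j i))
  e_mul_f_self i := by
    simpa only [map_mul, map_sub, map_smul, proj_E, proj_F, proj_D, proj_Dinv] using
      proj_eq_of_rel (Rel.E_F_same i)
  e_commute_f {i j} h := by
    simpa only [map_mul, map_sub, map_zero, proj_E, proj_F, sub_eq_zero, commute_iff_eq] using
      proj_eq_of_rel (Rel.E_F_ne i j h)
  e_commute {i j} _ h := by
    simpa only [map_mul, proj_E, commute_iff_eq] using proj_eq_of_rel (Rel.E_comm i j h)
  f_commute {i j} _ h := by
    simpa only [map_mul, proj_F, commute_iff_eq] using proj_eq_of_rel (Rel.F_comm i j h)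
  e_serre {i j} h := by
    simpa only [serreExpr, map_mul, map_sub, map_add, map_smul, map_zero, proj_E, mul_assoc,
      qint_two] using proj_eq_of_rel (Rel.E_serre i j h)
  f_serre {i j} h := by
    simpa only [serreExpr, map_mul, map_sub, map_add, map_smul, map_zero, proj_F, mul_assoc,
      qint_two] using proj_eq_of_rel (Rel.F_serre i j h)

theorem D_commute (j k : Vertex) : Commute (D j) (D k) := isChevalley.d_commute j k

theorem D_commute_Dinv (j k : Vertex) : Commute (D j) (Dinv k) :=
  Commute.units_inv_right (u := ⟨D k, Dinv k, D_mul_Dinv k, Dinv_mul_D k⟩) (D_commute j k)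

theorem Dinv_commute (j k : Vertex) : Commute (Dinv j) (Dinv k) :=
  Commute.units_inv_left (u := ⟨D j, Dinv j, D_mul_Dinv j, Dinv_mul_D j⟩) (D_commute_Dinv j k)

theorem D_mul_E (j : Vertex) (i : Edge) : D j * E i = q ^ wt i j • (E i * D j) :=
  isChevalley.d_mul_e j i

theorem D_mul_F (j : Vertex) (i : Edge) : D j * F i = q ^ (-wt i j) • (F i * D j) :=
  isChevalley.d_mul_f j i

theorem Dinv_mul_E (j : Vertex) (i : Edge) : Dinv j * E i = q ^ (-wt i j) • (E i * Dinv j) :=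
  qCommute_inv_left q_ne_zero (D_mul_Dinv j) (Dinv_mul_D j) (D_mul_E j i)

theorem Dinv_mul_F (j : Vertex) (i : Edge) : Dinv j * F i = q ^ wt i j • (F i * Dinv j) := by
  simpa only [neg_neg] using
    qCommute_inv_left q_ne_zero (D_mul_Dinv j) (Dinv_mul_D j) (D_mul_F j i)

/-- `K_i = D_{source i} D_{target i}⁻¹`. -/
def K (i : Edge) : Uq := D i.source * Dinv i.target

/-- The entry `a_{ij}` of the Cartan matrix, so that `K_i E_j K_i⁻¹ = q^{a_{ij}} E_j`. -/
def cartan (i j : Edge) : ℤ := wt j i.source - wt j i.target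

theorem cartan_comm (i j : Edge) : cartan i j = cartan j i := by
  cases i <;> cases j <;> decide

theorem cartan_self (i : Edge) : cartan i i = 2 := by cases i <;> decide

theorem cartan_of_adjacent : ∀ {i j : Edge}, i.Adjacent j → cartan i j = -1 := by
  rintro (_ | _ | _) (_ | _ | _) <;> decide

theorem cartan_of_not_adjacent : ∀ {i j : Edge}, i ≠ j → ¬i.Adjacent j → cartan i j = 0 := by
  rintro (_ | _ | _) (_ | _ | _) <;> decide

theorem K_mul_E (i j : Edge) : K i * E j = q ^ cartan i j • (E j * K i) :=
  qCommute_mul_left q_ne_zero (D_mul_E _ _) (Dinv_mul_E _ _)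

theorem K_mul_F (i j : Edge) : K i * F j = q ^ (-cartan i j) • (F j * K i) := by
  rw [show -cartan i j = -wt j i.source + wt j i.target by unfold cartan; ring]
  exact qCommute_mul_left q_ne_zero (D_mul_F _ _) (Dinv_mul_F _ _)

theorem Kinv_mul_E (i j : Edge) : Kinv i * E j = q ^ (-cartan i j) • (E j * Kinv i) := by
  rw [show -cartan i j = wt j i.target + -wt j i.source by unfold cartan; ring]
  exact qCommute_mul_left q_ne_zero (D_mul_E _ _) (Dinv_mul_E _ _)

theorem Kinv_mul_F (i j : Edge) : Kinv i * F j = q ^ cartan i j • (F j * Kinv i) := by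
  rw [show cartan i j = -wt j i.target + wt j i.source by unfold cartan; ring]
  exact qCommute_mul_left q_ne_zero (D_mul_F _ _) (Dinv_mul_F _ _)

theorem D_commute_K (j : Vertex) (i : Edge) : Commute (D j) (K i) :=
  (D_commute _ _).mul_right (D_commute_Dinv _ _)

theorem D_commute_Kinv (j : Vertex) (i : Edge) : Commute (D j) (Kinv i) :=
  (D_commute _ _).mul_right (D_commute_Dinv _ _)

theorem K_commute (i j : Edge) : Commute (K i) (K j) :=
  (D_commute_K _ _).mul_left ((D_commute_Dinv _ _).symm.mul_right (Dinv_commute _ _))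

theorem Kinv_commute (i j : Edge) : Commute (Kinv i) (Kinv j) :=
  (D_commute_Kinv _ _).mul_left ((D_commute_Dinv _ _).symm.mul_right (Dinv_commute _ _))

theorem K_mul_Kinv (i : Edge) : K i * Kinv i = 1 := by
  rw [K, Kinv, mul_assoc, ← mul_assoc (Dinv i.target), Dinv_mul_D, one_mul, D_mul_Dinv]

theorem E_mul_F_self (i : Edge) : E i * F i - F i * E i = (q - q⁻¹)⁻¹ • (K i - Kinv i) :=
  isChevalley.e_mul_f_self i

theorem E_commute_F {i j : Edge} (h : i ≠ j) : Commute (E i) (F j) := isChevalley.e_commute_f h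

theorem E_commute {i j : Edge} (hne : i ≠ j) (h : ¬i.Adjacent j) : Commute (E i) (E j) :=
  isChevalley.e_commute hne h

theorem F_commute {i j : Edge} (hne : i ≠ j) (h : ¬i.Adjacent j) : Commute (F i) (F j) :=
  isChevalley.f_commute hne h

theorem serreExpr_E {i j : Edge} (h : i.Adjacent j) : serreExpr q (E i) (E j) = 0 :=
  isChevalley.e_serre h

theorem serreExpr_F {i j : Edge} (h : i.Adjacent j) : serreExpr q (F i) (F j) = 0 :=
  isChevalley.f_serre h

end Uq

/-! ### The coproduct -/

/-- Quantum Serre relations are additive over pairs which commute up to powers of `q`. -/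
theorem serreExpr_add_mul_eq_zero {K A : Type*} [Field K] [Ring A] [Algebra K A] {q : K}
    (hq : q ≠ 0) {a a' b b' k k' : A} (hkk : Commute k' k) (hba : Commute b a)
    (hba' : Commute b a') (hb'a : Commute b' a) (hbk : Commute b k) (hbk' : Commute b k')
    (hb'k : Commute b' k) (hka : k * a = q ^ (2 : ℤ) • (a * k))
    (hka' : k * a' = q ^ (-1 : ℤ) • (a' * k)) (hk'a : k' * a = q ^ (-1 : ℤ) • (a * k'))
    (ha : serreExpr q a a' = 0) (hb : serreExpr q b b' = 0) :
    serreExpr q (a + k * b) (a' + k' * b') = 0 := by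
  have assoc : ∀ {x y z : A}, x * y = z → ∀ w, x * (y * w) = z * w := fun h w => by
    rw [← mul_assoc, h]
  have hkkb := congrArg (fun z => k * (k * (k' * z))) hb
  simp only [serreExpr, mul_add, add_mul, mul_sub, mul_smul_comm, smul_mul_assoc, mul_assoc,
    mul_zero, smul_add, smul_smul, assoc hkk.eq, hba.eq, assoc hba.eq, hba'.eq, assoc hba'.eq,
    hb'a.eq, assoc hb'a.eq, assoc hbk.eq, assoc hbk'.eq, assoc hb'k.eq, assoc hka, assoc hka',
    assoc hk'a] at ha hkkb ⊢
  linear_combination (norm := skip) ha + hkkb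
  match_scalars <;> (try simp only [zpow_neg, zpow_ofNat]) <;> field_simp <;> ring

namespace Uq

/-- `Δ(E_i) = E_i ⊗ 1 + K_i ⊗ E_i`. -/
def comulE (i : Edge) : Uq ⊗[Kq] Uq := E i ⊗ₜ 1 + K i ⊗ₜ E i

/-- `Δ(F_i) = F_i ⊗ K_i⁻¹ + 1 ⊗ F_i`. -/
def comulF (i : Edge) : Uq ⊗[Kq] Uq := F i ⊗ₜ Kinv i + 1 ⊗ₜ F i

open Algebra.TensorProduct (tmul_mul_tmul)
open TensorProduct (tmul_smul smul_tmul' sub_tmul tmul_sub)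

theorem commute_tmul_one_one_tmul (x y : Uq) : Commute (x ⊗ₜ[Kq] (1 : Uq)) ((1 : Uq) ⊗ₜ[Kq] y) := by
  simp only [commute_iff_eq, tmul_mul_tmul, mul_one, one_mul]

theorem comulE_eq (i : Edge) : comulE i = E i ⊗ₜ 1 + (K i ⊗ₜ 1) * (1 ⊗ₜ E i) := by
  rw [tmul_mul_tmul, mul_one, one_mul, comulE]

theorem comulF_eq (i : Edge) : comulF i = 1 ⊗ₜ F i + (1 ⊗ₜ Kinv i) * (F i ⊗ₜ 1) := by
  rw [tmul_mul_tmul, mul_one, one_mul, comulF, add_comm]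

theorem comulE_mul_comulF_sub (i j : Edge) :
    comulE i * comulF j - comulF j * comulE i =
      (E i * F j - F j * E i) ⊗ₜ Kinv j + K i ⊗ₜ (E i * F j - F j * E i) := by
  have cross : (K i * F j) ⊗ₜ[Kq] (E i * Kinv j) = (F j * K i) ⊗ₜ (Kinv j * E i) := by
    rw [K_mul_F, Kinv_mul_E, cartan_comm j i, tmul_smul, smul_tmul']
  simp only [comulE, comulF, mul_add, add_mul, tmul_mul_tmul, mul_one, one_mul, cross, sub_tmul,
    tmul_sub]
  abel

theorem comulE_commute {i j : Edge} (hne : i ≠ j) (h : ¬i.Adjacent j) :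
    Commute (comulE i) (comulE j) := by
  have hK : ∀ {i j}, cartan i j = 0 → K i * E j = E j * K i := fun h => by
    rw [K_mul_E, h, zpow_zero, one_smul]
  have hij := cartan_of_not_adjacent hne h
  simp only [commute_iff_eq, comulE, mul_add, add_mul, tmul_mul_tmul, mul_one, one_mul,
    (E_commute hne h).eq, (K_commute i j).eq, hK hij, hK (cartan_comm j i ▸ hij)]
  abel

theorem comulF_commute {i j : Edge} (hne : i ≠ j) (h : ¬i.Adjacent j) :
    Commute (comulF i) (comulF j) := by
  have hK : ∀ {i j}, cartan i j = 0 → Kinv i * F j = F j * Kinv i := fun h => by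
    rw [Kinv_mul_F, h, zpow_zero, one_smul]
  have hij := cartan_of_not_adjacent hne h
  simp only [commute_iff_eq, comulF, mul_add, add_mul, tmul_mul_tmul, mul_one, one_mul,
    (F_commute hne h).eq, (Kinv_commute i j).eq, hK hij, hK (cartan_comm j i ▸ hij)]
  abel

theorem serreExpr_tmul_one (x y : Uq) :
    serreExpr q (x ⊗ₜ[Kq] (1 : Uq)) (y ⊗ₜ 1) = serreExpr q x y ⊗ₜ 1 := by
  simp only [serreExpr, tmul_mul_tmul, mul_one, smul_tmul', TensorProduct.add_tmul, sub_tmul]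

theorem serreExpr_one_tmul (x y : Uq) :
    serreExpr q ((1 : Uq) ⊗ₜ[Kq] x) (1 ⊗ₜ y) = 1 ⊗ₜ serreExpr q x y := by
  simp only [serreExpr, tmul_mul_tmul, mul_one, tmul_smul, TensorProduct.tmul_add, tmul_sub]

theorem serreExpr_comulE {i j : Edge} (h : i.Adjacent j) :
    serreExpr q (comulE i) (comulE j) = 0 := by
  have hK : ∀ {i j n}, cartan i j = n →
      K i ⊗ₜ[Kq] (1 : Uq) * E j ⊗ₜ 1 = q ^ n • (E j ⊗ₜ 1 * K i ⊗ₜ 1) := fun h => by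
    rw [tmul_mul_tmul, tmul_mul_tmul, K_mul_E, h, smul_tmul']
  rw [comulE_eq, comulE_eq]
  refine serreExpr_add_mul_eq_zero q_ne_zero ((K_commute j i).tmul (.one_left 1))
    (commute_tmul_one_one_tmul _ _).symm (commute_tmul_one_one_tmul _ _).symm
    (commute_tmul_one_one_tmul _ _).symm (commute_tmul_one_one_tmul _ _).symm
    (commute_tmul_one_one_tmul _ _).symm (commute_tmul_one_one_tmul _ _).symm
    (hK (cartan_self i)) (hK (cartan_of_adjacent h)) (hK (cartan_of_adjacent h.symm)) ?_ ?_
  · rw [serreExpr_tmul_one, serreExpr_E h, TensorProduct.zero_tmul]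
  · rw [serreExpr_one_tmul, serreExpr_E h, TensorProduct.tmul_zero]

theorem serreExpr_comulF {i j : Edge} (h : i.Adjacent j) :
    serreExpr q (comulF i) (comulF j) = 0 := by
  have hK : ∀ {i j n}, cartan i j = n →
      (1 : Uq) ⊗ₜ[Kq] Kinv i * 1 ⊗ₜ F j = q ^ n • (1 ⊗ₜ F j * 1 ⊗ₜ Kinv i) := fun h => by
    rw [tmul_mul_tmul, tmul_mul_tmul, Kinv_mul_F, h, tmul_smul]
  rw [comulF_eq, comulF_eq]
  refine serreExpr_add_mul_eq_zero q_ne_zero (Commute.tmul (.one_left 1) (Kinv_commute j i))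
    (commute_tmul_one_one_tmul _ _) (commute_tmul_one_one_tmul _ _)
    (commute_tmul_one_one_tmul _ _) (commute_tmul_one_one_tmul _ _)
    (commute_tmul_one_one_tmul _ _) (commute_tmul_one_one_tmul _ _)
    (hK (cartan_self i)) (hK (cartan_of_adjacent h)) (hK (cartan_of_adjacent h.symm)) ?_ ?_
  · rw [serreExpr_one_tmul, serreExpr_F h, TensorProduct.tmul_zero]
  · rw [serreExpr_tmul_one, serreExpr_F h, TensorProduct.zero_tmul]

theorem isChevalley_comul :
    IsChevalley comulE comulF (fun j => D j ⊗ₜ[Kq] D j) (fun j => Dinv j ⊗ₜ[Kq] Dinv j) where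
  d_mul_inv j := by rw [tmul_mul_tmul, D_mul_Dinv, Algebra.TensorProduct.one_def]
  inv_mul_d j := by rw [tmul_mul_tmul, Dinv_mul_D, Algebra.TensorProduct.one_def]
  d_commute j k := (D_commute j k).tmul (D_commute j k)
  d_mul_e j i := by
    refine qCommute_add_right ?_ ?_ <;>
      simp only [tmul_mul_tmul, D_mul_E, (D_commute_K j i).eq, mul_one, one_mul, tmul_smul,
        smul_tmul']
  d_mul_f j i := by
    refine qCommute_add_right ?_ ?_ <;>
      simp only [tmul_mul_tmul, D_mul_F, (D_commute_Kinv j i).eq, mul_one, one_mul, tmul_smul,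
        smul_tmul']
  e_mul_f_self i := by
    have hK : K i ⊗ₜ[Kq] K i - Kinv i ⊗ₜ Kinv i = D i.source ⊗ₜ D i.source *
        Dinv i.target ⊗ₜ Dinv i.target - D i.target ⊗ₜ D i.target *
          Dinv i.source ⊗ₜ Dinv i.source := by
      rw [tmul_mul_tmul, tmul_mul_tmul, K, Kinv]
    rw [comulE_mul_comulF_sub, E_mul_F_self, ← smul_tmul', tmul_smul, sub_tmul, tmul_sub,
      ← smul_add, ← hK]
    congr 1
    abel
  e_commute_f {i j} h := sub_eq_zero.mp <| by
    rw [comulE_mul_comulF_sub, sub_eq_zero.mpr (E_commute_F h).eq, TensorProduct.zero_tmul,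
      TensorProduct.tmul_zero, add_zero]
  e_commute := comulE_commute
  f_commute := comulF_commute
  e_serre := serreExpr_comulE
  f_serre := serreExpr_comulF

/-- The coproduct of `U_q(𝔤𝔩₄)`. -/
def comul : Uq →ₐ[Kq] Uq ⊗[Kq] Uq := isChevalley_comul.lift

theorem comul_E (i : Edge) : comul (E i) = E i ⊗ₜ 1 + K i ⊗ₜ E i := isChevalley_comul.lift_E i
theorem comul_F (i : Edge) : comul (F i) = F i ⊗ₜ Kinv i + 1 ⊗ₜ F i := isChevalley_comul.lift_F i
theorem comul_D (j : Vertex) : comul (D j) = D j ⊗ₜ D j := isChevalley_comul.lift_D j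
theorem comul_Dinv (j : Vertex) : comul (Dinv j) = Dinv j ⊗ₜ Dinv j :=
  isChevalley_comul.lift_Dinv j

theorem comul_Kinv (i : Edge) : comul (Kinv i) = Kinv i ⊗ₜ Kinv i := by
  rw [Kinv, map_mul, comul_D, comul_Dinv, tmul_mul_tmul]

theorem comul_F_add_E_mul_Kinv (i j : Edge) (c : Kq) :
    comul (F i + c • (E j * Kinv i)) = (F i + c • (E j * Kinv i)) ⊗ₜ Kinv i + 1 ⊗ₜ F i +
      c • ((K j * Kinv i) ⊗ₜ (E j * Kinv i)) := by
  rw [map_add, map_smul, map_mul, comul_F, comul_E, comul_Kinv, add_mul, tmul_mul_tmul,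
    tmul_mul_tmul, one_mul, TensorProduct.add_tmul, ← smul_tmul', smul_add]
  abel

end Uq

/-! ### Relations in the coideal subalgebra -/

section Serre

variable {K A : Type*} [Field K] [Ring A] [Algebra K A] {q : K}

theorem serreExpr_mul_mul_eq_zero {r s : K} {a a' k k' : A} (hkk : Commute k' k)
    (hka : k * a = r • (a * k)) (hka' : k * a' = s • (a' * k)) (hk'a : k' * a = s • (a * k'))
    (h : serreExpr q a a' = 0) : serreExpr q (a * k) (a' * k') = 0 := by
  have assoc : ∀ {x y z : A}, x * y = z → ∀ w, x * (y * w) = z * w := fun h w => by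
    rw [← mul_assoc, h]
  have hmul := congrArg (fun z => z * (k * (k * k'))) h
  simp only [serreExpr, add_mul, sub_mul, mul_smul_comm, smul_mul_assoc, mul_assoc, zero_mul,
    smul_smul, hkk.eq, assoc hkk.eq, assoc hka, assoc hka', assoc hk'a] at hmul ⊢
  linear_combination (norm := skip) (r * s ^ 2) • hmul
  match_scalars <;> ring

theorem serreExpr_add_add_inv_smul_eq_zero (hq : q ≠ 0) {f e F G : A}
    (hef : e * f = q ^ 2 • (f * e)) (heF : e * F = q⁻¹ • (F * e)) (hGf : G * f = q⁻¹ • (f * G))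
    (hF : serreExpr q f F = 0) (hG : serreExpr q e G = 0) :
    serreExpr q (f + e) (F + q⁻¹ • G) = 0 := by
  have assoc : ∀ {x y z : A}, x * y = z → ∀ w, x * (y * w) = z * w := fun h w => by
    rw [← mul_assoc, h]
  simp only [serreExpr, mul_add, add_mul, mul_smul_comm, smul_mul_assoc, mul_assoc, smul_add,
    smul_smul, hef, assoc hef, heF, assoc heF, hGf, assoc hGf] at hF hG ⊢
  linear_combination (norm := skip) hF + q⁻¹ • hG
  match_scalars <;> field_simp <;> ring

theorem serreExpr_add_inv_smul_add_eq_add (hq : q ≠ 0) (hq2 : q ^ 2 - 1 ≠ 0) {f e F G h : A}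
    (hGF : G * F = q ^ 2 • (F * G) + (q ^ 2 * (q - q⁻¹)⁻¹) • (1 - h))
    (hGf : G * f = q⁻¹ • (f * G)) (heF : e * F = q⁻¹ • (F * e))
    (hf : h * f = (q ^ 2)⁻¹ • (f * h)) (he : h * e = q ^ 2 • (e * h))
    (hF : serreExpr q F f = 0) (hG : serreExpr q G e = 0) :
    serreExpr q (F + q⁻¹ • G) (f + e) = f + e := by
  have assoc : ∀ {x y z : A}, x * y = z → ∀ w, x * (y * w) = z * w := fun h w => by
    rw [← mul_assoc, h]
  simp only [serreExpr, mul_add, add_mul, mul_sub, sub_mul, mul_smul_comm, smul_mul_assoc,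
    mul_assoc, smul_add, smul_sub, smul_smul, mul_one, one_mul, hGF, assoc hGF, hGf, assoc hGf,
    heF, assoc heF, hf, he] at hF hG ⊢
  linear_combination (norm := skip) hF + (q⁻¹ * q⁻¹) • hG
  match_scalars <;> field_simp <;> ring

end Serre

namespace Uq

theorem E_mul_Kinv_mul_F {i j k : Edge} (h : i ≠ k) :
    E i * Kinv j * F k = q ^ cartan j k • (F k * (E i * Kinv j)) := by
  rw [mul_assoc, Kinv_mul_F, mul_smul_comm, ← mul_assoc, (E_commute_F h).eq, mul_assoc]

theorem E_mul_Kinv_mul_F_self (i : Edge) :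
    E i * Kinv i * F i = q ^ 2 • (F i * (E i * Kinv i)) +
      (q ^ 2 * (q - q⁻¹)⁻¹) • (1 - Kinv i * Kinv i) := by
  rw [mul_assoc, Kinv_mul_F, cartan_self, mul_smul_comm, ← mul_assoc,
    ← sub_add_cancel (E i * F i) (F i * E i), E_mul_F_self, add_mul, smul_mul_assoc, sub_mul,
    K_mul_Kinv, zpow_ofNat, smul_add, smul_smul, mul_assoc, add_comm]

theorem serreExpr_E_mul_Kinv {i j i' j' : Edge} (h : i.Adjacent j) (hij : i'.Adjacent j)
    (hji : j'.Adjacent i) : serreExpr q (E i * Kinv i') (E j * Kinv j') = 0 :=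
  serreExpr_mul_mul_eq_zero (s := q ^ (1 : ℤ)) (Kinv_commute _ _) (Kinv_mul_E _ _)
    (by simpa only [cartan_of_adjacent hij, neg_neg] using Kinv_mul_E i' j)
    (by simpa only [cartan_of_adjacent hji, neg_neg] using Kinv_mul_E j' i) (serreExpr_E h)

theorem serreExpr_BNeg_BZero : serreExpr q BNeg BZero = 0 := by
  have hneg : Edge.neg.Adjacent .zero := by decide
  have hpos : Edge.pos.Adjacent .zero := by decide
  refine serreExpr_add_add_inv_smul_eq_zero q_ne_zero ?_ ?_ ?_ (serreExpr_F hneg)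
    (serreExpr_E_mul_Kinv hpos hneg hpos.symm)
  · simpa [cartan_self] using E_mul_Kinv_mul_F (i := .pos) (j := .neg) (k := .neg) (by simp)
  · simpa [cartan_of_adjacent hneg] using
      E_mul_Kinv_mul_F (i := .pos) (j := .neg) (k := .zero) (by simp)
  · simpa [cartan_of_adjacent hneg.symm] using
      E_mul_Kinv_mul_F (i := .zero) (j := .zero) (k := .neg) (by simp)

theorem serreExpr_BZero {i j : Edge} (hi : Edge.zero.Adjacent i) (hj : Edge.zero.Adjacent j)
    (hi0 : i ≠ .zero) (hj0 : j ≠ .zero) :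
    serreExpr q BZero (F i + E j * Kinv i) = F i + E j * Kinv i := by
  refine serreExpr_add_inv_smul_add_eq_add (h := Kinv .zero * Kinv .zero) q_ne_zero
    q_sq_sub_one_ne_zero (E_mul_Kinv_mul_F_self _) ?_ ?_ ?_ ?_ (serreExpr_F hi)
    (serreExpr_E_mul_Kinv hj hj hi.symm)
  · simpa [cartan_of_adjacent hi] using E_mul_Kinv_mul_F (j := .zero) hi0.symm
  · simpa [cartan_of_adjacent hi.symm] using E_mul_Kinv_mul_F (j := i) hj0
  · have hsq := qCommute_mul_left q_ne_zero (Kinv_mul_F .zero i) (Kinv_mul_F .zero i)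
    rw [cartan_of_adjacent hi] at hsq
    exact hsq
  · have hsq := qCommute_mul_left q_ne_zero (Kinv_mul_E .zero j) (Kinv_mul_E .zero j)
    rw [cartan_of_adjacent hj] at hsq
    exact qCommute_mul_right_of_commute (n := 2) hsq
      ((Kinv_commute .zero i).mul_left (Kinv_commute .zero i))

theorem serreExpr_BZero_BPos : serreExpr q BZero BPos = BPos :=
  serreExpr_BZero (by decide) (by decide) (by decide) (by decide)

theorem serreExpr_BZero_BNeg : serreExpr q BZero BNeg = BNeg :=
  serreExpr_BZero (by decide) (by decide) (by decide) (by decide)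

theorem E_mul_Kinv_commute {i j : Edge} (hne : i ≠ j) (h : ¬i.Adjacent j) :
    Commute (E i * Kinv j) (E j * Kinv i) := by
  have swap : ∀ k l : Edge, E k * Kinv l * (E l * Kinv k) =
      q ^ (-2 : ℤ) • (E k * E l * (Kinv l * Kinv k)) := fun k l => by
    rw [mul_assoc, ← mul_assoc (Kinv l), Kinv_mul_E, cartan_self]
    simp only [smul_mul_assoc, mul_smul_comm, mul_assoc]
  rw [commute_iff_eq, swap, swap, (E_commute hne h).eq, (Kinv_commute j i).eq]

theorem E_mul_Kinv_mul_F_sub {i j : Edge} (hne : i ≠ j) (h : ¬i.Adjacent j) :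
    E i * Kinv j * F i - F i * (E i * Kinv j) =
      (q - q⁻¹)⁻¹ • ((K i - Kinv i) * Kinv j) := by
  rw [← smul_mul_assoc, ← E_mul_F_self, mul_assoc, Kinv_mul_F, cartan_comm,
    cartan_of_not_adjacent hne h, zpow_zero, one_smul, sub_mul, mul_assoc, mul_assoc]

theorem F_add_E_mul_Kinv_commutator {i j : Edge} (hne : i ≠ j) (h : ¬i.Adjacent j) :
    (F i + E j * Kinv i) * (F j + E i * Kinv j) - (F j + E i * Kinv j) * (F i + E j * Kinv i) =
      (q - q⁻¹)⁻¹ • (K j * Kinv i - K i * Kinv j) := by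
  have hFF := sub_eq_zero.mpr (F_commute hne h).eq
  have hEE := sub_eq_zero.mpr (E_mul_Kinv_commute (Ne.symm hne) fun h' => h h'.symm).eq
  calc _ = (F i * F j - F j * F i) +
        (E j * Kinv i * (E i * Kinv j) - E i * Kinv j * (E j * Kinv i)) +
        (E j * Kinv i * F j - F j * (E j * Kinv i)) -
        (E i * Kinv j * F i - F i * (E i * Kinv j)) := by noncomm_ring
    _ = _ := by
      rw [hFF, hEE, E_mul_Kinv_mul_F_sub hne h,
        E_mul_Kinv_mul_F_sub (Ne.symm hne) fun h' => h h'.symm, zero_add, zero_add, ← smul_sub,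
        sub_mul, sub_mul, (Kinv_commute j i).eq, sub_sub_sub_cancel_right]

theorem K_neg_mul_Kinv_pos : K .neg * Kinv .pos = DhatDia * DhatOneInv := by
  rw [K, Kinv, DhatDia, DhatOneInv, Commute.mul_mul_mul_comm (D_commute_Dinv _ _).symm,
    (Dinv_commute .negOne .one).eq]
  rfl

theorem K_pos_mul_Kinv_neg : K .pos * Kinv .neg = DhatOne * DhatDiaInv := by
  rw [K, Kinv, DhatOne, DhatDiaInv, Commute.mul_mul_mul_comm (D_commute_Dinv _ _).symm,
    (D_commute .one .negOne).eq]
  rfl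

theorem BPos_mul_BNeg_sub : BPos * BNeg - BNeg * BPos =
    (q - q⁻¹)⁻¹ • (DhatDia * DhatOneInv - DhatOne * DhatDiaInv) := by
  rw [← K_neg_mul_Kinv_pos, ← K_pos_mul_Kinv_neg]
  exact F_add_E_mul_Kinv_commutator (by decide) (by decide)

theorem D_mul_D_mul_F_add {j k : Vertex} {i l : Edge} (c : Kq) {n : ℤ}
    (hF : -wt i j + -wt i k = n) (hE : wt l j + wt l k = n) :
    D j * D k * (F i + c • (E l * Kinv i)) =
      q ^ n • ((F i + c • (E l * Kinv i)) * (D j * D k)) := by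
  refine qCommute_add_right (hF ▸ qCommute_mul_left q_ne_zero (D_mul_F _ _) (D_mul_F _ _)) ?_
  rw [mul_smul_comm, smul_mul_assoc, smul_comm]
  exact congrArg (c • ·) (qCommute_mul_right_of_commute
    (hE ▸ qCommute_mul_left q_ne_zero (D_mul_E _ _) (D_mul_E _ _))
    ((D_commute_Kinv j i).mul_left (D_commute_Kinv k i)))

theorem DhatDia_mul_BNeg : DhatDia * BNeg = q⁻¹ • (BNeg * DhatDia) := by
  have h := D_mul_D_mul_F_add (j := .dia) (k := .negDia) (i := .neg) (l := .pos) 1 (n := -1)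
    (by decide) (by decide)
  rw [one_smul, zpow_neg_one] at h
  exact h

theorem DhatDia_commute_BZero : Commute DhatDia BZero := by
  have h := D_mul_D_mul_F_add (j := .dia) (k := .negDia) (i := .zero) (l := .zero) q⁻¹ (n := 0)
    (by decide) (by decide)
  rw [zpow_zero, one_smul] at h
  exact h

theorem DhatOne_mul_BNeg : DhatOne * BNeg = q • (BNeg * DhatOne) := by
  have h := D_mul_D_mul_F_add (j := .one) (k := .negOne) (i := .neg) (l := .pos) 1 (n := 1)
    (by decide) (by decide)
  rw [one_smul, zpow_one] at h
  exact h

theorem DhatOne_commute_BZero : Commute DhatOne BZero := by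
  have h := D_mul_D_mul_F_add (j := .one) (k := .negOne) (i := .zero) (l := .zero) q⁻¹ (n := 0)
    (by decide) (by decide)
  rw [zpow_zero, one_smul] at h
  exact h

theorem Dinv_mul_Dinv_mul_D_mul_D (j k : Vertex) : Dinv k * Dinv j * (D j * D k) = 1 := by
  rw [mul_assoc, ← mul_assoc (Dinv j), Dinv_mul_D, one_mul, Dinv_mul_D]

end Uq

namespace Uq'

/-- The inverse of `D̂_◇` as an element of `U_q'`. -/
def DdiaInv : Uq' := ⟨Uq.DhatDiaInv, Algebra.subset_adjoin (by simp)⟩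
/-- The inverse of `D̂_1` as an element of `U_q'`. -/
def D1Inv : Uq' := ⟨Uq.DhatOneInv, Algebra.subset_adjoin (by simp)⟩

theorem serreExpr_Bm1_B0 : serreExpr q Bm1 B0 = 0 := Subtype.ext Uq.serreExpr_BNeg_BZero

theorem serreExpr_B0_B1 : serreExpr q B0 B1 = B1 := Subtype.ext Uq.serreExpr_BZero_BPos

theorem serreExpr_B0_Bm1 : serreExpr q B0 Bm1 = Bm1 := Subtype.ext Uq.serreExpr_BZero_BNeg

theorem B1_mul_Bm1_sub :
    B1 * Bm1 - Bm1 * B1 = (q - q⁻¹)⁻¹ • (Ddia * D1Inv - D1 * DdiaInv) :=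
  Subtype.ext Uq.BPos_mul_BNeg_sub

theorem Ddia_mul_Bm1 : Ddia * Bm1 = q⁻¹ • (Bm1 * Ddia) := Subtype.ext Uq.DhatDia_mul_BNeg
theorem Ddia_mul_B0 : Ddia * B0 = B0 * Ddia := Subtype.ext Uq.DhatDia_commute_BZero
theorem D1_mul_Bm1 : D1 * Bm1 = q • (Bm1 * D1) := Subtype.ext Uq.DhatOne_mul_BNeg
theorem D1_mul_B0 : D1 * B0 = B0 * D1 := Subtype.ext Uq.DhatOne_commute_BZero
theorem DdiaInv_mul_Ddia : DdiaInv * Ddia = 1 := Subtype.ext (Uq.Dinv_mul_Dinv_mul_D_mul_D _ _)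
theorem D1Inv_mul_D1 : D1Inv * D1 = 1 := Subtype.ext (Uq.Dinv_mul_Dinv_mul_D_mul_D _ _)

end Uq'

/-! ### Generators of the coideal subalgebra and the coaction -/

namespace Uq'

/-- Labels for the generators of `U_q'`. -/
inductive Label : Type
  | B1 | Bm1 | B0 | Ddia | DdiaInv | D1 | D1Inv

/-- The generator of `U_q'` with a given label. -/
def gen : Label → Uq'
  | .B1 => B1
  | .Bm1 => Bm1
  | .B0 => B0
  | .Ddia => Ddia
  | .DdiaInv => DdiaInv
  | .D1 => D1
  | .D1Inv => D1Inv

theorem mem_of_gen_mem {S : Subalgebra Kq Uq'} (h : ∀ g, gen g ∈ S) (x : Uq') : x ∈ S := by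
  suffices Uq' ≤ S.map Uq'.val by
    obtain ⟨y, hy, hyx⟩ := this x.2
    rwa [← Subtype.ext hyx]
  have hmem : ∀ g, (gen g : Uq) ∈ S.map Uq'.val := fun g => ⟨gen g, h g, rfl⟩
  refine Algebra.adjoin_le ?_
  rintro y (rfl | rfl | rfl | rfl | rfl | rfl | rfl)
  exacts [hmem .B1, hmem .Bm1, hmem .B0, hmem .Ddia, hmem .DdiaInv, hmem .D1, hmem .D1Inv]

/-- The projection from the free algebra on the generators. -/
def proj : FreeAlgebra Kq Label →ₐ[Kq] Uq' := FreeAlgebra.lift Kq gen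

theorem proj_ι (g : Label) : proj (FreeAlgebra.ι Kq g) = gen g := FreeAlgebra.lift_ι_apply _ _

theorem proj_surjective : Function.Surjective proj :=
  mem_of_gen_mem (S := proj.range) fun g => ⟨_, proj_ι g⟩

/-- The homomorphism on `U_q'` induced by a homomorphism on the free algebra which kills all
relations of `U_q'`. No presentation of `U_q'` is used: in the applications the vanishing on the
relations is obtained by interpolation between known representations. -/
def descend {A : Type*} [Ring A] [Algebra Kq A] (f : FreeAlgebra Kq Label →ₐ[Kq] A)
    (hf : ∀ x, proj x = 0 → f x = 0) : Uq' →ₐ[Kq] A :=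
  (Ideal.Quotient.liftₐ (RingHom.ker proj) f hf).comp
    (Ideal.quotientKerAlgEquivOfSurjective proj_surjective).symm.toAlgHom

theorem descend_gen {A : Type*} [Ring A] [Algebra Kq A] (f : FreeAlgebra Kq Label →ₐ[Kq] A)
    (hf : ∀ x, proj x = 0 → f x = 0) (g : Label) :
    descend f hf (gen g) = f (FreeAlgebra.ι Kq g) := by
  have h : (Ideal.quotientKerAlgEquivOfSurjective proj_surjective).symm (gen g) =
      Ideal.Quotient.mk _ (FreeAlgebra.ι Kq g) := by
    rw [AlgEquiv.symm_apply_eq, ← proj_ι]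
    rfl
  exact congrArg (Ideal.Quotient.liftₐ (RingHom.ker proj) f hf) h

/-- The inclusion of `U_q' ⊗ U_q(𝔤𝔩₄)` into `U_q(𝔤𝔩₄) ⊗ U_q(𝔤𝔩₄)`. -/
def tensorVal : Uq' ⊗[Kq] Uq →ₐ[Kq] Uq ⊗[Kq] Uq :=
  Algebra.TensorProduct.map Uq'.val (AlgHom.id Kq Uq)

theorem tensorVal_injective : Function.Injective tensorVal :=
  Module.Flat.rTensor_preserves_injective_linearMap Uq'.val.toLinearMap Subtype.val_injective

theorem comul_B1 : Uq.comul B1 = tensorVal (B1 ⊗ₜ Uq.Kinv .pos + 1 ⊗ₜ Uq.F .pos +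
    (Ddia * D1Inv) ⊗ₜ (Uq.E .neg * Uq.Kinv .pos)) := by
  have h := Uq.comul_F_add_E_mul_Kinv .pos .neg 1
  rw [one_smul, one_smul, Uq.K_neg_mul_Kinv_pos] at h
  exact h

theorem comul_Bm1 : Uq.comul Bm1 = tensorVal (Bm1 ⊗ₜ Uq.Kinv .neg + 1 ⊗ₜ Uq.F .neg +
    (D1 * DdiaInv) ⊗ₜ (Uq.E .pos * Uq.Kinv .neg)) := by
  have h := Uq.comul_F_add_E_mul_Kinv .neg .pos 1
  rw [one_smul, one_smul, Uq.K_pos_mul_Kinv_neg] at h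
  exact h

theorem comul_B0 :
    Uq.comul B0 = tensorVal (B0 ⊗ₜ Uq.Kinv .zero + 1 ⊗ₜ Uq.BZero) := by
  have h := Uq.comul_F_add_E_mul_Kinv .zero .zero q⁻¹
  rw [Uq.K_mul_Kinv, add_assoc, ← TensorProduct.tmul_smul, ← TensorProduct.tmul_add] at h
  exact h

theorem comul_D_mul_D (j k : Vertex) :
    Uq.comul (Uq.D j * Uq.D k) = (Uq.D j * Uq.D k) ⊗ₜ (Uq.D j * Uq.D k) := by
  rw [map_mul, Uq.comul_D, Uq.comul_D, Algebra.TensorProduct.tmul_mul_tmul]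

theorem comul_Dinv_mul_Dinv (j k : Vertex) :
    Uq.comul (Uq.Dinv j * Uq.Dinv k) = (Uq.Dinv j * Uq.Dinv k) ⊗ₜ (Uq.Dinv j * Uq.Dinv k) := by
  rw [map_mul, Uq.comul_Dinv, Uq.comul_Dinv, Algebra.TensorProduct.tmul_mul_tmul]

theorem comul_Ddia : Uq.comul Ddia = tensorVal (Ddia ⊗ₜ Uq.DhatDia) := comul_D_mul_D _ _

theorem comul_DdiaInv : Uq.comul DdiaInv = tensorVal (DdiaInv ⊗ₜ Uq.DhatDiaInv) :=
  comul_Dinv_mul_Dinv _ _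

theorem comul_D1 : Uq.comul D1 = tensorVal (D1 ⊗ₜ Uq.DhatOne) := comul_D_mul_D _ _

theorem comul_D1Inv : Uq.comul D1Inv = tensorVal (D1Inv ⊗ₜ Uq.DhatOneInv) :=
  comul_Dinv_mul_Dinv _ _

theorem comul_mem_range (x : Uq') : Uq.comul x ∈ tensorVal.range := by
  refine mem_of_gen_mem (S := tensorVal.range.comap (Uq.comul.comp Uq'.val)) ?_ x
  rintro (_ | _ | _ | _ | _ | _ | _)
  exacts [⟨_, comul_B1.symm⟩, ⟨_, comul_Bm1.symm⟩, ⟨_, comul_B0.symm⟩, ⟨_, comul_Ddia.symm⟩,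
    ⟨_, comul_DdiaInv.symm⟩, ⟨_, comul_D1.symm⟩, ⟨_, comul_D1Inv.symm⟩]

/-- The restriction of the coproduct that makes `U_q'` a right coideal subalgebra. -/
def coaction : Uq' →ₐ[Kq] Uq' ⊗[Kq] Uq :=
  (AlgEquiv.ofInjective tensorVal tensorVal_injective).symm.toAlgHom.comp
    ((Uq.comul.comp Uq'.val).codRestrict tensorVal.range comul_mem_range)

theorem coaction_eq {x : Uq'} {y : Uq' ⊗[Kq] Uq} (h : Uq.comul x = tensorVal y) :
    coaction x = y :=
  (AlgEquiv.symm_apply_eq (AlgEquiv.ofInjective tensorVal tensorVal_injective)).mpr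
    (Subtype.ext h)

theorem coaction_B1 : coaction B1 = B1 ⊗ₜ Uq.Kinv .pos + 1 ⊗ₜ Uq.F .pos +
    (Ddia * D1Inv) ⊗ₜ (Uq.E .neg * Uq.Kinv .pos) := coaction_eq comul_B1

theorem coaction_Bm1 : coaction Bm1 = Bm1 ⊗ₜ Uq.Kinv .neg + 1 ⊗ₜ Uq.F .neg +
    (D1 * DdiaInv) ⊗ₜ (Uq.E .pos * Uq.Kinv .neg) := coaction_eq comul_Bm1

theorem coaction_B0 : coaction B0 = B0 ⊗ₜ Uq.Kinv .zero + 1 ⊗ₜ Uq.BZero := coaction_eq comul_B0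

theorem coaction_Ddia : coaction Ddia = Ddia ⊗ₜ Uq.DhatDia := coaction_eq comul_Ddia

theorem coaction_D1 : coaction D1 = D1 ⊗ₜ Uq.DhatOne := coaction_eq comul_D1

end Uq'

/-! ### Tensor products of representations -/

section TensorRep

variable {M N : Type*} [AddCommGroup M] [Module Kq M] [AddCommGroup N] [Module Kq N]

/-- The tensor product of a representation of `U_q'` with a representation of `U_q(𝔤𝔩₄)`. -/
def tensorRep (ρ : Uq' →ₐ[Kq] Module.End Kq M) (ψ : Uq →ₐ[Kq] Module.End Kq N) :
    Uq' →ₐ[Kq] Module.End Kq (M ⊗[Kq] N) :=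
  Module.endTensorEndAlgHom.comp ((Algebra.TensorProduct.map ρ ψ).comp Uq'.coaction)

variable (ρ : Uq' →ₐ[Kq] Module.End Kq M) (ψ : Uq →ₐ[Kq] Module.End Kq N) (m : M) (n : N)

theorem tensorRep_B1 : tensorRep ρ ψ Uq'.B1 (m ⊗ₜ n) =
    ρ Uq'.B1 m ⊗ₜ ψ (Uq.Kinv .pos) n + m ⊗ₜ ψ (Uq.F .pos) n +
      ρ Uq'.Ddia (ρ Uq'.D1Inv m) ⊗ₜ ψ (Uq.E .neg) (ψ (Uq.Kinv .pos) n) := by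
  simp [tensorRep, Uq'.coaction_B1, Module.endTensorEndAlgHom_apply]

theorem tensorRep_Bm1 : tensorRep ρ ψ Uq'.Bm1 (m ⊗ₜ n) =
    ρ Uq'.Bm1 m ⊗ₜ ψ (Uq.Kinv .neg) n + m ⊗ₜ ψ (Uq.F .neg) n +
      ρ Uq'.D1 (ρ Uq'.DdiaInv m) ⊗ₜ ψ (Uq.E .pos) (ψ (Uq.Kinv .neg) n) := by
  simp [tensorRep, Uq'.coaction_Bm1, Module.endTensorEndAlgHom_apply]

theorem tensorRep_B0 : tensorRep ρ ψ Uq'.B0 (m ⊗ₜ n) =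
    ρ Uq'.B0 m ⊗ₜ ψ (Uq.Kinv .zero) n + m ⊗ₜ ψ (Uq.F .zero) n +
      q⁻¹ • m ⊗ₜ ψ (Uq.E .zero) (ψ (Uq.Kinv .zero) n) := by
  simp [tensorRep, Uq'.coaction_B0, Uq.BZero, Module.endTensorEndAlgHom_apply,
    TensorProduct.tmul_add, add_assoc]

theorem tensorRep_Ddia : tensorRep ρ ψ Uq'.Ddia (m ⊗ₜ n) =
    ρ Uq'.Ddia m ⊗ₜ ψ (Uq.D .dia) (ψ (Uq.D .negDia) n) := by
  simp [tensorRep, Uq'.coaction_Ddia, Uq.DhatDia, Module.endTensorEndAlgHom_apply]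

theorem tensorRep_D1 : tensorRep ρ ψ Uq'.D1 (m ⊗ₜ n) =
    ρ Uq'.D1 m ⊗ₜ ψ (Uq.D .one) (ψ (Uq.D .negOne) n) := by
  simp [tensorRep, Uq'.coaction_D1, Uq.DhatOne, Module.endTensorEndAlgHom_apply]

end TensorRep

instance : Fintype Vertex := ⟨{.negOne, .negDia, .dia, .one}, fun j => by cases j <;> simp⟩

theorem inv_sub_mul_sub_inv : (q - q⁻¹)⁻¹ * (q⁻¹ - q) = -1 := by
  rw [← neg_sub q, mul_neg, inv_mul_cancel₀ q_sub_inv_ne_zero]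

theorem isChevalley_matrix : IsChevalley (A := Matrix Vertex Vertex Kq)
    (fun i => Matrix.single i.source i.target 1) (fun i => Matrix.single i.target i.source 1)
    (fun j => Matrix.diagonal fun k => if k = j then q else 1)
    (fun j => Matrix.diagonal fun k => if k = j then q⁻¹ else 1) where
  d_mul_inv j := by
    rw [Matrix.diagonal_mul_diagonal, ← Matrix.diagonal_one]
    congr 1 with k
    split_ifs <;> simp [q_ne_zero]
  inv_mul_d j := by
    rw [Matrix.diagonal_mul_diagonal, ← Matrix.diagonal_one]
    congr 1 with k
    split_ifs <;> simp [q_ne_zero]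
  d_commute j k := Matrix.commute_diagonal _ _
  d_mul_e j i := by
    cases j <;> cases i <;> ext a b <;> cases a <;> cases b <;>
      simp [Matrix.mul_diagonal, Edge.source, Edge.target, wt, q_ne_zero]
  d_mul_f j i := by
    cases j <;> cases i <;> ext a b <;> cases a <;> cases b <;>
      simp [Matrix.mul_diagonal, Edge.source, Edge.target, wt, q_ne_zero]
  e_mul_f_self i := by
    simp only [Matrix.single_mul_single_same, Matrix.diagonal_mul_diagonal]
    cases i <;> ext a b <;> cases a <;> cases b <;>
      simp [Edge.source, Edge.target, inv_sub_mul_sub_inv, q_sub_inv_ne_zero]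
  e_commute_f {i j} h := by
    cases i <;> cases j <;>
      simp [commute_iff_eq, Edge.source, Edge.target, Matrix.single_mul_single_of_ne] at h ⊢
  e_commute {i j} _ h := by
    cases i <;> cases j <;>
      simp [commute_iff_eq, Edge.source, Edge.target, Edge.Adjacent,
        Matrix.single_mul_single_of_ne] at h ⊢
  f_commute {i j} _ h := by
    cases i <;> cases j <;>
      simp [commute_iff_eq, Edge.source, Edge.target, Edge.Adjacent,
        Matrix.single_mul_single_of_ne] at h ⊢
  e_serre {i j} h := by
    cases i <;> cases j <;>
      simp [serreExpr, Edge.source, Edge.target, Edge.Adjacent,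
        Matrix.single_mul_single_of_ne] at h ⊢
  f_serre {i j} h := by
    cases i <;> cases j <;>
      simp [serreExpr, Edge.source, Edge.target, Edge.Adjacent,
        Matrix.single_mul_single_of_ne] at h ⊢

/-- The natural representation of `U_q(𝔤𝔩₄)`. -/
def natRep : Uq →ₐ[Kq] Module.End Kq (Vertex → Kq) :=
  Matrix.toLinAlgEquiv'.toAlgHom.comp isChevalley_matrix.lift

/-- The vector of the standard basis of the natural representation attached to a vertex. -/
def basisVec (j : Vertex) : Vertex → Kq := Pi.single j 1

theorem natRep_gen_apply (g : Gen) (v : Vertex → Kq) :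
    natRep (Uq.gen g) v = isChevalley_matrix.lift (Uq.gen g) *ᵥ v := rfl

theorem natRep_E_basisVec (i : Edge) (j : Vertex) :
    natRep (Uq.E i) (basisVec j) = if j = i.target then basisVec i.source else 0 := by
  rw [Uq.E, natRep_gen_apply, ← Uq.E, isChevalley_matrix.lift_E]
  ext k
  cases i <;> cases j <;> cases k <;> simp [basisVec, Edge.source, Edge.target]

theorem natRep_F_basisVec (i : Edge) (j : Vertex) :
    natRep (Uq.F i) (basisVec j) = if j = i.source then basisVec i.target else 0 := by
  rw [Uq.F, natRep_gen_apply, ← Uq.F, isChevalley_matrix.lift_F]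
  ext k
  cases i <;> cases j <;> cases k <;> simp [basisVec, Edge.source, Edge.target]

theorem natRep_D_basisVec (k j : Vertex) :
    natRep (Uq.D k) (basisVec j) = (if j = k then q else 1) • basisVec j := by
  rw [Uq.D, natRep_gen_apply, ← Uq.D, isChevalley_matrix.lift_D]
  split_ifs with h <;> simp [h, basisVec, ← Pi.single_smul]

theorem natRep_Dinv_basisVec (k j : Vertex) :
    natRep (Uq.Dinv k) (basisVec j) = (if j = k then q⁻¹ else 1) • basisVec j := by
  rw [Uq.Dinv, natRep_gen_apply, ← Uq.Dinv, isChevalley_matrix.lift_Dinv]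
  split_ifs with h <;> simp [h, basisVec, ← Pi.single_smul]

theorem natRep_Kinv_basisVec (i : Edge) (j : Vertex) : natRep (Uq.Kinv i) (basisVec j) =
    ((if j = i.source then q⁻¹ else 1) * (if j = i.target then q else 1)) • basisVec j := by
  rw [Uq.Kinv, map_mul, Module.End.mul_apply, natRep_Dinv_basisVec, map_smul, natRep_D_basisVec,
    smul_smul]

/-! ### Brackets -/

/-- The bracket `[x] = (x - x⁻¹) / (q - q⁻¹)`, over any field: `[μ; n] = [qⁿ μ]`, `[n] = [qⁿ]`. -/
def bracket {K : Type*} [Field K] (q x : K) : K := (x - x⁻¹) / (q - q⁻¹)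

theorem qbr_eq_bracket (μ : Kq) (n : ℤ) : qbr μ n = bracket q (q ^ n * μ) := by
  rw [qbr, bracket, mul_inv, zpow_neg]

theorem qint_eq_bracket (n : ℤ) : qint n = bracket q (q ^ n) := by
  rw [qint, bracket, zpow_neg]

section Bracket

variable {K : Type*} [Field K] {q x y : K}

theorem sub_inv_ne_zero (h0 : q ≠ 0) (h2 : q ^ 2 - 1 ≠ 0) : q - q⁻¹ ≠ 0 := by
  contrapose! h2
  field_simp at h2
  linear_combination h2

theorem bracket_q_mul (h0 : q ≠ 0) (h2 : q ^ 2 - 1 ≠ 0) (hx : x ≠ 0) :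
    bracket q (q * x) = q⁻¹ * bracket q x + x := by
  have h := sub_inv_ne_zero h0 h2
  rw [bracket, bracket, div_eq_iff h, add_mul, mul_assoc, div_mul_cancel₀ _ h]
  field_simp
  ring

theorem bracket_q_mul_eq_add_inv (h0 : q ≠ 0) (h2 : q ^ 2 - 1 ≠ 0) (hx : x ≠ 0) :
    bracket q (q * x) = q * bracket q x + x⁻¹ := by
  have h := sub_inv_ne_zero h0 h2
  rw [bracket, bracket, div_eq_iff h, add_mul, mul_assoc, div_mul_cancel₀ _ h]
  field_simp
  ring

theorem mul_eq_zero_of_bracket_eq (h0 : q ≠ 0) (h2 : q ^ 2 - 1 ≠ 0) (hx : x ≠ 0) (hy : y ≠ 0)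
    (h : bracket q x = bracket q y) : (x - y) * (x * y + 1) = 0 := by
  rw [bracket, bracket, div_left_inj' (sub_inv_ne_zero h0 h2)] at h
  field_simp at h
  linear_combination h

end Bracket

/-! ### One-dimensional representations -/

/-- `v` spans a one-dimensional subrepresentation on which `B_{±1}` act by `0`, `B_0` acts by `[μ]`
and `D̂_◇`, `D̂_1` act by `c`. -/
structure IsCharacterVector {M : Type*} [AddCommGroup M] [Module Kq M]
    (ρ : Uq' →ₐ[Kq] Module.End Kq M) (v : M) (μ c : Kq) : Prop where
  B1 : ρ Uq'.B1 v = 0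
  Bm1 : ρ Uq'.Bm1 v = 0
  B0 : ρ Uq'.B0 v = bracket q μ • v
  Ddia : ρ Uq'.Ddia v = c • v
  D1 : ρ Uq'.D1 v = c • v

/-- `a`, `b` span a two-dimensional subrepresentation with `B_{-1} a = b` and `B_1 b = a`, on which
`B_0`, `D̂_◇` and `D̂_1` act diagonally. -/
structure IsDoublet {M : Type*} [AddCommGroup M] [Module Kq M]
    (ρ : Uq' →ₐ[Kq] Module.End Kq M) (a b : M) (μ c : Kq) : Prop where
  B1_fst : ρ Uq'.B1 a = 0
  B1_snd : ρ Uq'.B1 b = a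
  Bm1_fst : ρ Uq'.Bm1 a = b
  Bm1_snd : ρ Uq'.Bm1 b = 0
  B0_fst : ρ Uq'.B0 a = bracket q (q * μ) • a
  B0_snd : ρ Uq'.B0 b = bracket q μ • b
  Ddia_fst : ρ Uq'.Ddia a = (q * c) • a
  Ddia_snd : ρ Uq'.Ddia b = c • b
  D1_fst : ρ Uq'.D1 a = c • a
  D1_snd : ρ Uq'.D1 b = (q * c) • b

section

variable {M : Type*} [AddCommGroup M] [Module Kq M] {ρ : Uq' →ₐ[Kq] Module.End Kq M}

theorem apply_eq_inv_smul {x y : Uq'} (h : y * x = 1) {v : M} {c : Kq} (hc : c ≠ 0)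
    (hv : ρ x v = c • v) : ρ y v = c⁻¹ • v := by
  rw [eq_inv_smul_iff₀ hc, ← map_smul, ← hv, ← Module.End.mul_apply, ← map_mul, h, map_one,
    Module.End.one_apply]

theorem apply_DdiaInv {v : M} {c : Kq} (hc : c ≠ 0) (hv : ρ Uq'.Ddia v = c • v) :
    ρ Uq'.DdiaInv v = c⁻¹ • v :=
  apply_eq_inv_smul Uq'.DdiaInv_mul_Ddia hc hv

theorem apply_D1Inv {v : M} {c : Kq} (hc : c ≠ 0) (hv : ρ Uq'.D1 v = c • v) :
    ρ Uq'.D1Inv v = c⁻¹ • v :=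
  apply_eq_inv_smul Uq'.D1Inv_mul_D1 hc hv

/-- The general element of `M ⊗ V`, in the order of the chain `-1 → -◇ → ◇ → 1`. -/
def quad (a b c d : M) : M ⊗[Kq] (Vertex → Kq) :=
  a ⊗ₜ basisVec .negOne + b ⊗ₜ basisVec .negDia + c ⊗ₜ basisVec .dia + d ⊗ₜ basisVec .one

theorem quad_zero : quad (0 : M) 0 0 0 = 0 := by
  simp [quad]

theorem quad_smul (r : Kq) (a b c d : M) :
    r • quad a b c d = quad (r • a) (r • b) (r • c) (r • d) := by
  simp [quad, TensorProduct.smul_tmul']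

theorem quad_sub (a b c d a' b' c' d' : M) :
    quad a b c d - quad a' b' c' d' = quad (a - a') (b - b') (c - c') (d - d') := by
  simp only [quad, TensorProduct.sub_tmul]
  abel

theorem quad_congr {a b c d a' b' c' d' : M} (ha : a = a') (hb : b = b') (hc : c = c')
    (hd : d = d') : quad a b c d = quad a' b' c' d' := by
  rw [ha, hb, hc, hd]

theorem eq_zero_of_quad_eq_zero {a b c d : M} (h : quad a b c d = 0) : a = 0 ∧ b = 0 := by
  have coord (j : Vertex) := congrFun (congrArg (TensorProduct.piScalarRight Kq Kq M Vertex) h) j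
  constructor
  · simpa [quad, basisVec] using coord .negOne
  · simpa [quad, basisVec] using coord .negDia

theorem tensorRep_B1_quad (a b c d : M) : tensorRep ρ natRep Uq'.B1 (quad a b c d) =
    quad (q⁻¹ • ρ Uq'.B1 a) (q • ρ Uq'.B1 b + a) (ρ Uq'.B1 c + ρ Uq'.Ddia (ρ Uq'.D1Inv d))
      (ρ Uq'.B1 d) := by
  simp [quad, tensorRep_B1, natRep_E_basisVec, natRep_F_basisVec, natRep_Kinv_basisVec,
    Edge.source, Edge.target, TensorProduct.add_tmul, TensorProduct.smul_tmul]
  abel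

theorem tensorRep_Bm1_quad (a b c d : M) : tensorRep ρ natRep Uq'.Bm1 (quad a b c d) =
    quad (ρ Uq'.Bm1 a + ρ Uq'.D1 (ρ Uq'.DdiaInv b)) (ρ Uq'.Bm1 b) (q⁻¹ • ρ Uq'.Bm1 c)
      (q • ρ Uq'.Bm1 d + c) := by
  simp [quad, tensorRep_Bm1, natRep_E_basisVec, natRep_F_basisVec, natRep_Kinv_basisVec,
    Edge.source, Edge.target, TensorProduct.add_tmul, TensorProduct.smul_tmul]
  abel

theorem tensorRep_B0_quad (a b c d : M) : tensorRep ρ natRep Uq'.B0 (quad a b c d) =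
    quad (ρ Uq'.B0 a) (q⁻¹ • ρ Uq'.B0 b + c) (q • ρ Uq'.B0 c + b) (ρ Uq'.B0 d) := by
  simp [quad, tensorRep_B0, natRep_E_basisVec, natRep_F_basisVec, natRep_Kinv_basisVec,
    Edge.source, Edge.target, TensorProduct.add_tmul, TensorProduct.smul_tmul, smul_smul, q_ne_zero]
  abel

theorem tensorRep_Ddia_quad (a b c d : M) : tensorRep ρ natRep Uq'.Ddia (quad a b c d) =
    quad (ρ Uq'.Ddia a) (q • ρ Uq'.Ddia b) (q • ρ Uq'.Ddia c) (ρ Uq'.Ddia d) := by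
  simp [quad, tensorRep_Ddia, natRep_D_basisVec, TensorProduct.smul_tmul]

theorem tensorRep_D1_quad (a b c d : M) : tensorRep ρ natRep Uq'.D1 (quad a b c d) =
    quad (q • ρ Uq'.D1 a) (ρ Uq'.D1 b) (ρ Uq'.D1 c) (q • ρ Uq'.D1 d) := by
  simp [quad, tensorRep_D1, natRep_D_basisVec, TensorProduct.smul_tmul]

theorem IsCharacterVector.isDoublet {v : M} {μ c : Kq} (h : IsCharacterVector ρ v μ c)
    (hμ : μ ≠ 0) (hc : c ≠ 0) :
    IsDoublet (tensorRep ρ natRep) (quad 0 v (μ • v) 0) (quad v 0 0 (μ • v)) μ c := by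
  have h0 := q_ne_zero
  have hd := apply_DdiaInv hc h.Ddia
  have ho := apply_D1Inv hc h.D1
  constructor
  · simp [tensorRep_B1_quad, h.B1, quad_zero]
  · simp [tensorRep_B1_quad, h.B1, h.Ddia, ho, smul_smul, hc]
  · simp [tensorRep_Bm1_quad, h.Bm1, h.D1, hd, smul_smul, hc]
  · simp [tensorRep_Bm1_quad, h.Bm1, quad_zero]
  · simp only [tensorRep_B0_quad, quad_smul, map_zero, map_smul, smul_zero, h.B0]
    refine quad_congr rfl ?_ ?_ rfl
    · rw [bracket_q_mul h0 q_sq_sub_one_ne_zero hμ, add_smul, mul_smul]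
    · rw [bracket_q_mul_eq_add_inv h0 q_sq_sub_one_ne_zero hμ]
      rw [add_smul, inv_smul_smul₀ hμ, mul_smul, smul_comm μ]
  · simp [tensorRep_B0_quad, quad_smul, h.B0, smul_smul, mul_comm]
  · simp [tensorRep_Ddia_quad, quad_smul, h.Ddia, smul_smul, mul_comm, mul_left_comm]
  · simp [tensorRep_Ddia_quad, quad_smul, h.Ddia, smul_smul, mul_comm]
  · simp [tensorRep_D1_quad, quad_smul, h.D1, smul_smul, mul_comm]
  · simp [tensorRep_D1_quad, quad_smul, h.D1, smul_smul, mul_comm, mul_left_comm]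

theorem IsDoublet.isCharacterVector {a b : M} {μ c : Kq} (h : IsDoublet ρ a b μ c)
    (hμ : μ ≠ 0) (hc : c ≠ 0) :
    IsCharacterVector (tensorRep ρ natRep)
      (quad a (-q⁻¹ • b) (-(μ * q⁻¹) • b) ((μ * (q⁻¹ * q⁻¹)) • a)) (q * μ) (q * c) := by
  have h0 := q_ne_zero
  have hd := apply_DdiaInv hc h.Ddia_snd
  have ho := apply_D1Inv hc h.D1_fst
  constructor
  · simp only [tensorRep_B1_quad, map_smul, h.B1_fst, h.B1_snd, h.Ddia_fst, ho, smul_zero]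
    refine (quad_congr rfl ?_ ?_ rfl).trans quad_zero
    · simp [smul_smul, h0]
    · rw [smul_smul, smul_smul, ← add_smul]
      exact smul_eq_zero_of_left (by field_simp; ring) a
  · simp only [tensorRep_Bm1_quad, map_smul, h.Bm1_fst, h.Bm1_snd, h.D1_snd, hd, smul_zero]
    refine (quad_congr ?_ rfl rfl ?_).trans quad_zero
    · rw [smul_smul, smul_smul, show -q⁻¹ * c⁻¹ * (q * c) = -1 by field_simp, neg_one_smul,
        add_neg_cancel]
    · rw [smul_smul, ← add_smul]
      exact smul_eq_zero_of_left (by field_simp; ring) b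
  · have e1 := bracket_q_mul h0 q_sq_sub_one_ne_zero hμ
    have e2 := bracket_q_mul_eq_add_inv h0 q_sq_sub_one_ne_zero hμ
    simp only [tensorRep_B0_quad, quad_smul, map_smul, h.B0_fst, h.B0_snd]
    refine quad_congr rfl ?_ ?_ (smul_comm ..) <;> simp only [smul_smul, ← add_smul] <;> congr 1
    · rw [e1]
      ring
    · rw [e2]
      field_simp
      ring
  · simp only [tensorRep_Ddia_quad, quad_smul, map_smul, h.Ddia_fst, h.Ddia_snd]
    refine quad_congr ?_ ?_ ?_ ?_ <;> simp only [smul_smul] <;> congr 1 <;> ring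
  · simp only [tensorRep_D1_quad, quad_smul, map_smul, h.D1_fst, h.D1_snd]
    refine quad_congr ?_ ?_ ?_ ?_ <;> simp only [smul_smul] <;> congr 1 <;> ring

end

theorem isChevalley_character {p : Kq} (hp : p ≠ 0) :
    IsChevalley (A := Kq) (fun _ => 0) (fun _ => 0) (fun _ => p) (fun _ => p⁻¹) := by
  constructor <;> simp [hp, serreExpr]

/-- The one-dimensional representation of `U_q(𝔤𝔩₄)` on which every `D_j` acts by `p`. -/
def scalarRep {p : Kq} (hp : p ≠ 0) : Uq →ₐ[Kq] Module.End Kq Kq :=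
  (Algebra.lmul Kq Kq).comp (isChevalley_character hp).lift

/-- A one-dimensional representation as in `IsCharacterVector` exists. -/
def HasCharacter (μ c : Kq) : Prop :=
  ∃ (M : Type) (_ : AddCommGroup M) (_ : Module Kq M) (ρ : Uq' →ₐ[Kq] Module.End Kq M) (v : M),
    v ≠ 0 ∧ IsCharacterVector ρ v μ c

theorem hasCharacter_one : HasCharacter 1 1 := by
  refine ⟨Kq, _, _, (scalarRep one_ne_zero).comp Uq'.val, 1, one_ne_zero, ?_⟩
  constructor <;>
    simp [scalarRep, Uq'.B1, Uq'.Bm1, Uq'.B0, Uq'.Ddia, Uq'.D1, Uq.BPos, Uq.BNeg, Uq.BZero,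
      Uq.DhatDia, Uq.DhatOne, IsChevalley.lift_E, IsChevalley.lift_F, IsChevalley.lift_D, bracket]

theorem HasCharacter.twist {μ c p : Kq} (h : HasCharacter μ c) (hp : p ≠ 0) :
    HasCharacter μ (p * p * c) := by
  obtain ⟨M, _, _, ρ, v, hv, h⟩ := h
  refine ⟨M ⊗[Kq] Kq, _, _, tensorRep ρ (scalarRep hp), v ⊗ₜ 1, ?_, ?_⟩
  · contrapose! hv
    simpa using congrArg (TensorProduct.rid Kq M) hv
  · have smul_tmul (r s : Kq) : (r • v) ⊗ₜ[Kq] s = (s * r) • v ⊗ₜ[Kq] (1 : Kq) := by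
      rw [mul_comm, TensorProduct.smul_tmul, ← TensorProduct.tmul_smul, smul_eq_mul, smul_eq_mul,
        mul_one]
    constructor <;>
      simp [tensorRep_B1, tensorRep_Bm1, tensorRep_B0, tensorRep_Ddia, tensorRep_D1, scalarRep,
        IsChevalley.lift_E, IsChevalley.lift_F, IsChevalley.lift_D, IsChevalley.lift_Dinv,
        Uq.Kinv, h.B1, h.Bm1, h.B0, h.Ddia, h.D1, hp, smul_tmul]

theorem HasCharacter.q_mul {μ c : Kq} (h : HasCharacter μ c) (hμ : μ ≠ 0) (hc : c ≠ 0) :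
    HasCharacter (q * μ) (q * c) := by
  obtain ⟨M, _, _, ρ, v, hv, h⟩ := h
  refine ⟨_, _, _, _, _, ?_, (h.isDoublet hμ hc).isCharacterVector hμ hc⟩
  exact fun h => hv (eq_zero_of_quad_eq_zero (eq_zero_of_quad_eq_zero h).1).2

theorem hasCharacter_pow (n : ℕ) : HasCharacter (q ^ n) (q ^ n) := by
  induction n with
  | zero => simpa using hasCharacter_one
  | succ n ih =>
    rw [pow_succ']
    exact ih.q_mul (pow_ne_zero _ q_ne_zero) (pow_ne_zero _ q_ne_zero)

theorem hasCharacter_even_pow (n : ℕ) : HasCharacter (q ^ (2 * n)) 1 := by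
  have h0 : q ^ n ≠ 0 := pow_ne_zero _ q_ne_zero
  convert (hasCharacter_pow (2 * n)).twist (inv_ne_zero h0) using 1
  rw [two_mul, pow_add]
  field_simp

/-- The characters of `U_q'` with `D̂_◇` and `D̂_1` acting by `1`, where the scalar by which `B_0`
acts is an indeterminate. -/
def genericCharacter : FreeAlgebra Kq Uq'.Label →ₐ[Kq] Polynomial Kq :=
  FreeAlgebra.lift Kq fun
    | .B1 => 0
    | .Bm1 => 0
    | .B0 => Polynomial.X
    | .Ddia => 1
    | .DdiaInv => 1
    | .D1 => 1
    | .D1Inv => 1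

theorem IsCharacterVector.apply_proj {M : Type*} [AddCommGroup M] [Module Kq M]
    {ρ : Uq' →ₐ[Kq] Module.End Kq M} {v : M} {μ : Kq} (h : IsCharacterVector ρ v μ 1)
    (x : FreeAlgebra Kq Uq'.Label) :
    ρ (Uq'.proj x) v = (genericCharacter x).eval (bracket q μ) • v := by
  have hd := apply_DdiaInv one_ne_zero h.Ddia
  have ho := apply_D1Inv one_ne_zero h.D1
  induction x using FreeAlgebra.induction with
  | grade0 r => simp [AlgHom.commutes, Module.algebraMap_end_apply]
  | grade1 g =>
    rw [Uq'.proj_ι]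
    cases g <;> simp [genericCharacter, Uq'.gen, h.B1, h.Bm1, h.B0, h.Ddia, h.D1, hd, ho]
  | mul x y hx hy => simp [hx, hy, smul_smul, mul_comm]
  | add x y hx hy => simp [hx, hy, add_smul]

theorem bracket_even_pow_injective :
    Function.Injective fun n : ℕ => bracket q (q ^ (2 * n)) := by
  intro m n h
  have h0 := q_ne_zero
  rcases mul_eq_zero.mp (mul_eq_zero_of_bracket_eq h0 q_sq_sub_one_ne_zero (pow_ne_zero _ h0)
    (pow_ne_zero _ h0) h) with h | h
  · have : (2 * m : ℤ) = (2 * n : ℤ) := q_zpow_injective (by exact_mod_cast sub_eq_zero.mp h)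
    omega
  · have hneg : q ^ (2 * m + 2 * n) = -1 := by rw [pow_add]; linear_combination h
    have hone : q ^ (2 * (2 * m + 2 * n)) = 1 := by rw [mul_comm, pow_mul, hneg]; norm_num
    have : 2 * (2 * m + 2 * n) = 0 := by_contra fun hne => q_pow_ne_one hne hone
    omega

theorem genericCharacter_eq_zero (x : FreeAlgebra Kq Uq'.Label) (hx : Uq'.proj x = 0) :
    genericCharacter x = 0 := by
  refine Polynomial.eq_zero_of_infinite_isRoot _
    (Set.infinite_of_injective_forall_mem bracket_even_pow_injective fun n => ?_)
  obtain ⟨M, _, _, ρ, v, hv, h⟩ := hasCharacter_even_pow n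
  have := h.apply_proj x
  rw [hx, map_zero, LinearMap.zero_apply, eq_comm, smul_eq_zero] at this
  exact this.resolve_right hv

theorem hasCharacter_trivial_weight (μ : Kq) : HasCharacter μ 1 := by
  let χ : Uq' →ₐ[Kq] Kq :=
    (Polynomial.aeval (bracket q μ)).comp (Uq'.descend genericCharacter genericCharacter_eq_zero)
  have h (g : Uq'.Label) : (Algebra.lmul Kq Kq).comp χ (Uq'.gen g) 1 =
      (genericCharacter (FreeAlgebra.ι Kq g)).eval (bracket q μ) := by
    simp [χ, Uq'.descend_gen, Polynomial.coe_aeval_eq_eval]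
  refine ⟨Kq, _, _, (Algebra.lmul Kq Kq).comp χ, 1, one_ne_zero,
    (h .B1).trans ?_, (h .Bm1).trans ?_, (h .B0).trans ?_, (h .Ddia).trans ?_,
    (h .D1).trans ?_⟩ <;> simp [genericCharacter]

theorem hasCharacter {μ : Kq} (hμ : μ ≠ 0) (k : ℤ) : HasCharacter μ (q ^ k) := by
  have h0 := q_ne_zero
  have even (j : ℤ) (μ : Kq) : HasCharacter μ (q ^ (2 * j)) := by
    have := (hasCharacter_trivial_weight μ).twist (zpow_ne_zero j h0)
    rwa [mul_one, ← zpow_add₀ h0, ← two_mul] at this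
  obtain ⟨j, rfl | rfl⟩ := Int.even_or_odd' k
  · exact even j μ
  · have := (even j (q⁻¹ * μ)).q_mul (mul_ne_zero (inv_ne_zero h0) hμ) (zpow_ne_zero _ h0)
    rwa [mul_inv_cancel_left₀ h0, ← zpow_one_add₀ h0, add_comm] at this

/-! ### Highest weight vectors -/

/-- The value `ζ = [μ; κ - 2i] - q^{-κ} [μ; 0]` at the dominant weight with `i = s`,
`κ - i = t`. -/
def dominantZeta (s t : ℤ) (μ : Kq) : Kq :=
  bracket q (q ^ (t - s) * μ) - q ^ (-s - t) * bracket q μ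

/-- `v` is a highest weight vector with `κ_1 = k1`, `κ_◇ = k1 + s + t`, `B_0` acting by `[μ]` and
`Z` acting by `dominantZeta s t μ`. -/
structure IsHighestWeight {M : Type*} [AddCommGroup M] [Module Kq M]
    (ρ : Uq' →ₐ[Kq] Module.End Kq M) (v : M) (k1 s t : ℤ) (μ : Kq) : Prop where
  B1 : ρ Uq'.B1 v = 0
  B0 : ρ Uq'.B0 v = bracket q μ • v
  Ddia : ρ Uq'.Ddia v = q ^ (k1 + s + t) • v
  D1 : ρ Uq'.D1 v = q ^ k1 • v
  Z : ρ Uq'.Z v = dominantZeta s t μ • v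

section

variable {M : Type*} [AddCommGroup M] [Module Kq M] {ρ : Uq' →ₐ[Kq] Module.End Kq M}

theorem apply_B1_Bm1 {w : M} {a b : ℤ} (hd : ρ Uq'.Ddia w = q ^ a • w)
    (ho : ρ Uq'.D1 w = q ^ b • w) :
    ρ Uq'.B1 (ρ Uq'.Bm1 w) = ρ Uq'.Bm1 (ρ Uq'.B1 w) + bracket q (q ^ (a - b)) • w := by
  have h0 := q_ne_zero
  have hd' := apply_DdiaInv (zpow_ne_zero a h0) hd
  have ho' := apply_D1Inv (zpow_ne_zero b h0) ho
  have := congrArg (fun z => ρ z w) Uq'.B1_mul_Bm1_sub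
  simp only [map_sub, map_mul, map_smul, LinearMap.sub_apply, Module.End.mul_apply,
    LinearMap.smul_apply, hd, ho, hd', ho', smul_smul, ← sub_smul] at this
  rw [← sub_eq_iff_eq_add', this]
  congr 1
  rw [bracket, zpow_sub₀ h0]
  field_simp

theorem apply_Y {w : M} {c : Kq} (h : ρ Uq'.B0 w = c • w) :
    ρ Uq'.Y w = ρ Uq'.B0 (ρ Uq'.Bm1 w) - (q⁻¹ * c) • ρ Uq'.Bm1 w := by
  simp [Uq'.Y, Uq'.comm, h, smul_smul]

theorem apply_Z {w : M} (h : ρ Uq'.B1 w = 0) : ρ Uq'.Z w = ρ Uq'.B1 (ρ Uq'.Y w) := by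
  simp [Uq'.Z, Uq'.comm, h]

theorem IsCharacterVector.isHighestWeight {v : M} {k1 : ℤ} {μ : Kq}
    (h : IsCharacterVector ρ v μ (q ^ k1)) : IsHighestWeight ρ v k1 0 0 μ where
  B1 := h.B1
  B0 := h.B0
  Ddia := by simpa using h.Ddia
  D1 := h.D1
  Z := by simp [apply_Z h.B1, apply_Y h.B0, h.Bm1, dominantZeta]

namespace IsHighestWeight

variable {v : M} {k1 s t : ℤ} {μ : Kq}

theorem apply_B1_Bm1 (h : IsHighestWeight ρ v k1 s t μ) :
    ρ Uq'.B1 (ρ Uq'.Bm1 v) = bracket q (q ^ (s + t)) • v := by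
  rw [QSP.apply_B1_Bm1 h.Ddia h.D1, h.B1, map_zero, zero_add]
  congr 4
  ring

theorem apply_B1_B0_Bm1 (h : IsHighestWeight ρ v k1 s t μ) :
    ρ Uq'.B1 (ρ Uq'.B0 (ρ Uq'.Bm1 v)) =
      (dominantZeta s t μ + q⁻¹ * bracket q μ * bracket q (q ^ (s + t))) • v := by
  have := h.Z
  rw [apply_Z h.B1, apply_Y h.B0, map_sub, map_smul, h.apply_B1_Bm1, smul_smul,
    sub_eq_iff_eq_add] at this
  rw [this, add_smul]

theorem quad_B1 (h : IsHighestWeight ρ v k1 s t μ) (y : Kq) :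
    tensorRep ρ natRep Uq'.B1 (quad 0 v (y • v) 0) = 0 := by
  simp [tensorRep_B1_quad, h.B1, quad_zero]

theorem quad_B0 (h : IsHighestWeight ρ v k1 s t μ) {μ' y : Kq}
    (h1 : q⁻¹ * bracket q μ + y = bracket q μ')
    (h2 : q * y * bracket q μ + 1 = y * bracket q μ') :
    tensorRep ρ natRep Uq'.B0 (quad 0 v (y • v) 0) = bracket q μ' • quad 0 v (y • v) 0 := by
  simp only [tensorRep_B0_quad, quad_smul, h.B0, map_zero, smul_zero, map_smul, smul_smul,
    ← add_smul, h1]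
  refine quad_congr rfl rfl ?_ rfl
  rw [mul_comm (bracket q μ'), ← h2, add_smul, one_smul, mul_assoc]

theorem quad_Z (h : IsHighestWeight ρ v k1 s t μ) {μ' y : Kq}
    (h1 : q⁻¹ * bracket q μ + y = bracket q μ')
    (h2 : q * y * bracket q μ + 1 = y * bracket q μ') :
    tensorRep ρ natRep Uq'.Z (quad 0 v (y • v) 0) =
      (dominantZeta s t μ + q ^ (-s - t) * (bracket q μ - q⁻¹ * bracket q μ')) •
        quad 0 v (y • v) 0 := by
  have h0 := q_ne_zero
  have hqi : q * q⁻¹ = 1 := mul_inv_cancel₀ h0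
  have hd := apply_DdiaInv (zpow_ne_zero _ h0) h.Ddia
  have ho := apply_D1Inv (zpow_ne_zero _ h0) h.D1
  have hdo : (q ^ (k1 + s + t))⁻¹ * q ^ k1 = q ^ (-s - t) := by
    rw [← zpow_neg, ← zpow_add₀ h0]
    congr 1
    ring
  have hod : (q ^ k1)⁻¹ * q ^ (k1 + s + t) = q ^ (s + t) := by
    rw [← zpow_neg, ← zpow_add₀ h0]
    congr 1
    ring
  have hbr : bracket q (q ^ (s + t)) * (q - q⁻¹) = q ^ (s + t) - q ^ (-s - t) := by
    rw [bracket, div_mul_cancel₀ _ q_sub_inv_ne_zero, ← zpow_neg]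
    congr 2
    ring
  rw [apply_Z (h.quad_B1 y), apply_Y (h.quad_B0 h1 h2), tensorRep_Bm1_quad, tensorRep_B0_quad,
    quad_smul, quad_sub, tensorRep_B1_quad, quad_smul]
  simp only [h.B1, h.B0, h.apply_B1_Bm1, h.apply_B1_B0_Bm1, hd, ho, h.D1, h.Ddia, map_zero,
    smul_zero, map_smul, smul_smul, zero_add, map_add, map_sub, ← add_smul, ← sub_smul]
  refine quad_congr rfl ?_ ?_ rfl
  · congr 1
    linear_combination (dominantZeta s t μ + (q⁻¹ * bracket q μ + y - bracket q μ') *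
      bracket q (q ^ (s + t))) * hqi + bracket q (q ^ (s + t)) * h1 +
      (bracket q μ - q⁻¹ * bracket q μ') * hdo
  · congr 1
    linear_combination (y * (dominantZeta s t μ + q⁻¹ * bracket q μ * bracket q (q ^ (s + t))) +
      -(y * bracket q μ' * bracket q (q ^ (s + t)))) * hqi +
      bracket q (q ^ (s + t)) * h2 + (y * bracket q μ - q⁻¹ * bracket q μ' * y) * (hod - hbr)

theorem isHighestWeight_quad (h : IsHighestWeight ρ v k1 s t μ) {s' t' : ℤ} {μ' y : Kq}
    (h1 : q⁻¹ * bracket q μ + y = bracket q μ')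
    (h2 : q * y * bracket q μ + 1 = y * bracket q μ') (hst : s' + t' = s + t + 1)
    (hz : dominantZeta s' t' μ' =
      dominantZeta s t μ + q ^ (-s - t) * (bracket q μ - q⁻¹ * bracket q μ')) :
    IsHighestWeight (tensorRep ρ natRep) (quad 0 v (y • v) 0) k1 s' t' μ' where
  B1 := h.quad_B1 y
  B0 := h.quad_B0 h1 h2
  Ddia := by
    simp [tensorRep_Ddia_quad, quad_smul, h.Ddia, smul_smul, mul_comm, mul_left_comm,
      show k1 + s' + t' = 1 + (k1 + s + t) by linarith, zpow_one_add₀ q_ne_zero]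
  D1 := by simp [tensorRep_D1_quad, quad_smul, h.D1, smul_smul, mul_comm]
  Z := (h.quad_Z h1 h2).trans (by rw [hz])

end IsHighestWeight

end

/-- A highest weight vector with the given parameters exists. -/
def HasHighestWeight (k1 s t : ℤ) (μ : Kq) : Prop :=
  ∃ (M : Type) (_ : AddCommGroup M) (_ : Module Kq M) (ρ : Uq' →ₐ[Kq] Module.End Kq M) (v : M),
    v ≠ 0 ∧ IsHighestWeight ρ v k1 s t μ

theorem hasHighestWeight_zero (k1 : ℤ) {μ : Kq} (hμ : μ ≠ 0) : HasHighestWeight k1 0 0 μ := by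
  obtain ⟨M, _, _, ρ, v, hv, h⟩ := hasCharacter hμ k1
  exact ⟨M, _, _, ρ, v, hv, h.isHighestWeight⟩

theorem HasHighestWeight.succ_left {k1 s t : ℤ} {μ : Kq} (hμ : μ ≠ 0)
    (h : HasHighestWeight k1 s t μ) : HasHighestWeight k1 (s + 1) t (q * μ) := by
  obtain ⟨M, _, _, ρ, v, hv, h⟩ := h
  have h0 := q_ne_zero
  have e1 := bracket_q_mul h0 q_sq_sub_one_ne_zero hμ
  have e2 := bracket_q_mul_eq_add_inv h0 q_sq_sub_one_ne_zero hμ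
  refine ⟨_, _, _, _, _, fun h => hv (eq_zero_of_quad_eq_zero h).2,
    h.isHighestWeight_quad (y := μ) e1.symm ?_ (by ring) ?_⟩
  · rw [e2]
    field_simp
  · rw [dominantZeta, dominantZeta,
      show q ^ (t - (s + 1)) * (q * μ) = q ^ (t - s) * μ by
        rw [← mul_assoc, ← zpow_add_one₀ h0]; ring_nf,
      show q ^ (-(s + 1) - t) = q ^ (-s - t) * q⁻¹ by rw [← zpow_sub_one₀ h0]; ring_nf]
    ring

theorem HasHighestWeight.succ_right {k1 s t : ℤ} {μ : Kq} (hμ : μ ≠ 0)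
    (h : HasHighestWeight k1 s t (q * μ)) : HasHighestWeight k1 s (t + 1) μ := by
  obtain ⟨M, _, _, ρ, v, hv, h⟩ := h
  have h0 := q_ne_zero
  have e1 := bracket_q_mul h0 q_sq_sub_one_ne_zero hμ
  have e2 := bracket_q_mul_eq_add_inv h0 q_sq_sub_one_ne_zero hμ
  refine ⟨_, _, _, _, _, fun h => hv (eq_zero_of_quad_eq_zero h).2,
    h.isHighestWeight_quad (y := -(q⁻¹ * μ⁻¹)) ?_ ?_ (by ring) ?_⟩
  · rw [e2]
    field_simp
    ring
  · rw [e1]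
    field_simp
    ring
  · rw [dominantZeta, dominantZeta,
      show q ^ (t + 1 - s) * μ = q ^ (t - s) * (q * μ) by
        rw [← mul_assoc, ← zpow_add_one₀ h0]; ring_nf,
      show q ^ (-s - (t + 1)) = q ^ (-s - t) * q⁻¹ by rw [← zpow_sub_one₀ h0]; ring_nf]
    ring

theorem hasHighestWeight (k1 : ℤ) (s t : ℕ) {μ : Kq} (hμ : μ ≠ 0) :
    HasHighestWeight k1 s t μ := by
  have h0 := q_ne_zero
  induction s generalizing μ with
  | zero =>
    induction t generalizing μ with
    | zero => exact hasHighestWeight_zero k1 hμ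
    | succ t ih => exact_mod_cast (ih (mul_ne_zero h0 hμ)).succ_right hμ
  | succ s ih =>
    have hμ' := mul_ne_zero (inv_ne_zero h0) hμ
    have := (ih hμ').succ_left hμ'
    rw [mul_inv_cancel_left₀ h0] at this
    exact_mod_cast this

/-! ### Ladder operators -/

section Ladder

variable {K : Type*} [Field K] {M : Type*} [AddCommGroup M] [Module K M]

/-- The symmetric bracket `{x} = x + x⁻¹`; goodness says that no `{q^l μ}` vanishes. -/
def symBracket (x : K) : K := x + x⁻¹

/-- The parameter `μ q^{n-m}` of the `B_0`-eigenvalue of the ladder vector with index `(m, n)`. -/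
def ladderParam (q μ : K) (m n : ℕ) : K := μ * q ^ n / q ^ m

/-- The coefficient with which `B_1` lowers the first index `m`, up to a symmetric bracket, where
`σ = q^s`, `τ = q^t` and `A = q^m`; it vanishes at `m = 0` and `m = s + 1`. -/
def lowerCoeffFst (q σ τ μ A : K) : K :=
  bracket q A * bracket q (q * σ / A) * symBracket (μ / A) * symBracket (q * τ * μ / A)

/-- The coefficient with which `B_1` lowers the second index `n`, up to a symmetric bracket, where
`σ = q^s`, `τ = q^t` and `B = q^n`; it vanishes at `n = 0` and `n = t + 1`. -/
def lowerCoeffSnd (q σ τ μ B : K) : K :=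
  bracket q B * bracket q (q * τ / B) * symBracket (μ * B) * symBracket (μ * B / (q * σ))

variable {q : K}

theorem lowerCoeffFst_one (σ τ μ : K) : lowerCoeffFst q σ τ μ 1 = 0 := by
  simp [lowerCoeffFst, bracket]

theorem lowerCoeffSnd_one (σ τ μ : K) : lowerCoeffSnd q σ τ μ 1 = 0 := by
  simp [lowerCoeffSnd, bracket]

theorem lowerCoeff_identity (h0 : q ≠ 0) (h2 : q ^ 2 - 1 ≠ 0) {σ τ μ A B : K} (hσ : σ ≠ 0)
    (hτ : τ ≠ 0) (hμ : μ ≠ 0) (hA : A ≠ 0) (hB : B ≠ 0) :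
    (lowerCoeffFst q σ τ μ (q * A) - lowerCoeffSnd q σ τ μ B) * symBracket (q * (μ * B / A)) +
      (lowerCoeffSnd q σ τ μ (q * B) - lowerCoeffFst q σ τ μ A) * symBracket (q⁻¹ * (μ * B / A)) =
    bracket q (σ * τ / (A * B) ^ 2) * symBracket (μ * B / A) * symBracket (q * (μ * B / A)) *
      symBracket (q⁻¹ * (μ * B / A)) := by
  unfold lowerCoeffFst lowerCoeffSnd bracket symBracket
  field_simp
  ring

/-- The eigenvalue of `Z` on the vectors at which both lowering coefficients vanish. -/
theorem lowerCoeff_identity_of_singular (h0 : q ≠ 0) (h2 : q ^ 2 - 1 ≠ 0) {σ τ μ A B : K}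
    (hσ : σ ≠ 0) (hτ : τ ≠ 0) (hμ : μ ≠ 0) (hA : A = 1 ∨ A = q * σ) (hB : B = 1 ∨ B = q * τ) :
    μ * B / A * lowerCoeffSnd q σ τ μ (q * B) * symBracket (q⁻¹ * (μ * B / A)) -
        (μ * B / A)⁻¹ * lowerCoeffFst q σ τ μ (q * A) * symBracket (q * (μ * B / A)) =
      symBracket (μ * B / A) *
        (bracket q (τ / B ^ 2 / (σ / A ^ 2) * (μ * B / A)) -
          (σ / A ^ 2 * (τ / B ^ 2))⁻¹ * bracket q (μ * B / A)) *
        symBracket (q * (μ * B / A)) * symBracket (q⁻¹ * (μ * B / A)) := by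
  rcases hA with rfl | rfl <;> rcases hB with rfl | rfl <;>
  · unfold lowerCoeffFst lowerCoeffSnd bracket symBracket
    field_simp
    ring

variable (q) in
/-- The `q`-Serre relations of `T = B_0`, `b = B_{-1}` and `c = B_1` among the relations of
`Uq'`. -/
structure IsLadder (T b c : M →ₗ[K] M) : Prop where
  Tb : ∀ w, T (T (b w)) - (q + q⁻¹) • T (b (T w)) + b (T (T w)) = b w
  Tc : ∀ w, T (T (c w)) - (q + q⁻¹) • T (c (T w)) + c (T (T w)) = c w
  bT : ∀ w, b (b (T w)) - (q + q⁻¹) • b (T (b w)) + T (b (b w)) = 0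

variable (q) in
/-- The action of `[T, b]_{q⁻¹}`, which is `Y` when `T = B_0` and `b = B_{-1}`. -/
def qComm (T b : M →ₗ[K] M) (w : M) : M := T (b w) - q⁻¹ • b (T w)

variable (q) in
/-- The ladder operator which maps `T`-eigenvectors of eigenvalue `[x]` to eigenvalue `[q⁻¹ x]`. -/
def raiseFst (T b : M →ₗ[K] M) (x : K) (w : M) : M := x • b w - qComm q T b w

variable (q) in
/-- The ladder operator which maps `T`-eigenvectors of eigenvalue `[x]` to eigenvalue `[q x]`. -/
def raiseSnd (T b : M →ₗ[K] M) (x : K) (w : M) : M := x⁻¹ • b w + qComm q T b w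

variable (q) in
/-- The vector obtained from `v` by `n` steps of `raiseSnd` followed by `m` steps of `raiseFst`. -/
def ladderVec (T b : M →ₗ[K] M) (μ : K) (v : M) : ℕ → ℕ → M
  | 0, 0 => v
  | 0, n + 1 => raiseSnd q T b (ladderParam q μ 0 n) (ladderVec T b μ v 0 n)
  | m + 1, n => raiseFst q T b (ladderParam q μ m n) (ladderVec T b μ v m n)

variable {T b c : M →ₗ[K] M}

theorem raiseFst_eq (h0 : q ≠ 0) (h2 : q ^ 2 - 1 ≠ 0) {x : K} (hx : x ≠ 0) {w : M}
    (hw : T w = bracket q x • w) : raiseFst q T b x w = bracket q (q * x) • b w - T (b w) := by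
  rw [raiseFst, qComm, hw, map_smul, bracket_q_mul h0 h2 hx]
  module

theorem raiseSnd_eq (h0 : q ≠ 0) (h2 : q ^ 2 - 1 ≠ 0) {x : K} (hx : x ≠ 0) {w : M}
    (hw : T w = bracket q x • w) : raiseSnd q T b x w = T (b w) - bracket q (q⁻¹ * x) • b w := by
  have h := bracket_q_mul_eq_add_inv (x := q⁻¹ * x) h0 h2 (mul_ne_zero (inv_ne_zero h0) hx)
  rw [mul_inv_cancel_left₀ h0] at h
  rw [raiseSnd, qComm, hw, map_smul, h]
  match_scalars
  · field_simp
    ring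
  · field_simp

theorem bracket_add_bracket (h0 : q ≠ 0) (h2 : q ^ 2 - 1 ≠ 0) {x : K} (hx : x ≠ 0) :
    bracket q (q * x) + bracket q (q⁻¹ * x) = (q + q⁻¹) * bracket q x := by
  unfold bracket; field_simp; ring

theorem bracket_mul_bracket (h0 : q ≠ 0) (h2 : q ^ 2 - 1 ≠ 0) {x : K} (hx : x ≠ 0) :
    bracket q (q * x) * bracket q (q⁻¹ * x) = bracket q x ^ 2 - 1 := by
  unfold bracket; field_simp; ring

/-- `w` is annihilated by `(T - a)(T - a')`. -/
def IsQuadraticEigenvector (T : M →ₗ[K] M) (a a' : K) (w : M) : Prop :=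
  T (T w) = (a + a') • T w - (a * a') • w

theorem isQuadraticEigenvector_of_serre (h0 : q ≠ 0) (h2 : q ^ 2 - 1 ≠ 0) {x : K} (hx : x ≠ 0)
    {w : M} (hT : T (T (b w)) - (q + q⁻¹) • T (b (T w)) + b (T (T w)) = b w)
    (hw : T w = bracket q x • w) :
    IsQuadraticEigenvector T (bracket q (q * x)) (bracket q (q⁻¹ * x)) (b w) := by
  simp only [hw, map_smul, smul_smul] at hT
  rw [IsQuadraticEigenvector, bracket_add_bracket h0 h2 hx, bracket_mul_bracket h0 h2 hx]
  linear_combination (norm := module) hT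

theorem apply_raiseFst (h0 : q ≠ 0) (h2 : q ^ 2 - 1 ≠ 0) (hL : IsLadder q T b c) {x : K}
    (hx : x ≠ 0) {w : M} (hw : T w = bracket q x • w) :
    T (raiseFst q T b x w) = bracket q (q⁻¹ * x) • raiseFst q T b x w := by
  rw [raiseFst_eq h0 h2 hx hw, map_sub, map_smul,
    isQuadraticEigenvector_of_serre h0 h2 hx (hL.Tb w) hw]
  module

theorem apply_raiseSnd (h0 : q ≠ 0) (h2 : q ^ 2 - 1 ≠ 0) (hL : IsLadder q T b c) {x : K}
    (hx : x ≠ 0) {w : M} (hw : T w = bracket q x • w) :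
    T (raiseSnd q T b x w) = bracket q (q * x) • raiseSnd q T b x w := by
  rw [raiseSnd_eq h0 h2 hx hw, map_sub, map_smul,
    isQuadraticEigenvector_of_serre h0 h2 hx (hL.Tb w) hw]
  module

theorem raiseFst_raiseSnd (h0 : q ≠ 0) (h2 : q ^ 2 - 1 ≠ 0) (hL : IsLadder q T b c) {x : K}
    (hx : x ≠ 0) {w : M} (hw : T w = bracket q x • w) :
    raiseFst q T b (q * x) (raiseSnd q T b x w) =
      raiseSnd q T b (q⁻¹ * x) (raiseFst q T b x w) := by
  have hqx : q * x ≠ 0 := mul_ne_zero h0 hx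
  have hqx' : q⁻¹ * x ≠ 0 := mul_ne_zero (inv_ne_zero h0) hx
  rw [raiseFst_eq h0 h2 hqx (apply_raiseSnd h0 h2 hL hx hw),
    raiseSnd_eq h0 h2 hqx' (apply_raiseFst h0 h2 hL hx hw), raiseFst_eq h0 h2 hx hw,
    raiseSnd_eq h0 h2 hx hw]
  have h := hL.bT w
  simp only [hw, map_smul, map_sub] at h ⊢
  linear_combination (norm := skip) (-(x + x⁻¹)) • h
  match_scalars <;> (try unfold bracket) <;> field_simp <;> ring

theorem ladderParam_ne_zero (h0 : q ≠ 0) {μ : K} (hμ : μ ≠ 0) (m n : ℕ) :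
    ladderParam q μ m n ≠ 0 :=
  div_ne_zero (mul_ne_zero hμ (pow_ne_zero _ h0)) (pow_ne_zero _ h0)

theorem ladderParam_succ_left (q μ : K) (m n : ℕ) :
    ladderParam q μ (m + 1) n = q⁻¹ * ladderParam q μ m n := by
  rw [ladderParam, ladderParam, pow_succ, ← div_div]
  ring

theorem ladderParam_succ_right (q μ : K) (m n : ℕ) :
    ladderParam q μ m (n + 1) = q * ladderParam q μ m n := by
  rw [ladderParam, ladderParam, pow_succ]
  ring

theorem ladderParam_ladderParam (q μ : K) (m n m' n' : ℕ) :
    ladderParam q (ladderParam q μ m n) m' n' = ladderParam q μ (m + m') (n + n') := by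
  rw [ladderParam, ladderParam, ladderParam, pow_add, pow_add, ← div_div]
  ring

variable {μ : K} {v : M}

theorem apply_ladderVec (h0 : q ≠ 0) (h2 : q ^ 2 - 1 ≠ 0) (hL : IsLadder q T b c) (hμ : μ ≠ 0)
    (hv : T v = bracket q μ • v) (m n : ℕ) :
    T (ladderVec q T b μ v m n) = bracket q (ladderParam q μ m n) • ladderVec q T b μ v m n := by
  induction m with
  | zero =>
    induction n with
    | zero => simpa [ladderVec, ladderParam] using hv
    | succ n ih =>
      rw [ladderVec, apply_raiseSnd h0 h2 hL (ladderParam_ne_zero h0 hμ _ _) ih,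
        ladderParam_succ_right]
  | succ m ih =>
    rw [ladderVec, apply_raiseFst h0 h2 hL (ladderParam_ne_zero h0 hμ _ _) ih,
      ladderParam_succ_left]

theorem raiseSnd_ladderVec (h0 : q ≠ 0) (h2 : q ^ 2 - 1 ≠ 0) (hL : IsLadder q T b c) (hμ : μ ≠ 0)
    (hv : T v = bracket q μ • v) (m n : ℕ) :
    raiseSnd q T b (ladderParam q μ m n) (ladderVec q T b μ v m n) =
      ladderVec q T b μ v m (n + 1) := by
  induction m with
  | zero => rw [ladderVec]
  | succ m ih =>
    rw [ladderVec, ladderParam_succ_left,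
      ← raiseFst_raiseSnd h0 h2 hL (ladderParam_ne_zero h0 hμ _ _)
        (apply_ladderVec h0 h2 hL hμ hv _ _),
      ih, ladderVec, ladderParam_succ_right]

theorem raise_ladderVec (h0 : q ≠ 0) (h2 : q ^ 2 - 1 ≠ 0) (hL : IsLadder q T b c) (hμ : μ ≠ 0)
    (hv : T v = bracket q μ • v) {m n : ℕ} (hg : symBracket (ladderParam q μ m n) ≠ 0) :
    b (ladderVec q T b μ v m n) =
      (symBracket (ladderParam q μ m n))⁻¹ •
        (ladderVec q T b μ v (m + 1) n + ladderVec q T b μ v m (n + 1)) := by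
  rw [eq_inv_smul_iff₀ hg, ← raiseSnd_ladderVec h0 h2 hL hμ hv, ladderVec, raiseFst, raiseSnd,
    symBracket]
  module

theorem qComm_ladderVec (h0 : q ≠ 0) (h2 : q ^ 2 - 1 ≠ 0) (hL : IsLadder q T b c) (hμ : μ ≠ 0)
    (hv : T v = bracket q μ • v) {m n : ℕ} (hg : symBracket (ladderParam q μ m n) ≠ 0) :
    qComm q T b (ladderVec q T b μ v m n) = (symBracket (ladderParam q μ m n))⁻¹ •
      (ladderParam q μ m n • ladderVec q T b μ v m (n + 1) -
        (ladderParam q μ m n)⁻¹ • ladderVec q T b μ v (m + 1) n) := by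
  have hx := ladderParam_ne_zero h0 hμ m n
  rw [eq_inv_smul_iff₀ hg, ← raiseSnd_ladderVec h0 h2 hL hμ hv, ladderVec, raiseFst, raiseSnd,
    symBracket]
  match_scalars <;> field_simp <;> ring

/-- The value that `lower_ladderVec` establishes for `c (ladderVec m n)`. -/
def lowered (q σ τ : K) (T b : M →ₗ[K] M) (μ : K) (v : M) (m n : ℕ) : M :=
  (symBracket (ladderParam q μ m n))⁻¹ •
    (lowerCoeffFst q σ τ μ (q ^ m) • ladderVec q T b μ v (m - 1) n +
      lowerCoeffSnd q σ τ μ (q ^ n) • ladderVec q T b μ v m (n - 1))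

section Lowering

variable {σ τ : K} (h0 : q ≠ 0) (h2 : q ^ 2 - 1 ≠ 0) (hL : IsLadder q T b c)
  (hμ : μ ≠ 0) (hv : T v = bracket q μ • v) (hg : ∀ l : ℤ, symBracket (q ^ l * μ) ≠ 0)

include h0 in
theorem ladderParam_eq_zpow (m n : ℕ) : ladderParam q μ m n = q ^ ((n : ℤ) - m) * μ := by
  rw [ladderParam, zpow_sub₀ h0, zpow_natCast, zpow_natCast]
  ring

include h0 hg in
theorem symBracket_ladderParam_ne_zero (m n : ℕ) : symBracket (ladderParam q μ m n) ≠ 0 := by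
  rw [ladderParam_eq_zpow h0]; exact hg _

include h0 h2 hL hμ hv hg in
theorem lowerCoeffFst_smul_raise (m n : ℕ) :
    lowerCoeffFst q σ τ μ (q ^ m) • b (ladderVec q T b μ v (m - 1) n) =
      (lowerCoeffFst q σ τ μ (q ^ m) * (symBracket (q * ladderParam q μ m n))⁻¹) •
        (ladderVec q T b μ v m n + ladderVec q T b μ v (m - 1) (n + 1)) := by
  cases m with
  | zero => simp [lowerCoeffFst_one]
  | succ m =>
    rw [ladderParam_succ_left, mul_inv_cancel_left₀ h0, Nat.add_sub_cancel,
      raise_ladderVec h0 h2 hL hμ hv (symBracket_ladderParam_ne_zero h0 hg _ _), smul_smul]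

include h0 h2 hL hμ hv hg in
theorem lowerCoeffSnd_smul_raise (m n : ℕ) :
    lowerCoeffSnd q σ τ μ (q ^ n) • b (ladderVec q T b μ v m (n - 1)) =
      (lowerCoeffSnd q σ τ μ (q ^ n) * (symBracket (q⁻¹ * ladderParam q μ m n))⁻¹) •
        (ladderVec q T b μ v (m + 1) (n - 1) + ladderVec q T b μ v m n) := by
  cases n with
  | zero => simp [lowerCoeffSnd_one]
  | succ n =>
    rw [ladderParam_succ_right, inv_mul_cancel_left₀ h0, Nat.add_sub_cancel,
      raise_ladderVec h0 h2 hL hμ hv (symBracket_ladderParam_ne_zero h0 hg _ _), smul_smul]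

include h0 h2 hL hμ hv in
theorem apply_lowerCoeffFst_smul (m n : ℕ) :
    T (lowerCoeffFst q σ τ μ (q ^ m) • ladderVec q T b μ v (m - 1) n) =
      bracket q (q * ladderParam q μ m n) •
        (lowerCoeffFst q σ τ μ (q ^ m) • ladderVec q T b μ v (m - 1) n) := by
  cases m with
  | zero => simp [lowerCoeffFst_one]
  | succ m =>
    rw [ladderParam_succ_left, mul_inv_cancel_left₀ h0, Nat.add_sub_cancel, map_smul,
      apply_ladderVec h0 h2 hL hμ hv, smul_comm]

include h0 h2 hL hμ hv in
theorem apply_lowerCoeffSnd_smul (m n : ℕ) :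
    T (lowerCoeffSnd q σ τ μ (q ^ n) • ladderVec q T b μ v m (n - 1)) =
      bracket q (q⁻¹ * ladderParam q μ m n) •
        (lowerCoeffSnd q σ τ μ (q ^ n) • ladderVec q T b μ v m (n - 1)) := by
  cases n with
  | zero => simp [lowerCoeffSnd_one]
  | succ n =>
    rw [ladderParam_succ_right, inv_mul_cancel_left₀ h0, Nat.add_sub_cancel, map_smul,
      apply_ladderVec h0 h2 hL hμ hv, smul_comm]

include h0 h2 hL hμ hv hg in
theorem lowered_add_lowered (hσ : σ ≠ 0) (hτ : τ ≠ 0) (m n : ℕ) :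
    lowered q σ τ T b μ v (m + 1) n + lowered q σ τ T b μ v m (n + 1) =
      symBracket (ladderParam q μ m n) • (b (lowered q σ τ T b μ v m n) +
        bracket q (σ * τ / (q ^ (m + n)) ^ 2) • ladderVec q T b μ v m n) := by
  have hne := symBracket_ladderParam_ne_zero h0 hg m n
  have hne_up : symBracket (q * ladderParam q μ m n) ≠ 0 := by
    rw [← ladderParam_succ_right]; exact symBracket_ladderParam_ne_zero h0 hg _ _
  have hne_down : symBracket (q⁻¹ * ladderParam q μ m n) ≠ 0 := by
    rw [← ladderParam_succ_left]; exact symBracket_ladderParam_ne_zero h0 hg _ _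
  have hcoeff := lowerCoeff_identity h0 h2 hσ hτ hμ (pow_ne_zero m h0) (pow_ne_zero n h0)
  rw [← pow_add, ← pow_succ', ← pow_succ'] at hcoeff
  change _ * symBracket (q * ladderParam q μ m n) + _ * symBracket (q⁻¹ * ladderParam q μ m n) =
    _ * symBracket (ladderParam q μ m n) * symBracket (q * ladderParam q μ m n) * symBracket
      (q⁻¹ * ladderParam q μ m n) at hcoeff
  rw [lowered, lowered, lowered, map_smul, map_add, map_smul, map_smul,
    lowerCoeffFst_smul_raise h0 h2 hL hμ hv hg, lowerCoeffSnd_smul_raise h0 h2 hL hμ hv hg,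
    Nat.add_sub_cancel,
    Nat.add_sub_cancel, ladderParam_succ_left, ladderParam_succ_right]
  generalize symBracket (ladderParam q μ m n) = y at *
  generalize symBracket (q * ladderParam q μ m n) = y' at *
  generalize symBracket (q⁻¹ * ladderParam q μ m n) = y'' at *
  match_scalars
  · field_simp
    linear_combination hcoeff
  · field_simp
  · field_simp

include h0 h2 hL hμ hv in
theorem isQuadraticEigenvector_lowered (m n : ℕ) :
    IsQuadraticEigenvector T (bracket q (q * ladderParam q μ m n))
      (bracket q (q⁻¹ * ladderParam q μ m n)) (lowered q σ τ T b μ v m n) := by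
  have hG := apply_lowerCoeffFst_smul (σ := σ) (τ := τ) h0 h2 hL hμ hv m n
  have hD := apply_lowerCoeffSnd_smul (σ := σ) (τ := τ) h0 h2 hL hμ hv m n
  rw [IsQuadraticEigenvector, lowered]
  generalize lowerCoeffFst q σ τ μ (q ^ m) • ladderVec q T b μ v (m - 1) n = G at *
  generalize lowerCoeffSnd q σ τ μ (q ^ n) • ladderVec q T b μ v m (n - 1) = D at *
  simp only [map_smul, map_add, hG, hD]
  module

namespace IsQuadraticEigenvector

variable {w w' : M} {a a' e e' : K}

theorem sub (h : IsQuadraticEigenvector T a a' w) (h' : IsQuadraticEigenvector T a a' w') :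
    IsQuadraticEigenvector T a a' (w - w') := by
  rw [IsQuadraticEigenvector] at *
  rw [map_sub, map_sub, h, h']
  module

theorem smul (h : IsQuadraticEigenvector T a a' w) (r : K) :
    IsQuadraticEigenvector T a a' (r • w) := by
  rw [IsQuadraticEigenvector] at *
  rw [map_smul, map_smul, h]
  module

theorem eq_zero_of_apply_eq_smul (h : IsQuadraticEigenvector T e e' w) (hw : T w = a • w)
    (hae : a ≠ e) (hae' : a ≠ e') : w = 0 := by
  rw [IsQuadraticEigenvector, hw, map_smul, hw] at h
  have hmul : ((a - e) * (a - e')) • w = 0 := by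
    linear_combination (norm := module) h
  exact (smul_eq_zero.mp hmul).resolve_left
    (mul_ne_zero (sub_ne_zero.mpr hae) (sub_ne_zero.mpr hae'))

theorem eq_zero (h : IsQuadraticEigenvector T a a' w) (h' : IsQuadraticEigenvector T e e' w)
    (hae : a ≠ e) (hae' : a ≠ e') (ha'e : a' ≠ e) (ha'e' : a' ≠ e') : w = 0 := by
  have hquad : IsQuadraticEigenvector T e e' (T w - a' • w) := by
    have hT := congrArg T h'
    rw [IsQuadraticEigenvector] at *
    simp only [map_sub, map_smul] at hT ⊢
    linear_combination (norm := module) hT - a' • h'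
  have heig : T (T w - a' • w) = a • (T w - a' • w) := by
    rw [IsQuadraticEigenvector] at h
    rw [map_sub, map_smul]
    linear_combination (norm := module) h
  exact h'.eq_zero_of_apply_eq_smul
    (sub_eq_zero.mp (hquad.eq_zero_of_apply_eq_smul heig hae hae')) ha'e ha'e'

end IsQuadraticEigenvector

theorem eq_of_bracket_zpow_mul_eq (h0 : q ≠ 0) (h2 : q ^ 2 - 1 ≠ 0) (hμ : μ ≠ 0)
    (hg : ∀ l : ℤ, symBracket (q ^ l * μ) ≠ 0) {i j : ℤ} (hij : Even (i + j))
    (h : bracket q (q ^ i * μ) = bracket q (q ^ j * μ)) : q ^ i = q ^ j := by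
  rcases mul_eq_zero.mp (mul_eq_zero_of_bracket_eq h0 h2 (mul_ne_zero (zpow_ne_zero _ h0) hμ)
    (mul_ne_zero (zpow_ne_zero _ h0) hμ) h) with h | h
  · exact mul_right_cancel₀ hμ (sub_eq_zero.mp h)
  · obtain ⟨k, hk⟩ := hij
    refine absurd ?_ (hg k)
    have hkμ : q ^ k * μ ≠ 0 := mul_ne_zero (zpow_ne_zero _ h0) hμ
    rw [mul_mul_mul_comm, ← zpow_add₀ h0, hk, zpow_add₀ h0, mul_mul_mul_comm] at h
    rw [symBracket]
    field_simp
    linear_combination h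

theorem eq_neg_one_pow_smul {f : ℕ → ℕ → M} {N : ℕ}
    (hf : ∀ m n, m + n = N → f (m + 1) n = -f m (n + 1)) (m n : ℕ) (hmn : m + n = N + 1) :
    f m n = (-1 : K) ^ m • f 0 (N + 1) := by
  induction m generalizing n with
  | zero => rw [← hmn, zero_add, pow_zero, one_smul]
  | succ m ih => rw [hf m n (by omega), ih (n + 1) (by omega), pow_succ, mul_neg_one, neg_smul]

/-- The failure of `c (ladderVec m n) = lowered m n`. -/
def lowerDefect (q σ τ : K) (T b c : M →ₗ[K] M) (μ : K) (v : M) (m n : ℕ) : M :=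
  c (ladderVec q T b μ v m n) - lowered q σ τ T b μ v m n

include h0 h2 hL hμ hv in
theorem isQuadraticEigenvector_lowerDefect (m n : ℕ) :
    IsQuadraticEigenvector T (bracket q (q * ladderParam q μ m n))
      (bracket q (q⁻¹ * ladderParam q μ m n)) (lowerDefect q σ τ T b c μ v m n) :=
  (isQuadraticEigenvector_of_serre h0 h2 (ladderParam_ne_zero h0 hμ m n) (hL.Tc _)
    (apply_ladderVec h0 h2 hL hμ hv m n)).sub
      (isQuadraticEigenvector_lowered h0 h2 hL hμ hv m n)

include h0 h2 hL hμ hv hg in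
theorem lowerDefect_succ_left (hσ : σ ≠ 0) (hτ : τ ≠ 0) {m n : ℕ}
    (hcb : c (b (ladderVec q T b μ v m n)) = b (c (ladderVec q T b μ v m n)) +
      bracket q (σ * τ / (q ^ (m + n)) ^ 2) • ladderVec q T b μ v m n)
    (hmn : lowerDefect q σ τ T b c μ v m n = 0) :
    lowerDefect q σ τ T b c μ v (m + 1) n = -lowerDefect q σ τ T b c μ v m (n + 1) := by
  have hne := symBracket_ladderParam_ne_zero h0 hg m n
  rw [raise_ladderVec h0 h2 hL hμ hv hne, map_smul, map_add, sub_eq_zero.mp hmn,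
    inv_smul_eq_iff₀ hne, ← lowered_add_lowered h0 h2 hL hμ hv hg hσ hτ] at hcb
  rw [lowerDefect, lowerDefect]
  linear_combination (norm := module) hcb

include h0 h2 hμ hg in
theorem smul_lowered_sub_smul_lowered (hσ : σ ≠ 0) (hτ : τ ≠ 0) :
    μ • lowered q σ τ T b μ v 0 1 - μ⁻¹ • lowered q σ τ T b μ v 1 0 =
      symBracket μ • (bracket q (τ / σ * μ) - (σ * τ)⁻¹ * bracket q μ) • v := by
  have hne : symBracket (q * μ) ≠ 0 := by simpa using hg 1
  have hne' : symBracket (q⁻¹ * μ) ≠ 0 := by simpa using hg (-1)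
  have hcoeff : μ * lowerCoeffSnd q σ τ μ q * symBracket (q⁻¹ * μ) -
      μ⁻¹ * lowerCoeffFst q σ τ μ q * symBracket (q * μ) =
        symBracket μ * (bracket q (τ / σ * μ) - (σ * τ)⁻¹ * bracket q μ) *
          symBracket (q * μ) * symBracket (q⁻¹ * μ) := by
    simpa using lowerCoeff_identity_of_singular h0 h2 hσ hτ hμ (.inl rfl) (.inl rfl)
  have hparam : ladderParam q μ 0 1 = q * μ := by simp [ladderParam, mul_comm]
  have hparam' : ladderParam q μ 1 0 = q⁻¹ * μ := by simp [ladderParam, div_eq_inv_mul]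
  rw [lowered, lowered, hparam, hparam']
  simp only [pow_zero, pow_one, lowerCoeffFst_one, lowerCoeffSnd_one, zero_smul, zero_add,
    add_zero, ladderVec, Nat.sub_self, smul_smul, ← sub_smul]
  congr 1
  generalize symBracket (q * μ) = y at *
  generalize symBracket (q⁻¹ * μ) = y' at *
  field_simp at hcoeff ⊢
  linear_combination hcoeff

include h0 h2 hL hμ hv hg in
theorem lowerDefect_zero_one (hσ : σ ≠ 0) (hτ : τ ≠ 0)
    (hz : c (qComm q T b v) = (bracket q (τ / σ * μ) - (σ * τ)⁻¹ * bracket q μ) • v)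
    (hsum : lowerDefect q σ τ T b c μ v 1 0 = -lowerDefect q σ τ T b c μ v 0 1) :
    lowerDefect q σ τ T b c μ v 0 1 = 0 := by
  have hne : symBracket μ ≠ 0 := by simpa using hg 0
  have hparam : ladderParam q μ 0 0 = μ := by simp [ladderParam]
  have hY := qComm_ladderVec h0 h2 hL hμ hv (symBracket_ladderParam_ne_zero h0 hg 0 0)
  rw [hparam, ladderVec] at hY
  rw [hY, map_smul, map_sub, map_smul, map_smul, inv_smul_eq_iff₀ hne] at hz
  have hlowered :=
    smul_lowered_sub_smul_lowered (T := T) (b := b) (v := v) h0 h2 hμ hg hσ hτ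
  have hsmul : symBracket μ • lowerDefect q σ τ T b c μ v 0 1 = 0 := by
    rw [lowerDefect, lowerDefect] at hsum
    rw [lowerDefect, symBracket]
    linear_combination (norm := module) hz - hlowered + μ⁻¹ • hsum
  exact (smul_eq_zero.mp hsmul).resolve_left hne

include h0 h2 hL hμ hv hg in
theorem lowerDefect_antidiagonal (hq : Function.Injective fun l : ℤ => q ^ l) {N : ℕ} (hN : N ≠ 0)
    (hsum : ∀ m n, m + n = N →
      lowerDefect q σ τ T b c μ v (m + 1) n = -lowerDefect q σ τ T b c μ v m (n + 1)) :
    lowerDefect q σ τ T b c μ v 0 (N + 1) = 0 := by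
  -- The defects at the two ends of the antidiagonal agree up to sign, but are annihilated by
  -- quadratic polynomials in `T` without a common root.
  have hup (m n : ℕ) : q * ladderParam q μ m n = q ^ ((n : ℤ) - m + 1) * μ := by
    rw [ladderParam_eq_zpow h0, zpow_add_one₀ h0]
    ring
  have hdown (m n : ℕ) : q⁻¹ * ladderParam q μ m n = q ^ ((n : ℤ) - m - 1) * μ := by
    rw [ladderParam_eq_zpow h0, zpow_sub_one₀ h0]
    ring
  have hne {i j : ℤ} (hij : Even (i + j)) (hij' : i ≠ j) :
      bracket q (q ^ i * μ) ≠ bracket q (q ^ j * μ) := fun h =>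
    hij' (hq (eq_of_bracket_zpow_mul_eq h0 h2 hμ hg hij h))
  have hfst := (isQuadraticEigenvector_lowerDefect (σ := σ) (τ := τ) h0 h2 hL hμ hv 0 (N + 1)).smul
    ((-1) ^ (N + 1))
  rw [← eq_neg_one_pow_smul (K := K) hsum (N + 1) 0 rfl, hup, hdown] at hfst
  have hlast := isQuadraticEigenvector_lowerDefect (σ := σ) (τ := τ) h0 h2 hL hμ hv (N + 1) 0
  rw [hup, hdown] at hlast
  have hzero := hlast.eq_zero hfst (hne ⟨1, by push_cast; ring⟩ (by push_cast; omega))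
    (hne ⟨0, by push_cast; ring⟩ (by push_cast; omega))
    (hne ⟨0, by push_cast; ring⟩ (by push_cast; omega))
    (hne ⟨-1, by push_cast; ring⟩ (by push_cast; omega))
  rw [eq_neg_one_pow_smul (K := K) hsum (N + 1) 0 rfl] at hzero
  exact (smul_eq_zero.mp hzero).resolve_left (pow_ne_zero _ (neg_ne_zero.mpr one_ne_zero))

include h0 h2 hL hμ hv hg in
theorem lower_ladderVec (hq : Function.Injective fun l : ℤ => q ^ l) (hσ : σ ≠ 0) (hτ : τ ≠ 0)
    (hcv : c v = 0)
    (hcb : ∀ m n, c (b (ladderVec q T b μ v m n)) = b (c (ladderVec q T b μ v m n)) +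
      bracket q (σ * τ / (q ^ (m + n)) ^ 2) • ladderVec q T b μ v m n)
    (hz : c (qComm q T b v) = (bracket q (τ / σ * μ) - (σ * τ)⁻¹ * bracket q μ) • v) (m n : ℕ) :
    c (ladderVec q T b μ v m n) = lowered q σ τ T b μ v m n := by
  suffices h : ∀ N m n, m + n = N → lowerDefect q σ τ T b c μ v m n = 0 from
    sub_eq_zero.mp (h _ m n rfl)
  intro N
  induction N with
  | zero =>
    intro m n hmn
    obtain ⟨rfl, rfl⟩ : m = 0 ∧ n = 0 := by omega
    simp [lowerDefect, ladderVec, lowered, hcv, lowerCoeffFst_one, lowerCoeffSnd_one]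
  | succ N ih =>
    have hsum (m n : ℕ) (hmn : m + n = N) :=
      lowerDefect_succ_left h0 h2 hL hμ hv hg hσ hτ (hcb m n) (ih m n hmn)
    have hzero : lowerDefect q σ τ T b c μ v 0 (N + 1) = 0 := by
      rcases eq_or_ne N 0 with rfl | hN
      · exact lowerDefect_zero_one h0 h2 hL hμ hv hg hσ hτ hz (hsum 0 0 rfl)
      · exact lowerDefect_antidiagonal h0 h2 hL hμ hv hg hq hN hsum
    intro m n hmn
    rw [eq_neg_one_pow_smul (K := K) hsum m n hmn, hzero, smul_zero]

end Lowering

end Ladder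

/-! ### Ladders from highest weight vectors -/

/-- The condition on `μ` that makes a Verma module with `B_0` acting by `[μ; 0]` good, up to the
shift of parameters along ladders. -/
structure IsGeneric (μ : Kq) : Prop where
  ne_zero : μ ≠ 0
  symBracket_ne_zero (l : ℤ) : symBracket (q ^ l * μ) ≠ 0

theorem IsGeneric.zpow_mul {μ : Kq} (hμ : IsGeneric μ) (k : ℤ) : IsGeneric (q ^ k * μ) where
  ne_zero := mul_ne_zero (zpow_ne_zero k q_ne_zero) hμ.ne_zero
  symBracket_ne_zero l := by
    rw [← mul_assoc, ← zpow_add₀ q_ne_zero]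
    exact hμ.symBracket_ne_zero _

theorem IsGeneric.symBracket_ladderParam_ne_zero {μ : Kq} (hμ : IsGeneric μ) (m n : ℕ) :
    symBracket (ladderParam q μ m n) ≠ 0 :=
  QSP.symBracket_ladderParam_ne_zero q_ne_zero hμ.symBracket_ne_zero m n

section HighestWeight

variable {M : Type*} [AddCommGroup M] [Module Kq M] {ρ : Uq' →ₐ[Kq] Module.End Kq M}

theorem serreExpr_apply (x y : Uq') (w : M) : ρ (serreExpr q x y) w =
    ρ x (ρ x (ρ y w)) - (q + q⁻¹) • ρ x (ρ y (ρ x w)) + ρ y (ρ x (ρ x w)) := by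
  simp only [serreExpr, map_add, map_sub, map_smul, map_mul, LinearMap.add_apply,
    LinearMap.sub_apply, LinearMap.smul_apply, Module.End.mul_apply]

theorem isLadder : IsLadder q (ρ Uq'.B0) (ρ Uq'.Bm1) (ρ Uq'.B1) where
  Tb w := by rw [← serreExpr_apply, Uq'.serreExpr_B0_Bm1]
  Tc w := by rw [← serreExpr_apply, Uq'.serreExpr_B0_B1]
  bT w := by
    rw [← serreExpr_apply, Uq'.serreExpr_Bm1_B0, map_zero, LinearMap.zero_apply]

theorem qComm_eq (w : M) : qComm q (ρ Uq'.B0) (ρ Uq'.Bm1) w = ρ Uq'.Y w := by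
  simp [qComm, Uq'.Y, Uq'.comm]

variable (ρ) in
/-- The vector with index `(m, n)` of the ladder of `B_0`, `B_{±1}` through `v`. -/
def weightVec (μ : Kq) (v : M) (m n : ℕ) : M := ladderVec q (ρ Uq'.B0) (ρ Uq'.Bm1) μ v m n

theorem apply_of_qCommute {x y : Uq'} {r : Kq} (h : x * y = r • (y * x)) {w : M} {a : Kq}
    (hw : ρ x w = a • w) : ρ x (ρ y w) = (a * r) • ρ y w := by
  rw [← Module.End.mul_apply, ← map_mul, h, map_smul, map_mul, LinearMap.smul_apply,
    Module.End.mul_apply, hw, map_smul, smul_smul, mul_comm]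

theorem apply_qComm {x : Uq'} {r : Kq} (h : x * Uq'.Bm1 = r • (Uq'.Bm1 * x))
    (h' : x * Uq'.B0 = Uq'.B0 * x) {w : M} {a : Kq} (hw : ρ x w = a • w) :
    ρ x (qComm q (ρ Uq'.B0) (ρ Uq'.Bm1) w) =
      (a * r) • qComm q (ρ Uq'.B0) (ρ Uq'.Bm1) w := by
  have h'' : x * Uq'.B0 = (1 : Kq) • (Uq'.B0 * x) := by rw [h', one_smul]
  have e1 := apply_of_qCommute h'' (apply_of_qCommute h hw)
  have e2 := apply_of_qCommute h (apply_of_qCommute h'' hw)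
  rw [mul_one] at e1 e2
  rw [qComm, map_sub, map_smul, e1, e2, smul_sub, smul_comm]

theorem apply_weightVec {x : Uq'} {r : Kq} (h : x * Uq'.Bm1 = r • (Uq'.Bm1 * x))
    (h' : x * Uq'.B0 = Uq'.B0 * x) {v : M} {a : Kq} (hv : ρ x v = a • v) (μ : Kq) (m n : ℕ) :
    ρ x (weightVec ρ μ v m n) = (a * r ^ (m + n)) • weightVec ρ μ v m n := by
  induction m with
  | zero =>
    induction n with
    | zero => simpa [weightVec, ladderVec] using hv
    | succ n ih =>
      rw [weightVec] at ih ⊢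
      rw [ladderVec, raiseSnd, map_add, map_smul, apply_of_qCommute h ih, apply_qComm h h' ih,
        smul_comm, ← smul_add, mul_assoc, ← pow_succ, add_assoc]
  | succ m ih =>
    rw [weightVec] at ih ⊢
    rw [ladderVec, raiseFst, map_sub, map_smul, apply_of_qCommute h ih, apply_qComm h h' ih,
      smul_comm, ← smul_sub, mul_assoc, ← pow_succ, add_right_comm]

namespace IsHighestWeight

variable {v : M} {k1 s t : ℤ} {μ : Kq} (h : IsHighestWeight ρ v k1 s t μ) (hμ : IsGeneric μ)

include h in
theorem Ddia_weightVec (m n : ℕ) : ρ Uq'.Ddia (weightVec ρ μ v m n) =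
    q ^ (k1 + s + t - (m + n)) • weightVec ρ μ v m n := by
  rw [apply_weightVec Uq'.Ddia_mul_Bm1 Uq'.Ddia_mul_B0 h.Ddia, inv_pow, ← zpow_natCast,
    ← zpow_neg, ← zpow_add₀ q_ne_zero]
  push_cast
  rfl

include h in
theorem D1_weightVec (m n : ℕ) : ρ Uq'.D1 (weightVec ρ μ v m n) =
    q ^ (k1 + (m + n)) • weightVec ρ μ v m n := by
  rw [apply_weightVec Uq'.D1_mul_Bm1 Uq'.D1_mul_B0 h.D1, ← zpow_natCast, ← zpow_add₀ q_ne_zero]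
  push_cast
  rfl

include h in
theorem DdiaInv_weightVec (m n : ℕ) : ρ Uq'.DdiaInv (weightVec ρ μ v m n) =
    (q ^ (k1 + s + t - (m + n)))⁻¹ • weightVec ρ μ v m n :=
  apply_DdiaInv (zpow_ne_zero _ q_ne_zero) (h.Ddia_weightVec m n)

include h in
theorem D1Inv_weightVec (m n : ℕ) : ρ Uq'.D1Inv (weightVec ρ μ v m n) =
    (q ^ (k1 + (m + n)))⁻¹ • weightVec ρ μ v m n :=
  apply_D1Inv (zpow_ne_zero _ q_ne_zero) (h.D1_weightVec m n)

include h hμ in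
theorem B0_weightVec (m n : ℕ) : ρ Uq'.B0 (weightVec ρ μ v m n) =
    bracket q (ladderParam q μ m n) • weightVec ρ μ v m n :=
  apply_ladderVec q_ne_zero q_sq_sub_one_ne_zero isLadder hμ.ne_zero h.B0 m n

include h hμ in
theorem Bm1_weightVec (m n : ℕ) : ρ Uq'.Bm1 (weightVec ρ μ v m n) =
    (symBracket (ladderParam q μ m n))⁻¹ •
      (weightVec ρ μ v (m + 1) n + weightVec ρ μ v m (n + 1)) :=
  raise_ladderVec q_ne_zero q_sq_sub_one_ne_zero isLadder hμ.ne_zero h.B0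
    (hμ.symBracket_ladderParam_ne_zero m n)

include h hμ in
theorem B1_weightVec (m n : ℕ) : ρ Uq'.B1 (weightVec ρ μ v m n) =
    (symBracket (ladderParam q μ m n))⁻¹ •
      (lowerCoeffFst q (q ^ s) (q ^ t) μ (q ^ m) • weightVec ρ μ v (m - 1) n +
        lowerCoeffSnd q (q ^ s) (q ^ t) μ (q ^ n) • weightVec ρ μ v m (n - 1)) := by
  have h0 := q_ne_zero
  refine lower_ladderVec h0 q_sq_sub_one_ne_zero isLadder hμ.ne_zero h.B0
    hμ.symBracket_ne_zero q_zpow_injective (zpow_ne_zero s h0) (zpow_ne_zero t h0) h.B1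
    (fun m n => ?_) ?_ m n
  · have := QSP.apply_B1_Bm1 (h.Ddia_weightVec m n) (h.D1_weightVec m n)
    rw [← weightVec, this, show k1 + s + t - ((m : ℤ) + n) - (k1 + (m + n)) =
      s + t - ((m + n : ℕ) : ℤ) * (2 : ℕ) by push_cast; ring, zpow_sub₀ h0, zpow_add₀ h0,
      zpow_mul, zpow_natCast, zpow_natCast]
  · rw [qComm_eq, ← apply_Z h.B1, h.Z, dominantZeta, zpow_sub₀ h0, mul_inv, ← zpow_neg, ← zpow_neg,
      ← zpow_add₀ h0]
    rfl

end IsHighestWeight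

end HighestWeight

theorem bracket_ladderParam_ne {μ : Kq} (hμ : IsGeneric μ) {m n m' n' : ℕ}
    (hs : m + n = m' + n') (hne : (m, n) ≠ (m', n')) :
    bracket q (ladderParam q μ m n) ≠ bracket q (ladderParam q μ m' n') := by
  intro h
  rw [ladderParam_eq_zpow q_ne_zero, ladderParam_eq_zpow q_ne_zero] at h
  have hexp := q_zpow_injective (eq_of_bracket_zpow_mul_eq q_ne_zero q_sq_sub_one_ne_zero
    hμ.ne_zero hμ.symBracket_ne_zero ⟨(n : ℤ) - m', by omega⟩ h)
  apply hne
  rw [Prod.mk.injEq]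
  omega

theorem single_mem_of_separated {F ι J : Type*} [Field F] (W : Submodule F (ι →₀ F))
    (d : J → ι → F) (hsep : ∀ i i', i ≠ i' → ∃ j, d j i ≠ d j i')
    (D : J → (ι →₀ F) →ₗ[F] (ι →₀ F)) (hD : ∀ j x i, D j x i = d j i * x i)
    (hW : ∀ j, ∀ x ∈ W, D j x ∈ W) {x : ι →₀ F} (hx : x ∈ W) {i : ι} (hi : x i ≠ 0) :
    Finsupp.single i 1 ∈ W := by
  induction hn : x.support.card using Nat.strong_induction_on generalizing x with
  | _ n ih =>
    by_cases hex : ∃ i' ∈ x.support, i' ≠ i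
    · -- `D j - d j i'` removes `i'` from the support and keeps `i`.
      obtain ⟨i', hi', hne⟩ := hex
      obtain ⟨j, hj⟩ := hsep i i' hne.symm
      have hval (k : ι) : (D j x - d j i' • x) k = (d j k - d j i') * x k := by simp [hD, sub_mul]
      have hsupp : (D j x - d j i' • x).support ⊂ x.support := by
        refine (Finset.ssubset_iff_of_subset fun k hk => ?_).mpr ⟨i', hi', ?_⟩
        · rw [Finsupp.mem_support_iff, hval] at hk
          exact Finsupp.mem_support_iff.mpr (right_ne_zero_of_mul hk)
        · rw [Finsupp.notMem_support_iff, hval, sub_self, zero_mul]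
      refine ih _ (hn ▸ Finset.card_lt_card hsupp) (W.sub_mem (hW j x hx) (W.smul_mem _ hx)) ?_ rfl
      rw [hval]
      exact mul_ne_zero (sub_ne_zero.mpr hj) hi
    · push Not at hex
      have hsingle : x = Finsupp.single i (x i) :=
        Finsupp.support_subset_singleton.mp fun k hk => Finset.mem_singleton.mpr (hex k hk)
      rw [hsingle, ← mul_one (x i), ← smul_eq_mul, ← Finsupp.smul_single] at hx
      exact (W.smul_mem_iff hi).mp hx

/-! ### The Fock space -/

section Fock

/-- The free module on the indices `(m, n)` of ladder vectors, a model of the Verma modules. -/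
abbrev Fock (R : Type*) [CommRing R] : Type _ := (ℕ × ℕ) →₀ R

variable {R : Type*} [CommRing R] [Algebra Kq R]

/-- The coefficient `lowerCoeffFst q σ τ μ A` with `c` in place of `(σ, σ⁻¹, τ, τ⁻¹)`, so that it
is polynomial in `c`. -/
def universalCoeffFst (μ : Kq) (c : Fin 4 → R) (A : Kq) : R :=
  (bracket q A * symBracket (μ / A)) • (((q - q⁻¹)⁻¹ • ((q / A) • c 0 - (q / A)⁻¹ • c 1)) *
    ((q * μ / A) • c 2 + (q * μ / A)⁻¹ • c 3))

/-- The coefficient `lowerCoeffSnd q σ τ μ B` with `c` in place of `(σ, σ⁻¹, τ, τ⁻¹)`, so that it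
is polynomial in `c`. -/
def universalCoeffSnd (μ : Kq) (c : Fin 4 → R) (B : Kq) : R :=
  (bracket q B * symBracket (μ * B)) • (((q - q⁻¹)⁻¹ • ((q / B) • c 2 - (q / B)⁻¹ • c 3)) *
    ((μ * B / q) • c 1 + (μ * B / q)⁻¹ • c 0))

/-- The action of a generator of `U_q'` on a basis vector, read off from the action on ladder
vectors. At `m = 0` or `n = 0` the truncated index `m - 1` or `n - 1` occurs with coefficient
zero. -/
def fockGen (k1 : ℤ) (μ : Kq) (c : Fin 4 → R) : Uq'.Label → ℕ × ℕ → Fock R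
  | .B1, (m, n) =>
    Finsupp.single (m - 1, n)
        ((symBracket (ladderParam q μ m n))⁻¹ • universalCoeffFst μ c (q ^ m)) +
      Finsupp.single (m, n - 1)
        ((symBracket (ladderParam q μ m n))⁻¹ • universalCoeffSnd μ c (q ^ n))
  | .Bm1, (m, n) =>
    Finsupp.single (m + 1, n) ((symBracket (ladderParam q μ m n))⁻¹ • 1) +
      Finsupp.single (m, n + 1) ((symBracket (ladderParam q μ m n))⁻¹ • 1)
  | .B0, (m, n) => Finsupp.single (m, n) (bracket q (ladderParam q μ m n) • 1)
  | .Ddia, (m, n) => Finsupp.single (m, n) (q ^ (k1 - (m + n)) • (c 0 * c 2))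
  | .DdiaInv, (m, n) => Finsupp.single (m, n) ((q ^ (k1 - (m + n)))⁻¹ • (c 1 * c 3))
  | .D1, (m, n) => Finsupp.single (m, n) (q ^ (k1 + (m + n)) • 1)
  | .D1Inv, (m, n) => Finsupp.single (m, n) ((q ^ (k1 + (m + n)))⁻¹ • 1)

/-- The action of the free algebra on the Fock space, which factors through `U_q'` only for
special values of `c`. -/
def fockRep (k1 : ℤ) (μ : Kq) (c : Fin 4 → R) :
    FreeAlgebra Kq Uq'.Label →ₐ[Kq] Module.End R (Fock R) :=
  FreeAlgebra.lift Kq fun g => Finsupp.linearCombination R (fockGen k1 μ c g)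

theorem fockRep_ι_single (k1 : ℤ) (μ : Kq) (c : Fin 4 → R) (g : Uq'.Label) (p : ℕ × ℕ) (r : R) :
    fockRep k1 μ c (FreeAlgebra.ι Kq g) (Finsupp.single p r) = r • fockGen k1 μ c g p := by
  simp [fockRep]

variable {R' : Type*} [CommRing R'] [Algebra Kq R']

theorem map_universalCoeffFst (f : R →ₐ[Kq] R') (μ : Kq) (c : Fin 4 → R) (A : Kq) :
    f (universalCoeffFst μ c A) = universalCoeffFst μ (f ∘ c) A := by
  simp [universalCoeffFst]

theorem map_universalCoeffSnd (f : R →ₐ[Kq] R') (μ : Kq) (c : Fin 4 → R) (A : Kq) :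
    f (universalCoeffSnd μ c A) = universalCoeffSnd μ (f ∘ c) A := by
  simp [universalCoeffSnd]

/-- Base change of the Fock space. -/
def fockMap (f : R →ₐ[Kq] R') : Fock R →+ Fock R' :=
  Finsupp.mapRange.addMonoidHom (f : R →+ R')

theorem fockMap_apply (f : R →ₐ[Kq] R') (x : Fock R) (p : ℕ × ℕ) : fockMap f x p = f (x p) :=
  rfl

theorem fockMap_single (f : R →ₐ[Kq] R') (p : ℕ × ℕ) (r : R) :
    fockMap f (Finsupp.single p r) = Finsupp.single p (f r) := by
  simp [fockMap]

theorem fockMap_smul (f : R →ₐ[Kq] R') (r : R) (x : Fock R) :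
    fockMap f (r • x) = f r • fockMap f x := by
  ext p
  simp [fockMap_apply]

theorem fockMap_fockGen (f : R →ₐ[Kq] R') (k1 : ℤ) (μ : Kq) (c : Fin 4 → R) (g : Uq'.Label)
    (p : ℕ × ℕ) : fockMap f (fockGen k1 μ c g p) = fockGen k1 μ (f ∘ c) g p := by
  cases g <;> simp [fockGen, fockMap_single, map_universalCoeffFst, map_universalCoeffSnd]

theorem fockMap_fockRep (f : R →ₐ[Kq] R') (k1 : ℤ) (μ : Kq) (c : Fin 4 → R)
    (x : FreeAlgebra Kq Uq'.Label) (y : Fock R) :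
    fockMap f (fockRep k1 μ c x y) = fockRep k1 μ (f ∘ c) x (fockMap f y) := by
  induction x using FreeAlgebra.induction generalizing y with
  | grade0 r =>
    ext p
    simp [AlgHom.commutes, Module.algebraMap_end_apply, fockMap_apply]
  | grade1 g =>
    induction y using Finsupp.induction_linear with
    | zero => simp
    | add y z hy hz => simp [hy, hz]
    | single p r =>
      rw [fockRep_ι_single, fockMap_smul, fockMap_fockGen, fockMap_single, fockRep_ι_single]
  | mul a b ha hb => simp [ha, hb]
  | add a b ha hb => simp [ha, hb]

end Fock

/-- The specialization `(q^s, q^{-s}, q^t, q^{-t})` of the parameters of `fockRep`. -/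
def stParam (s t : ℤ) : Fin 4 → Kq := ![q ^ s, (q ^ s)⁻¹, q ^ t, (q ^ t)⁻¹]

theorem universalCoeffFst_stParam (μ : Kq) (s t : ℤ) (A : Kq) :
    universalCoeffFst μ (stParam s t) A = lowerCoeffFst q (q ^ s) (q ^ t) μ A := by
  simp only [universalCoeffFst, lowerCoeffFst, stParam, smul_eq_mul, bracket, symBracket,
    Matrix.cons_val, mul_inv, div_eq_mul_inv, inv_inv]
  ring

theorem universalCoeffSnd_stParam (μ : Kq) (s t : ℤ) (A : Kq) :
    universalCoeffSnd μ (stParam s t) A = lowerCoeffSnd q (q ^ s) (q ^ t) μ A := by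
  simp only [universalCoeffSnd, lowerCoeffSnd, stParam, smul_eq_mul, bracket, symBracket,
    Matrix.cons_val, mul_inv, div_eq_mul_inv, inv_inv]
  ring

theorem fockGen_stParam_B1 (k1 s t : ℤ) (μ : Kq) (m n : ℕ) :
    fockGen k1 μ (stParam s t) .B1 (m, n) = (symBracket (ladderParam q μ m n))⁻¹ •
      (lowerCoeffFst q (q ^ s) (q ^ t) μ (q ^ m) • Finsupp.single (m - 1, n) 1 +
        lowerCoeffSnd q (q ^ s) (q ^ t) μ (q ^ n) • Finsupp.single (m, n - 1) 1) := by
  simp [fockGen, universalCoeffFst_stParam, universalCoeffSnd_stParam]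

theorem fockGen_stParam_Ddia (k1 s t : ℤ) (μ : Kq) (m n : ℕ) :
    fockGen k1 μ (stParam s t) .Ddia (m, n) =
      Finsupp.single (m, n) (q ^ (k1 + s + t - (m + n))) := by
  simp only [fockGen, stParam, Matrix.cons_val, smul_eq_mul, ← zpow_add₀ q_ne_zero]
  ring_nf

theorem fockGen_stParam_DdiaInv (k1 s t : ℤ) (μ : Kq) (m n : ℕ) :
    fockGen k1 μ (stParam s t) .DdiaInv (m, n) =
      Finsupp.single (m, n) (q ^ (k1 + s + t - (m + n)))⁻¹ := by
  simp only [fockGen, stParam, Matrix.cons_val, smul_eq_mul, ← mul_inv, ← zpow_add₀ q_ne_zero]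
  ring_nf

section Intertwine

variable {M : Type*} [AddCommGroup M] [Module Kq M] (ρ : Uq' →ₐ[Kq] Module.End Kq M)

/-- The linear map from the Fock space to a module with highest weight vector `v` that sends the
basis vectors to the ladder vectors of `v`. -/
def fockTo (μ : Kq) (v : M) : Fock Kq →ₗ[Kq] M :=
  Finsupp.linearCombination Kq fun p : ℕ × ℕ => weightVec ρ μ v p.1 p.2

theorem fockTo_single (μ : Kq) (v : M) (p : ℕ × ℕ) (r : Kq) :
    fockTo ρ μ v (Finsupp.single p r) = r • weightVec ρ μ v p.1 p.2 := by
  simp [fockTo]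

variable {ρ} {v : M} {k1 s t : ℤ} {μ : Kq}

theorem IsHighestWeight.fockTo_fockGen (h : IsHighestWeight ρ v k1 s t μ) (hμ : IsGeneric μ)
    (g : Uq'.Label) (p : ℕ × ℕ) :
    fockTo ρ μ v (fockGen k1 μ (stParam s t) g p) =
      ρ (Uq'.gen g) (weightVec ρ μ v p.1 p.2) := by
  obtain ⟨m, n⟩ := p
  cases g with
  | B1 =>
    simp only [fockGen_stParam_B1, map_add, map_smul, fockTo_single, one_smul, Uq'.gen,
      h.B1_weightVec hμ]
  | Bm1 =>
    simp only [fockGen, map_add, fockTo_single, Uq'.gen, h.Bm1_weightVec hμ, smul_eq_mul,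
      smul_add, mul_one]
  | B0 => simp only [fockGen, fockTo_single, Uq'.gen, h.B0_weightVec hμ, smul_eq_mul, mul_one]
  | Ddia => rw [fockGen_stParam_Ddia, fockTo_single, Uq'.gen, h.Ddia_weightVec]
  | DdiaInv => rw [fockGen_stParam_DdiaInv, fockTo_single, Uq'.gen, h.DdiaInv_weightVec]
  | D1 => simp only [fockGen, fockTo_single, Uq'.gen, h.D1_weightVec, smul_eq_mul, mul_one]
  | D1Inv => simp only [fockGen, fockTo_single, Uq'.gen, h.D1Inv_weightVec, smul_eq_mul, mul_one]

theorem IsHighestWeight.fockTo_fockRep (h : IsHighestWeight ρ v k1 s t μ) (hμ : IsGeneric μ)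
    (x : FreeAlgebra Kq Uq'.Label) (y : Fock Kq) :
    fockTo ρ μ v (fockRep k1 μ (stParam s t) x y) = ρ (Uq'.proj x) (fockTo ρ μ v y) := by
  induction x using FreeAlgebra.induction generalizing y with
  | grade0 r => simp [AlgHom.commutes, Module.algebraMap_end_apply]
  | grade1 g =>
    induction y using Finsupp.induction_linear with
    | zero => simp
    | add y z hy hz => simp only [map_add, hy, hz]
    | single p r =>
      rw [fockRep_ι_single, map_smul, fockTo_single, map_smul, Uq'.proj_ι,
        h.fockTo_fockGen hμ]
  | mul a b ha hb => simp [ha, hb]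
  | add a b ha hb => simp [ha, hb]

end Intertwine

/-! ### Stable subspaces of the Fock space -/

/-- `W` is stable under the generators of `U_q'`. This is stated in terms of `fockRep` because it
is used to prove that `fockRep` factors through `U_q'`. -/
def IsStable (k1 s t : ℤ) (μ : Kq) (W : Submodule Kq (Fock Kq)) : Prop :=
  ∀ g, ∀ x ∈ W, fockRep k1 μ (stParam s t) (FreeAlgebra.ι Kq g) x ∈ W

/-- Two generators acting diagonally on the Fock space. -/
def diagGen : Bool → Uq'.Label
  | true => .B0
  | false => .Ddia

/-- The eigenvalue of `diagGen j` on a basis vector of the Fock space. -/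
def diagEigenvalue (k1 s t : ℤ) (μ : Kq) : Bool → ℕ × ℕ → Kq
  | true, (m, n) => bracket q (ladderParam q μ m n)
  | false, (m, n) => q ^ (k1 + s + t - (m + n))

theorem diagEigenvalue_separates {k1 s t : ℤ} {μ : Kq} (hμ : IsGeneric μ) (p p' : ℕ × ℕ)
    (hne : p ≠ p') : ∃ j, diagEigenvalue k1 s t μ j p ≠ diagEigenvalue k1 s t μ j p' := by
  by_cases hs : p.1 + p.2 = p'.1 + p'.2
  · exact ⟨true, bracket_ladderParam_ne hμ hs hne⟩
  · refine ⟨false, fun h => hs ?_⟩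
    have := q_zpow_injective h
    omega

theorem fockGen_diagGen (k1 s t : ℤ) (μ : Kq) (j : Bool) (p : ℕ × ℕ) :
    fockGen k1 μ (stParam s t) (diagGen j) p =
      Finsupp.single p (diagEigenvalue k1 s t μ j p) := by
  cases j
  · exact fockGen_stParam_Ddia k1 s t μ p.1 p.2
  · simp [diagGen, fockGen, diagEigenvalue]

theorem fockRep_diagGen (k1 s t : ℤ) (μ : Kq) (j : Bool) (x : Fock Kq) (p : ℕ × ℕ) :
    fockRep k1 μ (stParam s t) (FreeAlgebra.ι Kq (diagGen j)) x p =
      diagEigenvalue k1 s t μ j p * x p := by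
  induction x using Finsupp.induction_linear with
  | zero => simp
  | add y z hy hz => simp [hy, hz, mul_add]
  | single p' r =>
    rw [fockRep_ι_single, fockGen_diagGen]
    by_cases h : p' = p
    · simp [h, mul_comm]
    · simp [h]

theorem bracket_q_zpow_ne_zero {k : ℤ} (hk : k ≠ 0) : bracket q (q ^ k) ≠ 0 := by
  refine div_ne_zero (fun h => hk ?_) q_sub_inv_ne_zero
  rw [← zpow_neg, sub_eq_zero] at h
  have := q_zpow_injective h
  omega

theorem lowerCoeffFst_ne_zero {s t : ℤ} {μ : Kq} (hμ : IsGeneric μ) {m : ℕ} (hm : m ≠ 0)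
    (hms : (m : ℤ) ≠ s + 1) : lowerCoeffFst q (q ^ s) (q ^ t) μ (q ^ m) ≠ 0 := by
  have h0 := q_ne_zero
  have hσ : q * q ^ s / q ^ m = q ^ (s + 1 - m) := by
    rw [zpow_sub₀ h0, zpow_add_one₀ h0, zpow_natCast, mul_comm q]
  have hdiv : μ / q ^ m = q ^ (-m : ℤ) * μ := by
    rw [zpow_neg, zpow_natCast, div_eq_inv_mul]
  have hτ : q * q ^ t * μ / q ^ m = q ^ (t + 1 - m) * μ := by
    rw [zpow_sub₀ h0, zpow_add_one₀ h0, zpow_natCast]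
    ring
  rw [lowerCoeffFst, hσ, hdiv, hτ, ← zpow_natCast]
  exact mul_ne_zero (mul_ne_zero (mul_ne_zero (bracket_q_zpow_ne_zero (by omega))
    (bracket_q_zpow_ne_zero (by omega))) (hμ.symBracket_ne_zero _)) (hμ.symBracket_ne_zero _)

theorem lowerCoeffSnd_ne_zero {s t : ℤ} {μ : Kq} (hμ : IsGeneric μ) {n : ℕ} (hn : n ≠ 0)
    (hnt : (n : ℤ) ≠ t + 1) : lowerCoeffSnd q (q ^ s) (q ^ t) μ (q ^ n) ≠ 0 := by
  have h0 := q_ne_zero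
  have hτ : q * q ^ t / q ^ n = q ^ (t + 1 - n) := by
    rw [zpow_sub₀ h0, zpow_add_one₀ h0, zpow_natCast, mul_comm q]
  have hmul : μ * q ^ n = q ^ (n : ℤ) * μ := by rw [zpow_natCast, mul_comm]
  have hσ : μ * q ^ n / (q * q ^ s) = q ^ (n - (s + 1)) * μ := by
    rw [zpow_sub₀ h0, zpow_add_one₀ h0, zpow_natCast]
    ring
  rw [lowerCoeffSnd, hτ, hσ, hmul, ← zpow_natCast]
  exact mul_ne_zero (mul_ne_zero (mul_ne_zero (bracket_q_zpow_ne_zero (by omega))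
    (bracket_q_zpow_ne_zero (by omega))) (hμ.symBracket_ne_zero _)) (hμ.symBracket_ne_zero _)

namespace IsStable

variable {k1 s t : ℤ} {μ : Kq} {W : Submodule Kq (Fock Kq)} (hW : IsStable k1 s t μ W)
  (hμ : IsGeneric μ)

include hW hμ

theorem single_mem {x : Fock Kq} (hx : x ∈ W) {p : ℕ × ℕ} (hp : x p ≠ 0) :
    Finsupp.single p 1 ∈ W :=
  single_mem_of_separated W (diagEigenvalue k1 s t μ) (diagEigenvalue_separates hμ)
    (fun j => fockRep k1 μ (stParam s t) (FreeAlgebra.ι Kq (diagGen j)))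
    (fockRep_diagGen k1 s t μ) (fun j => hW (diagGen j)) hx hp

theorem single_left_mem {m n : ℕ} (hms : (m : ℤ) ≠ s) (hm : Finsupp.single (m + 1, n) 1 ∈ W) :
    Finsupp.single (m, n) 1 ∈ W := by
  refine hW.single_mem hμ (hW .B1 _ hm) ?_
  have : lowerCoeffFst q (q ^ s) (q ^ t) μ (q ^ (m + 1)) ≠ 0 :=
    lowerCoeffFst_ne_zero hμ (Nat.succ_ne_zero m) (by push_cast; omega)
  simp [fockRep_ι_single, fockGen_stParam_B1, this, hμ.symBracket_ladderParam_ne_zero]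

theorem single_right_mem {m n : ℕ} (hnt : (n : ℤ) ≠ t) (hn : Finsupp.single (m, n + 1) 1 ∈ W) :
    Finsupp.single (m, n) 1 ∈ W := by
  refine hW.single_mem hμ (hW .B1 _ hn) ?_
  have : lowerCoeffSnd q (q ^ s) (q ^ t) μ (q ^ (n + 1)) ≠ 0 :=
    lowerCoeffSnd_ne_zero hμ (Nat.succ_ne_zero n) (by push_cast; omega)
  simp [fockRep_ι_single, fockGen_stParam_B1, this, hμ.symBracket_ladderParam_ne_zero]

theorem single_zero_mem {m n : ℕ} (hm : (m : ℤ) ≤ s) (hn : (n : ℤ) ≤ t)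
    (h : Finsupp.single (m, n) 1 ∈ W) : Finsupp.single (0, 0) 1 ∈ W := by
  induction m with
  | zero =>
    induction n with
    | zero => exact h
    | succ n ih =>
      push_cast at hn
      exact ih (by omega) (hW.single_right_mem hμ (by omega) h)
  | succ m ih =>
    push_cast at hm
    exact ih (by omega) (hW.single_left_mem hμ (by omega) h)

theorem single_succ_left_mem {m n : ℕ} (h : Finsupp.single (m, n) 1 ∈ W) :
    Finsupp.single (m + 1, n) 1 ∈ W := by
  refine hW.single_mem hμ (hW .Bm1 _ h) ?_
  simp [fockRep_ι_single, fockGen, hμ.symBracket_ladderParam_ne_zero]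

theorem single_succ_right_mem {m n : ℕ} (h : Finsupp.single (m, n) 1 ∈ W) :
    Finsupp.single (m, n + 1) 1 ∈ W := by
  refine hW.single_mem hμ (hW .Bm1 _ h) ?_
  simp [fockRep_ι_single, fockGen, hμ.symBracket_ladderParam_ne_zero]

theorem single_add_mem {m n : ℕ} (a b : ℕ) (h : Finsupp.single (m, n) 1 ∈ W) :
    Finsupp.single (m + a, n + b) 1 ∈ W := by
  induction a with
  | zero =>
    induction b with
    | zero => exact h
    | succ b ih => exact hW.single_succ_right_mem hμ ih
  | succ a ih => exact hW.single_succ_left_mem hμ ih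

theorem eq_top_of_single_zero_mem (h : Finsupp.single (0, 0) 1 ∈ W) : W = ⊤ := by
  refine eq_top_iff.mpr fun x _ => ?_
  induction x using Finsupp.induction_linear with
  | zero => exact W.zero_mem
  | add x y hx hy => exact W.add_mem (hx trivial) (hy trivial)
  | single p r => simpa using W.smul_mem r (hW.single_add_mem hμ p.1 p.2 h)

end IsStable

/-! ### Interpolation in `(q^s, q^t)` -/

/-- A function of an integer `s` which is a Laurent polynomial in `q^s`. -/
def IsLaurent (g : ℤ → Kq) : Prop :=
  ∃ (N : ℕ) (p : Polynomial Kq), ∀ s, (q ^ s) ^ N * g s = p.eval (q ^ s)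

namespace IsLaurent

theorem const (a : Kq) : IsLaurent fun _ => a := ⟨0, .C a, by simp⟩

theorem zpow : IsLaurent fun s => q ^ s := ⟨0, .X, by simp⟩

theorem zpow_inv : IsLaurent fun s => (q ^ s)⁻¹ :=
  ⟨1, 1, fun s => by simp [zpow_ne_zero s q_ne_zero]⟩

theorem add {g h : ℤ → Kq} (hg : IsLaurent g) (hh : IsLaurent h) :
    IsLaurent fun s => g s + h s := by
  obtain ⟨N, p, hp⟩ := hg
  obtain ⟨N', p', hp'⟩ := hh
  refine ⟨N + N', p * .X ^ N' + p' * .X ^ N, fun s => ?_⟩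
  simp only [Polynomial.eval_add, Polynomial.eval_mul, Polynomial.eval_pow, Polynomial.eval_X,
    ← hp, ← hp']
  ring

theorem mul {g h : ℤ → Kq} (hg : IsLaurent g) (hh : IsLaurent h) :
    IsLaurent fun s => g s * h s := by
  obtain ⟨N, p, hp⟩ := hg
  obtain ⟨N', p', hp'⟩ := hh
  refine ⟨N + N', p * p', fun s => ?_⟩
  rw [Polynomial.eval_mul, ← hp, ← hp']
  ring

theorem eq_zero {g : ℤ → Kq} (hg : IsLaurent g) (s₀ : ℕ) (h : ∀ s : ℕ, s₀ ≤ s → g s = 0)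
    (s : ℤ) : g s = 0 := by
  obtain ⟨N, p, hp⟩ := hg
  have : p = 0 := by
    refine Polynomial.eq_zero_of_infinite_isRoot p (Set.infinite_of_injective_forall_mem
      (f := fun k : ℕ => q ^ ((s₀ + k : ℕ) : ℤ)) (fun a b hab => ?_) fun k => ?_)
    · have := q_zpow_injective hab
      omega
    · rw [Set.mem_ofPred_eq, Polynomial.IsRoot, ← hp, h _ (Nat.le_add_right _ _), mul_zero]
  have h' := hp s
  rw [this, Polynomial.eval_zero] at h'
  exact (mul_eq_zero.mp h').resolve_left (pow_ne_zero _ (zpow_ne_zero _ q_ne_zero))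

theorem aeval {c : ℤ → Fin 4 → Kq} (hc : ∀ j, IsLaurent fun s => c s j)
    (F : MvPolynomial (Fin 4) Kq) : IsLaurent fun s => MvPolynomial.aeval (c s) F := by
  induction F using MvPolynomial.induction_on with
  | C a => simpa using const a
  | add f g hf hg => simpa using hf.add hg
  | mul_X f j hf => simpa only [map_mul, MvPolynomial.aeval_X] using hf.mul (hc j)

end IsLaurent

theorem isLaurent_stParam_left (t : ℤ) (j : Fin 4) : IsLaurent fun s => stParam s t j := by
  fin_cases j
  exacts [.zpow, .zpow_inv, .const (q ^ t), .const (q ^ t)⁻¹]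

theorem isLaurent_stParam_right (s : ℤ) (j : Fin 4) : IsLaurent fun t => stParam s t j := by
  fin_cases j
  exacts [.const (q ^ s), .const (q ^ s)⁻¹, .zpow, .zpow_inv]

theorem aeval_stParam_eq_zero (F : MvPolynomial (Fin 4) Kq) (s₀ t₀ : ℕ)
    (h : ∀ s t : ℕ, s₀ ≤ s → t₀ ≤ t → MvPolynomial.aeval (stParam s t) F = 0) (s t : ℤ) :
    MvPolynomial.aeval (stParam s t) F = 0 :=
  (IsLaurent.aeval (isLaurent_stParam_left t) F).eq_zero s₀
    (fun s hs => (IsLaurent.aeval (isLaurent_stParam_right s) F).eq_zero t₀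
      (fun t ht => h s t hs ht) t) s

theorem IsHighestWeight.isStable_ker_fockTo {M : Type*} [AddCommGroup M] [Module Kq M]
    {ρ : Uq' →ₐ[Kq] Module.End Kq M} {v : M} {k1 s t : ℤ} {μ : Kq}
    (h : IsHighestWeight ρ v k1 s t μ) (hμ : IsGeneric μ) :
    IsStable k1 s t μ (LinearMap.ker (fockTo ρ μ v)) := by
  intro g x hx
  rw [LinearMap.mem_ker] at hx ⊢
  rw [h.fockTo_fockRep hμ, hx, map_zero]

section FockModule

variable {μ : Kq} (hμ : IsGeneric μ)

include hμ in
theorem fockRep_single_apply_eq_zero_of_le (k1 : ℤ) (s t : ℕ) {x : FreeAlgebra Kq Uq'.Label}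
    (hx : Uq'.proj x = 0) (p p' : ℕ × ℕ) (hs : p'.1 ≤ s) (ht : p'.2 ≤ t) :
    fockRep k1 μ (stParam s t) x (Finsupp.single p 1) p' = 0 := by
  obtain ⟨M, _, _, ρ, v, hv, h⟩ := hasHighestWeight k1 s t hμ.ne_zero
  by_contra hne
  have hstable := h.isStable_ker_fockTo hμ
  have hmem : fockRep k1 μ (stParam s t) x (Finsupp.single p 1) ∈
      LinearMap.ker (fockTo ρ μ v) := by
    rw [LinearMap.mem_ker, h.fockTo_fockRep hμ, hx, map_zero, LinearMap.zero_apply]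
  have hzero := hstable.single_zero_mem hμ (Int.ofNat_le.mpr hs) (Int.ofNat_le.mpr ht)
    (hstable.single_mem hμ hmem hne)
  rw [LinearMap.mem_ker, fockTo_single, one_smul] at hzero
  exact hv (by simpa [weightVec, ladderVec] using hzero)

include hμ in
/-- The matrix coefficients are Laurent polynomials in `q^s` and `q^t`, and they vanish for all
large natural numbers `s` and `t`. -/
theorem fockRep_eq_zero (k1 s t : ℤ) {x : FreeAlgebra Kq Uq'.Label} (hx : Uq'.proj x = 0) :
    fockRep k1 μ (stParam s t) x = 0 := by
  refine Finsupp.lhom_ext' fun p => LinearMap.ext_ring (Finsupp.ext fun p' => ?_)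
  have hcoeff (s t : ℤ) : fockRep k1 μ (stParam s t) x (Finsupp.single p 1) p' =
      MvPolynomial.aeval (stParam s t)
        (fockRep k1 μ (MvPolynomial.X : Fin 4 → MvPolynomial (Fin 4) Kq) x
          (Finsupp.single p 1) p') := by
    rw [← fockMap_apply, fockMap_fockRep, fockMap_single, map_one]
    congr 4
    ext j
    simp
  refine (hcoeff s t).trans (aeval_stParam_eq_zero _ p'.1 p'.2 (fun s t hs ht => ?_) s t)
  rw [← hcoeff, fockRep_single_apply_eq_zero_of_le hμ k1 s t hx p p' hs ht]

/-- The representation of `U_q'` on the Fock space. -/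
def fockMod (k1 s t : ℤ) : Uq' →ₐ[Kq] Module.End Kq (Fock Kq) :=
  Uq'.descend (fockRep k1 μ (stParam s t)) fun _ hx => fockRep_eq_zero hμ k1 s t hx

theorem fockMod_gen (k1 s t : ℤ) (g : Uq'.Label) :
    fockMod hμ k1 s t (Uq'.gen g) = fockRep k1 μ (stParam s t) (FreeAlgebra.ι Kq g) :=
  Uq'.descend_gen _ _ g

theorem fockMod_proj (k1 s t : ℤ) (x : FreeAlgebra Kq Uq'.Label) :
    fockMod hμ k1 s t (Uq'.proj x) = fockRep k1 μ (stParam s t) x := by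
  have : (fockMod hμ k1 s t).comp Uq'.proj = fockRep k1 μ (stParam s t) := by
    ext1
    funext g
    simp only [Function.comp_apply, Uq'.proj_ι, fockMod_gen, AlgHom.coe_comp]
  exact DFunLike.congr_fun this x

end FockModule

/-! ### Singular vectors -/

/-- The indices at which the lowering coefficient with parameter `q^s` vanishes. -/
def IsSingularIndex (s : ℤ) (m : ℕ) : Prop := m = 0 ∨ (m : ℤ) = s + 1

theorem IsSingularIndex.zero (s : ℤ) : IsSingularIndex s 0 := .inl rfl

theorem IsSingularIndex.succ (s : ℕ) : IsSingularIndex s (s + 1) := .inr (by push_cast; rfl)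

theorem IsSingularIndex.q_pow {s : ℤ} {m : ℕ} (h : IsSingularIndex s m) :
    q ^ m = 1 ∨ q ^ m = q * q ^ s := by
  refine h.imp (fun h => by rw [h, pow_zero]) fun h => ?_
  rw [← zpow_natCast, h, zpow_add_one₀ q_ne_zero, mul_comm]

theorem lowerCoeffFst_eq_zero {s : ℤ} {m : ℕ} (h : IsSingularIndex s m) (τ μ : Kq) :
    lowerCoeffFst q (q ^ s) τ μ (q ^ m) = 0 := by
  rcases h.q_pow with h | h <;> rw [h]
  · exact lowerCoeffFst_one _ _ _
  · simp [lowerCoeffFst, bracket, q_ne_zero, zpow_ne_zero]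

theorem lowerCoeffSnd_eq_zero {t : ℤ} {n : ℕ} (h : IsSingularIndex t n) (σ μ : Kq) :
    lowerCoeffSnd q σ (q ^ t) μ (q ^ n) = 0 := by
  rcases h.q_pow with h | h <;> rw [h]
  · exact lowerCoeffSnd_one _ _ _
  · simp [lowerCoeffSnd, bracket, q_ne_zero, zpow_ne_zero]

section FockModule

variable {μ : Kq} (hμ : IsGeneric μ) (k1 s t : ℤ) (m n : ℕ)

theorem fockMod_B1 : fockMod hμ k1 s t Uq'.B1 (Finsupp.single (m, n) 1) =
    (symBracket (ladderParam q μ m n))⁻¹ •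
      (lowerCoeffFst q (q ^ s) (q ^ t) μ (q ^ m) • Finsupp.single (m - 1, n) 1 +
        lowerCoeffSnd q (q ^ s) (q ^ t) μ (q ^ n) • Finsupp.single (m, n - 1) 1) := by
  refine (LinearMap.congr_fun (fockMod_gen hμ k1 s t .B1) _).trans ?_
  rw [fockRep_ι_single, one_smul, fockGen_stParam_B1]

theorem fockMod_Bm1 : fockMod hμ k1 s t Uq'.Bm1 (Finsupp.single (m, n) 1) =
    (symBracket (ladderParam q μ m n))⁻¹ •
      (Finsupp.single (m + 1, n) 1 + Finsupp.single (m, n + 1) 1) := by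
  refine (LinearMap.congr_fun (fockMod_gen hμ k1 s t .Bm1) _).trans ?_
  simp [fockRep_ι_single, fockGen]

theorem fockMod_B0 : fockMod hμ k1 s t Uq'.B0 (Finsupp.single (m, n) 1) =
    bracket q (ladderParam q μ m n) • Finsupp.single (m, n) 1 := by
  refine (LinearMap.congr_fun (fockMod_gen hμ k1 s t .B0) _).trans ?_
  simp [fockRep_ι_single, fockGen]

theorem fockMod_Ddia : fockMod hμ k1 s t Uq'.Ddia (Finsupp.single (m, n) 1) =
    q ^ (k1 + s + t - (m + n)) • Finsupp.single (m, n) 1 := by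
  refine (LinearMap.congr_fun (fockMod_gen hμ k1 s t .Ddia) _).trans ?_
  rw [fockRep_ι_single, one_smul, fockGen_stParam_Ddia, Finsupp.smul_single_one]

theorem fockMod_D1 : fockMod hμ k1 s t Uq'.D1 (Finsupp.single (m, n) 1) =
    q ^ (k1 + (m + n)) • Finsupp.single (m, n) 1 := by
  refine (LinearMap.congr_fun (fockMod_gen hμ k1 s t .D1) _).trans ?_
  simp [fockRep_ι_single, fockGen]

theorem fockMod_qComm :
    qComm q (fockMod hμ k1 s t Uq'.B0) (fockMod hμ k1 s t Uq'.Bm1) (Finsupp.single (m, n) 1) =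
      (symBracket (ladderParam q μ m n))⁻¹ •
        (ladderParam q μ m n • Finsupp.single (m, n + 1) 1 -
          (ladderParam q μ m n)⁻¹ • Finsupp.single (m + 1, n) 1) := by
  have h0 := q_ne_zero
  have hx := ladderParam_ne_zero h0 hμ.ne_zero m n
  have hup : bracket q (q * ladderParam q μ m n) - q⁻¹ * bracket q (ladderParam q μ m n) =
      ladderParam q μ m n := by
    rw [bracket_q_mul h0 q_sq_sub_one_ne_zero hx, add_sub_cancel_left]
  have hdown : bracket q (q⁻¹ * ladderParam q μ m n) - q⁻¹ * bracket q (ladderParam q μ m n) =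
      -(ladderParam q μ m n)⁻¹ := by
    have h := bracket_q_mul_eq_add_inv h0 q_sq_sub_one_ne_zero (mul_ne_zero (inv_ne_zero h0) hx)
    rw [mul_inv_cancel_left₀ h0] at h
    rw [h]
    field_simp
    ring
  rw [qComm, fockMod_B0, fockMod_Bm1, map_smul, map_smul, map_add, fockMod_B0, fockMod_B0,
    fockMod_Bm1, ladderParam_succ_left, ladderParam_succ_right,
    smul_comm (bracket q _) (symBracket _)⁻¹, smul_comm q⁻¹ (symBracket _)⁻¹, ← smul_sub,
    smul_smul, smul_add, add_sub_add_comm, ← sub_smul, ← sub_smul, hup, hdown, neg_smul,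
    neg_add_eq_sub]

variable {s t m n} (hm : IsSingularIndex s m) (hn : IsSingularIndex t n)

include hm hn in
theorem fockMod_B1_of_isSingularIndex :
    fockMod hμ k1 s t Uq'.B1 (Finsupp.single (m, n) 1) = 0 := by
  rw [fockMod_B1, lowerCoeffFst_eq_zero hm, lowerCoeffSnd_eq_zero hn, zero_smul, zero_smul,
    add_zero, smul_zero]

include hm hn in
theorem fockMod_Z_of_isSingularIndex :
    fockMod hμ k1 s t Uq'.Z (Finsupp.single (m, n) 1) =
      dominantZeta (s - 2 * m) (t - 2 * n) (ladderParam q μ m n) • Finsupp.single (m, n) 1 := by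
  have h0 := q_ne_zero
  have hσ : q ^ (s - 2 * m) = q ^ s / (q ^ m) ^ 2 := by
    rw [zpow_sub₀ h0, mul_comm, zpow_mul, zpow_natCast, zpow_ofNat]
  have hτ : q ^ (t - 2 * n) = q ^ t / (q ^ n) ^ 2 := by
    rw [zpow_sub₀ h0, mul_comm, zpow_mul, zpow_natCast, zpow_ofNat]
  have hzeta := lowerCoeff_identity_of_singular h0 q_sq_sub_one_ne_zero (zpow_ne_zero s h0)
    (zpow_ne_zero t h0) hμ.ne_zero hm.q_pow hn.q_pow
  have hdom (s t : ℤ) (x : Kq) :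
      bracket q (q ^ t / q ^ s * x) - (q ^ s * q ^ t)⁻¹ * bracket q x = dominantZeta s t x := by
    rw [dominantZeta, zpow_sub₀ h0, ← zpow_add₀ h0, ← zpow_neg, neg_add']
  rw [← ladderParam, ← hσ, ← hτ, hdom] at hzeta
  have hx := ladderParam_ne_zero h0 hμ.ne_zero m n
  have hne := hμ.symBracket_ladderParam_ne_zero m n
  have hne_right := hμ.symBracket_ladderParam_ne_zero m (n + 1)
  have hne_left := hμ.symBracket_ladderParam_ne_zero (m + 1) n
  rw [ladderParam_succ_right] at hne_right
  rw [ladderParam_succ_left] at hne_left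
  rw [apply_Z (fockMod_B1_of_isSingularIndex hμ k1 hm hn), ← qComm_eq, fockMod_qComm, map_smul,
    map_sub, map_smul, map_smul, fockMod_B1, fockMod_B1, lowerCoeffFst_eq_zero hm,
    lowerCoeffSnd_eq_zero hn, ladderParam_succ_left, ladderParam_succ_right, zero_smul, zero_smul,
    zero_add, add_zero, Nat.add_sub_cancel, Nat.add_sub_cancel, smul_smul, smul_smul, smul_smul,
    smul_smul, ← sub_smul, smul_smul, pow_succ', pow_succ']
  congr 1
  generalize symBracket (ladderParam q μ m n) = y at *
  generalize symBracket (q * ladderParam q μ m n) = y₁ at *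
  generalize symBracket (q⁻¹ * ladderParam q μ m n) = y₂ at *
  field_simp at hzeta ⊢
  linear_combination hzeta

include hm hn in
theorem fockMod_isHighestWeight :
    IsHighestWeight (fockMod hμ k1 s t) (Finsupp.single (m, n) 1) (k1 + m + n) (s - 2 * m)
      (t - 2 * n) (ladderParam q μ m n) where
  B1 := fockMod_B1_of_isSingularIndex hμ k1 hm hn
  B0 := fockMod_B0 hμ k1 s t m n
  Ddia := by
    rw [fockMod_Ddia]
    congr 2
    ring
  D1 := by rw [fockMod_D1, add_assoc]
  Z := fockMod_Z_of_isSingularIndex hμ k1 hm hn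

end FockModule

/-! ### Verma modules -/

section Verma

local instance (kd k1 : ℤ) (β ζ : Kq) : SMul Uq' (Verma kd k1 β ζ) :=
  (Submodule.Quotient.module (vermaIdeal kd k1 β ζ)).toSMul

local instance (kd k1 : ℤ) (β ζ : Kq) : IsScalarTower Kq Uq' (Verma kd k1 β ζ) :=
  ⟨fun a u x => by
    obtain ⟨x, rfl⟩ := Submodule.Quotient.mk_surjective _ x
    exact congrArg Submodule.Quotient.mk (smul_assoc a u x)⟩

local instance (kd k1 : ℤ) (β ζ : Kq) : SMulCommClass Uq' Kq (Verma kd k1 β ζ) :=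
  ⟨fun u a x => by
    obtain ⟨x, rfl⟩ := Submodule.Quotient.mk_surjective _ x
    exact congrArg Submodule.Quotient.mk (mul_smul_comm a u x)⟩

theorem smul_verma_mk_one {kd k1 : ℤ} {β ζ a : Kq} {x : Uq'}
    (hx : x - algebraMap Kq Uq' a ∈ vermaIdeal kd k1 β ζ) :
    x • (Submodule.Quotient.mk 1 : Verma kd k1 β ζ) = a • Submodule.Quotient.mk 1 := by
  rw [← algebraMap_smul Uq' a, ← Submodule.Quotient.mk_smul, ← Submodule.Quotient.mk_smul,
    Submodule.Quotient.eq, smul_eq_mul, smul_eq_mul, mul_one, mul_one]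
  exact hx

theorem verma_isHighestWeight (k1 s t : ℤ) (μ : Kq) :
    IsHighestWeight
      (Algebra.lsmul Kq Kq (Verma (k1 + s + t) k1 (bracket q μ) (dominantZeta s t μ)))
      (Submodule.Quotient.mk 1) k1 s t μ where
  B1 := (smul_verma_mk_one (a := 0)
    (by rw [map_zero, sub_zero]; exact Submodule.subset_span (by simp))).trans (zero_smul _ _)
  B0 := smul_verma_mk_one (Submodule.subset_span (by simp))
  Ddia := smul_verma_mk_one (Submodule.subset_span (by simp))
  D1 := smul_verma_mk_one (Submodule.subset_span (by simp))
  Z := smul_verma_mk_one (Submodule.subset_span (by simp))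

theorem IsHighestWeight.eq_zero_of_mem_vermaIdeal {M : Type*} [AddCommGroup M] [Module Kq M]
    {ρ : Uq' →ₐ[Kq] Module.End Kq M} {v : M} {k1 s t : ℤ} {μ : Kq}
    (h : IsHighestWeight ρ v k1 s t μ) {u : Uq'}
    (hu : u ∈ vermaIdeal (k1 + s + t) k1 (bracket q μ) (dominantZeta s t μ)) : ρ u v = 0 := by
  have hsub {x : Uq'} {a : Kq} (hx : ρ x v = a • v) : ρ (x - algebraMap Kq Uq' a) v = 0 := by
    rw [map_sub, LinearMap.sub_apply, hx, AlgHom.commutes, Module.algebraMap_end_apply, sub_self]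
  induction hu using Submodule.span_induction with
  | mem x hx =>
    rcases hx with rfl | rfl | rfl | rfl | rfl | rfl
    · exact h.B1
    · simp [Uq'.X, Uq'.comm, h.B1, h.B0]
    · exact hsub h.Ddia
    · exact hsub h.D1
    · exact hsub h.B0
    · exact hsub h.Z
  | zero => simp
  | add x y _ _ hx hy => rw [map_add, LinearMap.add_apply, hx, hy, add_zero]
  | smul a x _ hx => rw [smul_eq_mul, map_mul, Module.End.mul_apply, hx, map_zero]

/-- The linear isomorphism `e` identifies the `U_q'`-module `N` with the representation `ρ` on a
Fock space. -/
def IsFock (ρ : Uq' →ₐ[Kq] Module.End Kq (Fock Kq)) {N : Type*} [AddCommGroup N] [Module Kq N]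
    [Module Uq' N] (e : Fock Kq ≃ₗ[Kq] N) : Prop :=
  ∀ u y, e (ρ u y) = u • e y

variable {μ : Kq} (hμ : IsGeneric μ) (k1 s t : ℤ)

theorem fockMod_vacuum_isHighestWeight :
    IsHighestWeight (fockMod hμ k1 s t) (Finsupp.single (0, 0) 1) k1 s t μ := by
  simpa [ladderParam] using fockMod_isHighestWeight hμ k1 (.zero s) (.zero t)

theorem fockMod_vacuum_surjective (y : Fock Kq) :
    ∃ u, fockMod hμ k1 s t u (Finsupp.single (0, 0) 1) = y := by
  set W : Submodule Kq (Fock Kq) := LinearMap.range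
    ((LinearMap.applyₗ (Finsupp.single (0, 0) 1)).comp (fockMod hμ k1 s t).toLinearMap)
  have hW : IsStable k1 s t μ W := by
    rintro g _ ⟨u, rfl⟩
    refine ⟨Uq'.gen g * u, ?_⟩
    simp [← fockMod_gen hμ]
  obtain ⟨u, hu⟩ : y ∈ W := hW.eq_top_of_single_zero_mem hμ ⟨1, by simp⟩ ▸ Submodule.mem_top
  exact ⟨u, by simpa using hu⟩

/-- Both modules are generated by a highest weight vector and `Verma` is the universal such module,
whereas `fockTo` maps the Fock space to every module with a highest weight vector. -/
theorem exists_isFock_verma {k1 s t kd ko : ℤ} {β ζ : Kq} (hkd : kd = k1 + s + t)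
    (hko : ko = k1) (hβ : β = bracket q μ) (hζ : ζ = dominantZeta s t μ) :
    ∃ e : Fock Kq ≃ₗ[Kq] Verma kd ko β ζ, IsFock (fockMod hμ k1 s t) e := by
  subst kd ko β ζ
  have h := verma_isHighestWeight k1 s t μ
  set φ := fockTo (Algebra.lsmul Kq Kq (Verma _ k1 _ _)) μ (Submodule.Quotient.mk 1) with hφ
  have hcomm (u : Uq') (y : Fock Kq) : φ (fockMod hμ k1 s t u y) = u • φ y := by
    obtain ⟨x, rfl⟩ := Uq'.proj_surjective u
    rw [fockMod_proj, hφ, h.fockTo_fockRep hμ, Algebra.lsmul_coe]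
  have hvac : φ (Finsupp.single (0, 0) 1) = Submodule.Quotient.mk 1 := by
    rw [hφ, fockTo_single, one_smul, weightVec, ladderVec]
  have hmk (u : Uq') : φ (fockMod hμ k1 s t u (Finsupp.single (0, 0) 1)) =
      Submodule.Quotient.mk u := by
    rw [hcomm, hvac, ← Submodule.Quotient.mk_smul, smul_eq_mul, mul_one]
  refine ⟨LinearEquiv.ofBijective φ ⟨?_, fun z => ?_⟩, hcomm⟩
  · rw [← LinearMap.ker_eq_bot, LinearMap.ker_eq_bot']
    intro y hy
    obtain ⟨u, rfl⟩ := fockMod_vacuum_surjective hμ k1 s t y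
    rw [hmk, Submodule.Quotient.mk_eq_zero] at hy
    exact (fockMod_vacuum_isHighestWeight hμ k1 s t).eq_zero_of_mem_vermaIdeal hy
  · obtain ⟨u, rfl⟩ := Submodule.Quotient.mk_surjective _ z
    exact ⟨_, hmk u⟩

end Verma

/-! ### Embeddings of Fock spaces -/

section Shift

variable {R : Type*} [CommRing R]

/-- The embedding of the Fock space onto the quadrant with corner `(m, n)`. -/
def fockShift (m n : ℕ) : Fock R →ₗ[R] Fock R :=
  Finsupp.lmapDomain R R fun p => (m + p.1, n + p.2)

theorem fockShift_injective (m n : ℕ) : Function.Injective (fockShift (R := R) m n) :=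
  Finsupp.mapDomain_injective fun _ _ h => by simpa [Prod.ext_iff] using h

theorem fockShift_single (m n : ℕ) (p : ℕ × ℕ) (r : R) :
    fockShift m n (Finsupp.single p r) = Finsupp.single (m + p.1, n + p.2) r :=
  Finsupp.mapDomain_single

theorem fockShift_fockShift (m n m' n' : ℕ) (y : Fock R) :
    fockShift m n (fockShift m' n' y) = fockShift (m + m') (n + n') y := by
  induction y using Finsupp.induction_linear with
  | zero => simp
  | add y z hy hz => simp [hy, hz]
  | single p r => simp [fockShift_single, add_assoc]

theorem range_fockShift (m n : ℕ) :
    LinearMap.range (fockShift (R := R) m n) =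
      Finsupp.supported R R {p : ℕ × ℕ | m ≤ p.1 ∧ n ≤ p.2} := by
  rw [← Submodule.map_top, ← Finsupp.supported_univ, fockShift, Finsupp.lmapDomain_supported,
    Set.image_univ]
  congr 1
  ext ⟨a, b⟩
  simp [le_iff_exists_add, eq_comm]

theorem range_fockShift_sup (a b : ℕ) :
    LinearMap.range (fockShift (R := R) a 0) ⊔ LinearMap.range (fockShift 0 b) =
      Finsupp.supported R R {p : ℕ × ℕ | a ≤ p.1 ∨ b ≤ p.2} := by
  rw [range_fockShift, range_fockShift, ← Finsupp.supported_union]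
  simp only [zero_le, and_true, true_and, Set.ofPred_or]

theorem range_fockShift_inf (a b : ℕ) :
    LinearMap.range (fockShift (R := R) a 0) ⊓ LinearMap.range (fockShift 0 b) =
      LinearMap.range (fockShift a b) := by
  simp only [range_fockShift, ← Finsupp.supported_inter, zero_le, and_true, true_and,
    Set.ofPred_and]

theorem fockShift_add_eq_zero_iff {a b : ℕ} {y₁ y₂ : Fock R} :
    fockShift a 0 y₁ + fockShift 0 b y₂ = 0 ↔
      ∃ z, fockShift 0 b z = y₁ ∧ -fockShift a 0 z = y₂ := by
  constructor
  · intro h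
    have hmem : fockShift a 0 y₁ ∈ LinearMap.range (fockShift (R := R) a b) :=
      range_fockShift_inf (R := R) a b ▸
        ⟨⟨y₁, rfl⟩, -y₂, by rw [map_neg, eq_neg_of_add_eq_zero_left h]⟩
    obtain ⟨z, hz⟩ := hmem
    refine ⟨z, fockShift_injective a 0 ?_, fockShift_injective 0 b ?_⟩
    · simp [fockShift_fockShift, hz]
    · simp [fockShift_fockShift, hz, eq_neg_of_add_eq_zero_right h]
  · rintro ⟨z, rfl, rfl⟩
    simp [fockShift_fockShift]

end Shift

/-- The linear map `φ` is a homomorphism of representations of `U_q'`. -/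
def Intertwines {M M' : Type*} [AddCommGroup M] [Module Kq M] [AddCommGroup M'] [Module Kq M']
    (ρ : Uq' →ₐ[Kq] Module.End Kq M) (ρ' : Uq' →ₐ[Kq] Module.End Kq M') (φ : M →ₗ[Kq] M') : Prop :=
  ∀ u y, φ (ρ u y) = ρ' u (φ y)

section Embedding

variable {μ : Kq} (hμ : IsGeneric μ)

theorem fockMod_raiseFst (k1 s t : ℤ) (m n : ℕ) :
    raiseFst q (fockMod hμ k1 s t Uq'.B0) (fockMod hμ k1 s t Uq'.Bm1) (ladderParam q μ m n)
      (Finsupp.single (m, n) 1) = Finsupp.single (m + 1, n) 1 := by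
  rw [raiseFst, fockMod_qComm, fockMod_Bm1, smul_comm, ← smul_sub,
    inv_smul_eq_iff₀ (hμ.symBracket_ladderParam_ne_zero m n), symBracket, smul_add, add_smul]
  abel

theorem fockMod_raiseSnd (k1 s t : ℤ) (m n : ℕ) :
    raiseSnd q (fockMod hμ k1 s t Uq'.B0) (fockMod hμ k1 s t Uq'.Bm1) (ladderParam q μ m n)
      (Finsupp.single (m, n) 1) = Finsupp.single (m, n + 1) 1 := by
  rw [raiseSnd, fockMod_qComm, fockMod_Bm1, smul_comm, ← smul_add,
    inv_smul_eq_iff₀ (hμ.symBracket_ladderParam_ne_zero m n), symBracket, smul_add, add_smul]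
  abel

theorem weightVec_fockMod (k1 s t : ℤ) (m n m' n' : ℕ) :
    weightVec (fockMod hμ k1 s t) (ladderParam q μ m n) (Finsupp.single (m, n) 1) m' n' =
      Finsupp.single (m + m', n + n') 1 := by
  induction m' with
  | zero =>
    induction n' with
    | zero => rw [weightVec, ladderVec, add_zero, add_zero]
    | succ n' ih =>
      rw [weightVec] at ih ⊢
      rw [ladderVec, ih, ladderParam_ladderParam, fockMod_raiseSnd, add_assoc]
  | succ m' ih =>
    rw [weightVec] at ih ⊢
    rw [ladderVec, ih, ladderParam_ladderParam, fockMod_raiseFst, add_assoc]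

theorem fockShift_intertwines {μ' : Kq} (hμ' : IsGeneric μ') {k1 s t k1' s' t' : ℤ} {m n : ℕ}
    (hm : IsSingularIndex s m) (hn : IsSingularIndex t n) (hk : k1' = k1 + m + n)
    (hs : s' = s - 2 * m) (ht : t' = t - 2 * n) (hparam : μ' = q ^ ((n : ℤ) - m) * μ) :
    Intertwines (fockMod hμ' k1' s' t') (fockMod hμ k1 s t) (fockShift m n) := by
  intro u y
  obtain ⟨x, rfl⟩ := Uq'.proj_surjective u
  rw [← ladderParam_eq_zpow q_ne_zero] at hparam
  have hv := fockMod_isHighestWeight hμ k1 hm hn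
  rw [← hk, ← hs, ← ht, ← hparam] at hv
  have hshift : fockShift m n = fockTo (fockMod hμ k1 s t) μ' (Finsupp.single (m, n) 1) := by
    refine Finsupp.lhom_ext fun p r => ?_
    rw [fockShift_single, fockTo_single, hparam, weightVec_fockMod, Finsupp.smul_single_one]
  rw [fockMod_proj, hshift, hv.fockTo_fockRep hμ']

end Embedding

/-! ### Resolutions -/

theorem fockMod_stable {μ : Kq} (hμ : IsGeneric μ) {k1 s t : ℤ} {V : Type*} [AddCommGroup V]
    [Module Kq V] [Module Uq' V] [IsScalarTower Kq Uq' V] {e : Fock Kq ≃ₗ[Kq] V}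
    (he : IsFock (fockMod hμ k1 s t) e) (N : Submodule Uq' V) :
    IsStable k1 s t μ ((N.restrictScalars Kq).comap e.toLinearMap) := by
  intro g x hx
  have hsmul : e (fockMod hμ k1 s t (Uq'.gen g) x) ∈ N := he _ x ▸ N.smul_mem _ hx
  rwa [fockMod_gen] at hsmul

/-- A homomorphism of representations on Fock spaces, as a map of the modules identified with
them. -/
def IsFock.hom {V V' : Type*} [AddCommGroup V] [Module Kq V] [Module Uq' V] [AddCommGroup V']
    [Module Kq V'] [Module Uq' V'] {ρ ρ' : Uq' →ₐ[Kq] Module.End Kq (Fock Kq)}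
    {e : Fock Kq ≃ₗ[Kq] V} {e' : Fock Kq ≃ₗ[Kq] V'} (he : IsFock ρ e) (he' : IsFock ρ' e')
    {φ : Fock Kq →ₗ[Kq] Fock Kq} (hφ : Intertwines ρ ρ' φ) : V →ₗ[Uq'] V' where
  toFun x := e' (φ (e.symm x))
  map_add' x y := by simp only [map_add]
  map_smul' u x := by
    obtain ⟨y, rfl⟩ := e.surjective x
    rw [← he, e.symm_apply_apply, e.symm_apply_apply, hφ, he', RingHom.id_apply]

theorem IsFock.hom_apply {V V' : Type*} [AddCommGroup V] [Module Kq V] [Module Uq' V]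
    [AddCommGroup V'] [Module Kq V'] [Module Uq' V']
    {ρ ρ' : Uq' →ₐ[Kq] Module.End Kq (Fock Kq)} {e : Fock Kq ≃ₗ[Kq] V}
    {e' : Fock Kq ≃ₗ[Kq] V'} (he : IsFock ρ e) (he' : IsFock ρ' e')
    {φ : Fock Kq →ₗ[Kq] Fock Kq} (hφ : Intertwines ρ ρ' φ) (y : Fock Kq) :
    he.hom he' hφ (e y) = e' (φ y) :=
  congrArg (fun y => e' (φ y)) (e.symm_apply_apply y)

theorem finiteDimensional_quotient_of_single_mem {V : Type*} [AddCommGroup V] [Module Kq V]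
    [Module Uq' V] [IsScalarTower Kq Uq' V] (e : Fock Kq ≃ₗ[Kq] V) (N : Submodule Uq' V)
    {a b : ℕ} (h : ∀ p : ℕ × ℕ, a ≤ p.1 ∨ b ≤ p.2 → e (Finsupp.single p 1) ∈ N) :
    FiniteDimensional Kq (V ⧸ N) := by
  classical
  refine ⟨⟨(Finset.range a ×ˢ Finset.range b).image
    fun p => N.mkQ (e (Finsupp.single p 1)), eq_top_iff.mpr fun x _ => ?_⟩⟩
  obtain ⟨x, rfl⟩ := N.mkQ_surjective x
  obtain ⟨y, rfl⟩ := e.surjective x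
  induction y using Finsupp.induction_linear with
  | zero => simp
  | add y z hy hz =>
    rw [map_add, map_add]
    exact Submodule.add_mem _ (hy trivial) (hz trivial)
  | single p r =>
    rw [← Finsupp.smul_single_one, map_smul, Submodule.mkQ_apply, Submodule.Quotient.mk_smul]
    refine Submodule.smul_mem _ _ ?_
    by_cases hp : a ≤ p.1 ∨ b ≤ p.2
    · rw [(Submodule.Quotient.mk_eq_zero N).mpr (h p hp)]
      exact Submodule.zero_mem _
    · push Not at hp
      refine Submodule.subset_span ?_
      rw [Finset.coe_image]
      exact ⟨p, by simpa using hp, rfl⟩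

section Resolution

variable {μ : Kq} (hμ : IsGeneric μ) (k1 : ℤ) (s t : ℕ)

/-- The representation generated by the singular vector at `(s + 1, 0)`. -/
abbrev fockModFst : Uq' →ₐ[Kq] Module.End Kq (Fock Kq) :=
  fockMod (hμ.zpow_mul (-(s + 1))) (k1 + s + 1) (-s - 2) t

/-- The representation generated by the singular vector at `(0, t + 1)`. -/
abbrev fockModSnd : Uq' →ₐ[Kq] Module.End Kq (Fock Kq) :=
  fockMod (hμ.zpow_mul (t + 1)) (k1 + t + 1) s (-t - 2)

/-- The representation generated by the singular vector at `(s + 1, t + 1)`. -/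
abbrev fockModBoth : Uq' →ₐ[Kq] Module.End Kq (Fock Kq) :=
  fockMod (hμ.zpow_mul (t - s)) (k1 + s + t + 2) (-s - 2) (-t - 2)

theorem fockModFst_intertwines :
    Intertwines (fockModFst hμ k1 s t) (fockMod hμ k1 s t) (fockShift (s + 1) 0) :=
  fockShift_intertwines _ _ (.succ s) (.zero t) (by push_cast; ring) (by push_cast; ring)
    (by push_cast; ring) (by push_cast; ring_nf)

theorem fockModSnd_intertwines :
    Intertwines (fockModSnd hμ k1 s t) (fockMod hμ k1 s t) (fockShift 0 (t + 1)) :=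
  fockShift_intertwines _ _ (.zero s) (.succ t) (by push_cast; ring) (by push_cast; ring)
    (by push_cast; ring) (by push_cast; ring_nf)

theorem fockModBoth_intertwines_fst :
    Intertwines (fockModBoth hμ k1 s t) (fockModFst hμ k1 s t) (fockShift 0 (t + 1)) :=
  fockShift_intertwines _ _ (.zero _) (.succ t) (by push_cast; ring) (by push_cast; ring)
    (by push_cast; ring) (by rw [← mul_assoc, ← zpow_add₀ q_ne_zero]; push_cast; ring_nf)

theorem fockModBoth_intertwines_snd :
    Intertwines (fockModBoth hμ k1 s t) (fockModSnd hμ k1 s t) (fockShift (s + 1) 0) :=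
  fockShift_intertwines _ _ (.succ s) (.zero _) (by push_cast; ring) (by push_cast; ring)
    (by push_cast; ring) (by rw [← mul_assoc, ← zpow_add₀ q_ne_zero]; push_cast; ring_nf)

variable {hμ k1 s t} {V V₁ V₂ V₃ : Type*} [AddCommGroup V] [Module Kq V] [Module Uq' V]
  [AddCommGroup V₁] [Module Kq V₁] [Module Uq' V₁] [AddCommGroup V₂] [Module Kq V₂]
  [Module Uq' V₂] [AddCommGroup V₃] [Module Kq V₃] [Module Uq' V₃] {e : Fock Kq ≃ₗ[Kq] V}
  {e₁ : Fock Kq ≃ₗ[Kq] V₁} {e₂ : Fock Kq ≃ₗ[Kq] V₂} {e₃ : Fock Kq ≃ₗ[Kq] V₃}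
  (he : IsFock (fockMod hμ k1 s t) e) (he₁ : IsFock (fockModFst hμ k1 s t) e₁)
  (he₂ : IsFock (fockModSnd hμ k1 s t) e₂) (he₃ : IsFock (fockModBoth hμ k1 s t) e₃)

/-- The map `M₁ ⊕ M₂ → M` of the resolution, the sum of two embeddings. -/
def resolutionMap : V₁ × V₂ →ₗ[Uq'] V :=
  (he₁.hom he (fockModFst_intertwines hμ k1 s t)).coprod
    (he₂.hom he (fockModSnd_intertwines hμ k1 s t))

/-- The map `M₃ → M₁ ⊕ M₂` of the resolution, the difference of two embeddings. -/
def syzygyMap : V₃ →ₗ[Uq'] V₁ × V₂ :=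
  (he₃.hom he₁ (fockModBoth_intertwines_fst hμ k1 s t)).prod
    (-he₃.hom he₂ (fockModBoth_intertwines_snd hμ k1 s t))

theorem resolutionMap_apply (y₁ y₂ : Fock Kq) :
    resolutionMap he he₁ he₂ (e₁ y₁, e₂ y₂) =
      e (fockShift (s + 1) 0 y₁ + fockShift 0 (t + 1) y₂) := by
  rw [resolutionMap, LinearMap.coprod_apply, IsFock.hom_apply, IsFock.hom_apply, map_add]

theorem syzygyMap_apply (y : Fock Kq) :
    syzygyMap he₁ he₂ he₃ (e₃ y) = (e₁ (fockShift 0 (t + 1) y), e₂ (-fockShift (s + 1) 0 y)) := by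
  rw [syzygyMap, LinearMap.prod_apply, Function.prod_apply, LinearMap.neg_apply, IsFock.hom_apply,
    IsFock.hom_apply, map_neg]

theorem syzygyMap_injective : Function.Injective (syzygyMap he₁ he₂ he₃) := by
  refine (injective_iff_map_eq_zero _).mpr fun x hx => ?_
  obtain ⟨y, rfl⟩ := e₃.surjective x
  rw [syzygyMap_apply, Prod.mk_eq_zero, e₁.map_eq_zero_iff] at hx
  rw [(map_eq_zero_iff _ (fockShift_injective _ _)).mp hx.1, map_zero]

theorem syzygyMap_exact_resolutionMap :
    Function.Exact (syzygyMap he₁ he₂ he₃) (resolutionMap he he₁ he₂) := by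
  rintro ⟨x₁, x₂⟩
  obtain ⟨y₁, rfl⟩ := e₁.surjective x₁
  obtain ⟨y₂, rfl⟩ := e₂.surjective x₂
  rw [resolutionMap_apply, e.map_eq_zero_iff, fockShift_add_eq_zero_iff]
  simp only [Set.mem_range, e₃.surjective.exists, syzygyMap_apply, Prod.mk.injEq,
    e₁.injective.eq_iff, e₂.injective.eq_iff]

theorem mem_range_resolutionMap {y : Fock Kq} :
    e y ∈ LinearMap.range (resolutionMap he he₁ he₂) ↔
      ∀ p, y p ≠ 0 → s + 1 ≤ p.1 ∨ t + 1 ≤ p.2 := by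
  trans y ∈ Finsupp.supported Kq Kq {p : ℕ × ℕ | s + 1 ≤ p.1 ∨ t + 1 ≤ p.2}
  · rw [← range_fockShift_sup]
    simp only [Submodule.mem_sup, LinearMap.mem_range, Prod.exists, e₁.surjective.exists,
      e₂.surjective.exists, resolutionMap_apply, e.injective.eq_iff, exists_exists_eq_and]
  · simp [Finsupp.mem_supported, Set.subset_def]

variable [IsScalarTower Kq Uq' V]

include he in
theorem IsFock.apply_eq_zero_of_ne_top {N : Submodule Uq' V} (hN : N ≠ ⊤) {y : Fock Kq}
    (hy : e y ∈ N) {p : ℕ × ℕ} (hs : p.1 ≤ s) (ht : p.2 ≤ t) : y p = 0 := by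
  by_contra hp
  have hstable := fockMod_stable hμ he N
  have htop := hstable.eq_top_of_single_zero_mem hμ <| hstable.single_zero_mem hμ
    (Int.ofNat_le.mpr hs) (Int.ofNat_le.mpr ht) (hstable.single_mem hμ hy hp)
  refine hN (eq_top_iff.mpr fun x _ => ?_)
  obtain ⟨y, rfl⟩ := e.surjective x
  exact htop.ge (Submodule.mem_top (x := y))

theorem le_range_resolutionMap {N : Submodule Uq' V} (hN : N ≠ ⊤) :
    N ≤ LinearMap.range (resolutionMap he he₁ he₂) := by
  intro x hx
  obtain ⟨y, rfl⟩ := e.surjective x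
  rw [mem_range_resolutionMap]
  intro p hp
  by_contra! hlt
  exact hp (he.apply_eq_zero_of_ne_top hN hx (by omega) (by omega))

theorem isCoatom_iff_eq_range_resolutionMap {N : Submodule Uq' V} :
    IsCoatom N ↔ N = LinearMap.range (resolutionMap he he₁ he₂) := by
  have hne : LinearMap.range (resolutionMap he he₁ he₂) ≠ ⊤ := fun h => by
    have hmem := (mem_range_resolutionMap he he₁ he₂).mp
      (h ▸ Submodule.mem_top (x := e (Finsupp.single (0, 0) 1))) (0, 0) (by simp)
    simp at hmem
  refine ⟨fun hN => (hN.le_iff.mp ?_).resolve_left hne |>.symm, ?_⟩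
  · exact le_range_resolutionMap he he₁ he₂ hN.1
  · rintro rfl
    exact ⟨hne, fun N hlt => by_contra fun hN =>
      hlt.not_ge (le_range_resolutionMap he he₁ he₂ hN)⟩

theorem finiteDimensional_quotient_range_resolutionMap :
    FiniteDimensional Kq (V ⧸ LinearMap.range (resolutionMap he he₁ he₂)) :=
  finiteDimensional_quotient_of_single_mem e _ fun p hp =>
    (mem_range_resolutionMap he he₁ he₂).mpr fun p' hp' => by
      rwa [(Finsupp.single_apply_ne_zero.mp hp').1]

end Resolution

/-! ### The parameters of the resolution -/

theorem IsGeneric.of_isGood {μ : Kq} (hμ : μ ≠ 0) (hgood : IsGood μ) : IsGeneric μ := by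
  refine ⟨hμ, fun l hzero => ?_⟩
  have hz : q ^ l * μ ≠ 0 := mul_ne_zero (zpow_ne_zero _ q_ne_zero) hμ
  have hiota : iota ^ 2 = -1 := by
    rw [iota, ← map_pow, Complex.I_sq, map_neg, map_one]
  have hsq : (q ^ l * μ) ^ 2 = iota ^ 2 := by
    rw [hiota]
    rw [symBracket] at hzero
    generalize q ^ l * μ = z at *
    field_simp at hzero
    linear_combination hzero
  have hdiv {y : Kq} (hy : q ^ l * μ = y) : μ = q ^ (-l) * y := by
    rw [← hy, zpow_neg, inv_mul_cancel_left₀ (zpow_ne_zero _ q_ne_zero)]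
  rcases sq_eq_sq_iff_eq_or_eq_neg.mp hsq with hpos | hneg
  · exact (hgood (-l)).1 (hdiv hpos)
  · exact (hgood (-l)).2 ((hdiv hneg).trans (mul_neg _ _))

section Zeta

variable (s t : ℤ) {μ : Kq} (hμ : μ ≠ 0)

theorem dominantZeta_eq_qbr : dominantZeta s t μ =
    qbr μ (s + t - 2 * s) - q ^ (-(s + t)) * qbr μ 0 := by
  rw [dominantZeta, qbr_eq_bracket, qbr_eq_bracket, zpow_zero, one_mul]
  ring_nf

include hμ in
theorem zeta1_eq_dominantZeta :
    zeta1 (s + t) μ s = dominantZeta (-s - 2) t (q ^ (-(s + 1)) * μ) := by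
  have h0 := q_ne_zero
  have h2 := q_sq_sub_one_ne_zero
  simp only [zeta1, dominantZeta, qint_eq_bracket, bracket, sub_eq_add_neg (_ : ℤ), neg_add,
    two_mul, neg_neg, zpow_add₀ h0, zpow_neg, zpow_ofNat]
  have hS := zpow_ne_zero s h0
  have hT := zpow_ne_zero t h0
  generalize q ^ s = S at *
  generalize q ^ t = T at *
  field_simp
  ring

include hμ in
theorem zeta2_eq_dominantZeta :
    zeta2 (s + t) μ t = dominantZeta s (-t - 2) (q ^ (t + 1) * μ) := by
  have h0 := q_ne_zero
  have h2 := q_sq_sub_one_ne_zero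
  simp only [zeta2, dominantZeta, qint_eq_bracket, bracket, sub_eq_add_neg (_ : ℤ), neg_add,
    two_mul, neg_neg, zpow_add₀ h0, zpow_neg, zpow_ofNat]
  have hS := zpow_ne_zero s h0
  have hT := zpow_ne_zero t h0
  generalize q ^ s = S at *
  generalize q ^ t = T at *
  field_simp
  ring

include hμ in
theorem zeta3_eq_dominantZeta :
    zeta3 (s + t) μ s = dominantZeta (-s - 2) (-t - 2) (q ^ (t - s) * μ) := by
  have h0 := q_ne_zero
  have h2 := q_sq_sub_one_ne_zero
  simp only [zeta3, dominantZeta, qint_eq_bracket, bracket, sub_eq_add_neg (_ : ℤ), neg_add,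
    neg_neg, zpow_add₀ h0, zpow_neg, zpow_ofNat]
  have hS := zpow_ne_zero s h0
  have hT := zpow_ne_zero t h0
  generalize q ^ s = S at *
  generalize q ^ t = T at *
  field_simp
  ring

end Zeta

end QSP

end

theorem corollary4p16 (kd k1 κ : ℤ) (hκ : κ = kd - k1) (μ ζ : QSP.Kq) (hμ : μ ≠ 0)
    (hgood : QSP.IsGood μ) (i : ℤ) (hi0 : 0 ≤ i) (hiκ : i ≤ κ)
    (hζ : ζ = QSP.qbr μ (κ - 2 * i) - QSP.q ^ (-κ) * QSP.qbr μ 0) :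
    (∃! N : Submodule QSP.Uq' (QSP.Verma kd k1 (QSP.qbr μ 0) ζ),
      IsSimpleModule QSP.Uq' (QSP.Verma kd k1 (QSP.qbr μ 0) ζ ⧸ N)) ∧
    ∀ N : Submodule QSP.Uq' (QSP.Verma kd k1 (QSP.qbr μ 0) ζ),
      IsSimpleModule QSP.Uq' (QSP.Verma kd k1 (QSP.qbr μ 0) ζ ⧸ N) →
      FiniteDimensional QSP.Kq (QSP.Verma kd k1 (QSP.qbr μ 0) ζ ⧸ N) ∧
      ∃ (f : QSP.Verma (k1 - 2) (kd + 2) (QSP.qbr μ (κ - 2 * i)) (QSP.zeta3 κ μ i) →ₗ[QSP.Uq']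
            QSP.Verma (kd - i - 1) (k1 + i + 1) (QSP.qbr μ (-(i + 1))) (QSP.zeta1 κ μ i) ×
            QSP.Verma (k1 + i - 1) (kd - i + 1) (QSP.qbr μ (κ - i + 1)) (QSP.zeta2 κ μ (κ - i)))
        (g : QSP.Verma (kd - i - 1) (k1 + i + 1) (QSP.qbr μ (-(i + 1))) (QSP.zeta1 κ μ i) ×
            QSP.Verma (k1 + i - 1) (kd - i + 1) (QSP.qbr μ (κ - i + 1)) (QSP.zeta2 κ μ (κ - i))
            →ₗ[QSP.Uq'] QSP.Verma kd k1 (QSP.qbr μ 0) ζ),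
        Function.Injective f ∧ Function.Exact f g ∧ Function.Exact g N.mkQ ∧
          Function.Surjective N.mkQ := by
  obtain ⟨s, rfl⟩ := Int.eq_ofNat_of_zero_le hi0
  obtain ⟨t, ht⟩ := Int.eq_ofNat_of_zero_le (sub_nonneg.mpr hiκ)
  obtain rfl : κ = s + t := by omega
  have hgen := QSP.IsGeneric.of_isGood hμ hgood
  rw [ht]
  obtain ⟨e, he⟩ := QSP.exists_isFock_verma (kd := kd) (ko := k1) (k1 := k1) (s := s) (t := t)
    (β := QSP.qbr μ 0) hgen (by omega) rfl (by rw [QSP.qbr_eq_bracket, zpow_zero, one_mul])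
    (hζ.trans (QSP.dominantZeta_eq_qbr s t).symm)
  obtain ⟨e₁, he₁⟩ := QSP.exists_isFock_verma (kd := kd - s - 1) (k1 := k1 + s + 1)
    (hgen.zpow_mul (-(s + 1))) (by omega) rfl (QSP.qbr_eq_bracket μ _)
    (QSP.zeta1_eq_dominantZeta s t hμ)
  obtain ⟨e₂, he₂⟩ := QSP.exists_isFock_verma (kd := k1 + s - 1) (ko := kd - s + 1)
    (k1 := k1 + t + 1) (hgen.zpow_mul (t + 1)) (by omega) (by omega) (QSP.qbr_eq_bracket μ _)
    (QSP.zeta2_eq_dominantZeta s t hμ)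
  obtain ⟨e₃, he₃⟩ := QSP.exists_isFock_verma (kd := k1 - 2) (ko := kd + 2)
    (k1 := k1 + s + t + 2) (β := QSP.qbr μ (s + t - 2 * s)) (hgen.zpow_mul (t - s)) (by omega)
    (by omega) (by rw [QSP.qbr_eq_bracket]; ring_nf) (QSP.zeta3_eq_dominantZeta s t hμ)
  simp only [isSimpleModule_iff_isCoatom, QSP.isCoatom_iff_eq_range_resolutionMap he he₁ he₂]
  refine ⟨⟨_, rfl, fun _ h => h⟩, ?_⟩
  rintro _ rfl
  exact ⟨QSP.finiteDimensional_quotient_range_resolutionMap he he₁ he₂,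
    QSP.syzygyMap he₁ he₂ he₃, QSP.resolutionMap he he₁ he₂, QSP.syzygyMap_injective he₁ he₂ he₃,
    QSP.syzygyMap_exact_resolutionMap he he₁ he₂ he₃, LinearMap.exact_map_mkQ_range _,
    Submodule.mkQ_surjective _⟩
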